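/- **Setting.** Fix a join-semilattice of security levels with a least element. Extended levels are $k$ or $k[k_c]$ (an array reference of level $k$ with content of extended level $k_c$; contents are invariant in the order). Let $P$ be a JVM program (instructions push, pop, load, store, binop, swap, goto, ifeq, return, new, getfield, putfield, newarray, arraylength, arrayload, arraystore, invoke, throw, with exception tables), each of whose methods is verified in the following sense: its code is non-empty, control and handlers stay inside the code, only declared local variables are used, and every program point is reachable from the entry. Let $\Gamma$ be a table of method policies, $\mathit{ft}$ a field policy, and $\mathit{at}_m(i)$ the content levels of the arrays created at the points $i$ of each method $m$. For each $m$ let $\mathrm{region}_m(i,\tau)$ be sets of program points such that every point of $\mathrm{region}_m(i,\tau)$ is reached from $i$ by one step with tag $\tau$ followed by steps inside the region. A JVM method is typable for a policy if there are a security environment $se$ (a level for each program point) and stack types $S_i$, with $S_0$ empty, such that for every step $i\mapsto^{\tau} j$ the transfer rules of the JVM non-interference type system of Barthe et al. give $i\vdash^{\tau} S_i\Rightarrow st'$ with $st'\le S_j$, and for every step that ends the method the corresponding rule $i\vdash^{\tau} S_i\Rightarrow$ applies. Typability of a DEX method is defined in the same way with the DEX transfer rules and register types $RT_p$ (unknown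 registers being the top element), where $RT_0$ is the assignment of the policy's levels to the local variables. A program is typable if each of its methods $m$ is typable for each of its policies $\Gamma_m[k]$. Let $\lfloor P\rfloor$ be the DEX program obtained from $P$ by the non-optimising translation: StartBlock (division into basic blocks), TraceParentChild (successors, primary successors and the additional blocks for moveresult, moveexception and return), Translate (the stack cell at height $n$ becomes the register $\mathit{locN}+n$), PickOrder (ordering of the blocks along traces) and Output (appending gotos, resolving labels, exception table). The translated region of $(\lfloor i\rfloor,\tau)$ consists of the instructions translating the points of $\mathrm{region}(i,\tau)$, together with the additional instructions that belong to it: an appended goto or a moveresult of a point of the region, or of $i$ itself if $\tau$ is normal; a moveexception reached by an exceptional step from a point of the region, or from $i$ with tag $\tau$; and the return block if the region contains a return. The levels $\mathit{at}$ are transported to the translated instructions. **Theorem.** If $P$ is typable with respect to $\Gamma,\mathit{ft},\mathit{at}$ and the regions $\mathrm{region}_m$, then $\lfloor P\rfloor$ is typable in the DEX type system with respect to the same $\Gamma$ and $\mathit{ft}$, the transported $\mathit{at}$ and the translated regions. More precisely, for every method $m$, every policy $\Gamma_m[k]$ and every JVM typing $(se,S)$ of $m$ for it, there are a security environment $se_1\le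 se$ for which $(se_1,S)$ is still a JVM typing, and a DEX typing $(se',RT)$ of $\lfloor m\rfloor$ for the same policy, such that $se'$ takes the value $se_1(i)$ at all instructions that translate the JVM instruction at $i$, and $RT$ at the first instruction of that translation is the flattening of $S_i$: the local variables have the levels of the policy, the register $\mathit{locN}+n$ has the level of the stack cell at height $n$, and all other registers are unconstrained. -/

import Mathlib

/-! ## Security levels -/

/-- Extended security levels: a plain level `k`, or `k[kc]`, the level `k` of an array reference
together with the extended level `kc` of the array's content. -/
inductive ExtLevel (S : Type*) where
  | base (k : S) : ExtLevel S
  | arr (k : S) (content : ExtLevel S) : ExtLevel S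

namespace ExtLevel

variable {S : Type*}

/-- The plain level of an extended level. When a plain level is compared with an extended level,
only the head matters. -/
def head : ExtLevel S → S
  | base k => k
  | arr k _ => k

/-- The partial order on extended levels: contents of arrays are invariant. -/
def Le [LE S] : ExtLevel S → ExtLevel S → Prop
  | base a, base b => a ≤ b
  | arr a c, arr b d => a ≤ b ∧ c = d
  | _, _ => False

/-- `k ⊔ e` for a plain level `k` and an extended level `e`. -/
def join [Max S] (k : S) : ExtLevel S → ExtLevel S
  | base a => base (k ⊔ a)
  | arr a c => arr (k ⊔ a) c

end ExtLevel

/-! ## Method policies and the data shared by both languages -/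

/-- Tags of execution steps: normal, or an exception of a class. -/
inductive Tag (C : Type*) where
  | norm : Tag C
  | exc (e : C) : Tag C

/-- A method policy `kₐ → kᵣ` with heap effect `kₕ`. `ka` gives the levels of the local variables
(on entry: of the receiver, at `0`, and of the parameters), `krNorm` the level of the value
returned and `krExc` the level of each escaping exception. -/
structure Policy (S C : Type*) where
  ka : ℕ → ExtLevel S
  kh : S
  krNorm : ExtLevel S
  krExc : C → S

/-- An entry of an exception table: it is active on `[startPC, endPC)`. -/
structure HandlerEntry (C : Type*) where
  startPC : ℕ
  endPC : ℕ
  handlerPC : ℕ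
  catchType : C
deriving DecidableEq

/-- Data of the program that both languages use: the class `np` of null pointer exceptions, the
relation "a handler for the first class catches the second", the exceptions that may escape a
method, and the number of arguments of a method (without the receiver). -/
structure Env (C M : Type*) where
  np : C
  catches : C → C → Bool
  excAnalysis : M → Finset C
  nbArguments : M → ℕ

/-- `Handler(i, e)`: the first entry of the table that is active at `i` and catches `e`. -/
def handlerOf {C M : Type*} (E : Env C M) (table : List (HandlerEntry C)) (i : ℕ) (e : C) :
    Option ℕ :=
  (table.find? fun h => decide (h.startPC ≤ i) && decide (i < h.endPC) &&
    E.catches h.catchType e).map HandlerEntry.handlerPC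

/-- The parameters of the typing judgements other than the program: method policies `Γ`, field
policy, the policy of the current method, the control dependence regions, the security
environment, and the content level of the arrays created at each program point. -/
structure Ctx (S C F M : Type*) where
  Γ : M → S → Policy S C
  ft : F → ExtLevel S
  sgn : Policy S C
  region : ℕ → Tag C → Set ℕ
  se : ℕ → S
  at' : ℕ → ExtLevel S

/-- `∀ j ∈ region(i, τ), k ≤ se(j)`. -/
def Ctx.Guards {S C F M : Type*} [LE S] (X : Ctx S C F M) (i : ℕ) (τ : Tag C) (k : S) : Prop :=
  ∀ j ∈ X.region i τ, k ≤ X.se j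

inductive BinOp where
  | add | sub | mul | div
deriving DecidableEq

/-- Element types of arrays. -/
inductive ElemType (C : Type*) where
  | int : ElemType C
  | obj (c : C) : ElemType C
  | array (t : ElemType C) : ElemType C

/-! ## JVM bytecode -/

inductive JInstr (C F M : Type*) where
  | push (n : ℤ)
  | pop
  | load (x : ℕ)
  | store (x : ℕ)
  | binop (op : BinOp)
  | swap
  | goto (t : ℕ)
  | ifeq (t : ℕ)
  | ret
  | new (c : C)
  | getfield (f : F)
  | putfield (f : F)
  | newarray (t : ElemType C)
  | arraylength
  | arrayload
  | arraystore
  | invoke (m : M)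
  | throw

/-- A JVM method: instructions (program points are indices, the entry is `0`), number of local
variables, exception table, and the classes a `throw` at a given point may throw. -/
structure JMethod (C F M : Type*) where
  code : List (JInstr C F M)
  locN : ℕ
  handlers : List (HandlerEntry C)
  classAnalysis : ℕ → Finset C

/-- The exception classes with which the instruction at `i` may end. -/
def JInstr.excTags {C F M : Type*} (E : Env C M) (P : JMethod C F M) (i : ℕ) :
    JInstr C F M → Set C
  | .getfield _ | .putfield _ | .arraylength | .arrayload | .arraystore => {E.np}
  | .invoke m => {e | e ∈ E.excAnalysis m ∨ e = E.np}
  | .throw => {e | e ∈ P.classAnalysis i ∨ e = E.np}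
  | _ => ∅

/-- Instructions whose normal execution continues at the next program point. -/
def JInstr.FallsThrough {C F M : Type*} : JInstr C F M → Prop
  | .goto _ | .ret | .throw => False
  | _ => True

/-- The successor relation `i ↦^τ j`. -/
inductive JSucc {C F M : Type*} (E : Env C M) (P : JMethod C F M) : ℕ → Tag C → ℕ → Prop
  | next {i : ℕ} {ins : JInstr C F M} :
      P.code[i]? = some ins → ins.FallsThrough → JSucc E P i .norm (i + 1)
  | goto {i t : ℕ} : P.code[i]? = some (.goto t) → JSucc E P i .norm t
  | ifeq {i t : ℕ} : P.code[i]? = some (.ifeq t) → JSucc E P i .norm t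
  | exc {i t : ℕ} {ins : JInstr C F M} {e : C} :
      P.code[i]? = some ins → e ∈ ins.excTags E P i → handlerOf E P.handlers i e = some t →
      JSucc E P i (.exc e) t

/-- `i ↦^τ`: the method may end at `i` with tag `τ`. -/
inductive JExit {C F M : Type*} (E : Env C M) (P : JMethod C F M) : ℕ → Tag C → Prop
  | ret {i : ℕ} : P.code[i]? = some .ret → JExit E P i .norm
  | exc {i : ℕ} {ins : JInstr C F M} {e : C} :
      P.code[i]? = some ins → e ∈ ins.excTags E P i → handlerOf E P.handlers i e = none →
      JExit E P i (.exc e)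

/-- Program points that can be reached from the entry point. -/
inductive JReachable {C F M : Type*} (E : Env C M) (P : JMethod C F M) : ℕ → Prop
  | entry : JReachable E P 0
  | step {i j : ℕ} {τ : Tag C} : JReachable E P i → JSucc E P i τ j → JReachable E P j

/-- What the translation takes for granted about its (verified) input: the code is not empty,
control stays inside the code, only declared local variables are used, and there is no dead code. -/
structure JMethod.Verified {C F M : Type*} (E : Env C M) (P : JMethod C F M) : Prop where
  nonempty : 0 < P.code.length
  succ_lt : ∀ i τ j, JSucc E P i τ j → j < P.code.length
  handler_lt : ∀ h ∈ P.handlers, h.handlerPC < P.code.length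
  load_lt : ∀ i x : ℕ, P.code[i]? = some (.load x) → x < P.locN
  store_lt : ∀ i x : ℕ, P.code[i]? = some (.store x) → x < P.locN
  reachable : ∀ i < P.code.length, JReachable E P i

/-- The points reached from `i` by a step with tag `τ` followed by steps inside `R`, all of them
(except `i`) in `R`. -/
inductive ReachedWithin {C F M : Type*} (E : Env C M) (P : JMethod C F M) (R : Set ℕ)
    (i : ℕ) (τ : Tag C) : ℕ → Prop
  | first {j : ℕ} : JSucc E P i τ j → j ∈ R → ReachedWithin E P R i τ j
  | step {j k : ℕ} {τ' : Tag C} :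
      ReachedWithin E P R i τ j → JSucc E P j τ' k → k ∈ R → ReachedWithin E P R i τ k

/-- `region(i, τ)` consists of points that are executed under the control of a step from `i` with
tag `τ`. -/
def IsControlRegion {C F M : Type*} (E : Env C M) (P : JMethod C F M)
    (region : ℕ → Tag C → Set ℕ) : Prop :=
  ∀ i τ, ∀ j ∈ region i τ, ReachedWithin E P (region i τ) i τ j

/-! ## The JVM type system -/

/-- Stack types, top of the stack first. -/
abbrev StackType (S : Type*) := List (ExtLevel S)

/-- Pointwise order on stack types (of equal height). -/
def StackType.Le {S : Type*} [LE S] (st st' : StackType S) : Prop := List.Forall₂ ExtLevel.Le st st'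

/-- `lift_k(st)`. -/
def StackType.lift {S : Type*} [Max S] (k : S) (st : StackType S) : StackType S := st.map (ExtLevel.join k)

section JVMTyping

variable {S C F M : Type*} [SemilatticeSup S] [OrderBot S]

/-- The conditions on the call of a method with policy `pol`, common to all rules for `invoke`: the
arguments `st₁` (top of the stack first) and the receiver level `k`. -/
def JCallOk (E : Env C M) (X : Ctx S C F M) (i : ℕ) (mid : M) (pol : Policy S C)
    (st₁ : StackType S) (k : S) : Prop :=
  st₁.length = E.nbArguments mid ∧
  (∀ (t : ℕ) (a : ExtLevel S), st₁[t]? = some a → a.Le (pol.ka (t + 1))) ∧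
  (ExtLevel.base k).Le (pol.ka 0) ∧
  k ⊔ X.sgn.kh ⊔ X.se i ≤ pol.kh

/-- The level `kₑ`: the join of the levels of the exceptions that may escape the method. -/
def escapeLevel (E : Env C M) (mid : M) (pol : Policy S C) : S :=
  (E.excAnalysis mid).sup pol.krExc

/-- The transfer rules `i ⊢^τ st ⇒ st'`. -/
inductive JTrans (E : Env C M) (P : JMethod C F M) (X : Ctx S C F M) (i : ℕ) :
    Tag C → StackType S → StackType S → Prop
  | push {n : ℤ} {st} : P.code[i]? = some (.push n) →
      JTrans E P X i .norm st (.base (X.se i) :: st)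
  | pop {k st} : P.code[i]? = some .pop → JTrans E P X i .norm (k :: st) st
  | load {x : ℕ} {st} : P.code[i]? = some (.load x) →
      JTrans E P X i .norm st ((X.sgn.ka x).join (X.se i) :: st)
  | store {x : ℕ} {k : ExtLevel S} {st} : P.code[i]? = some (.store x) →
      (k.join (X.se i)).Le (X.sgn.ka x) →
      JTrans E P X i .norm (k :: st) st
  | binop {op} {k₁ k₂ : S} {st} : P.code[i]? = some (.binop op) →
      JTrans E P X i .norm (.base k₁ :: .base k₂ :: st) (.base (k₁ ⊔ k₂ ⊔ X.se i) :: st)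
  | swap {k₁ k₂ st} : P.code[i]? = some .swap →
      JTrans E P X i .norm (k₁ :: k₂ :: st) (k₂ :: k₁ :: st)
  | goto {t : ℕ} {st} : P.code[i]? = some (.goto t) → JTrans E P X i .norm st st
  | ifeq {t : ℕ} {k : ExtLevel S} {st} : P.code[i]? = some (.ifeq t) →
      X.Guards i .norm k.head →
      JTrans E P X i .norm (k :: st) (StackType.lift k.head st)
  | new {c : C} {st} : P.code[i]? = some (.new c) →
      JTrans E P X i .norm st (.base (X.se i) :: st)
  | getfield {f : F} {k : S} {st} : P.code[i]? = some (.getfield f) →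
      X.Guards i .norm k →
      JTrans E P X i .norm (.base k :: st)
        (StackType.lift k ((X.ft f).join (k ⊔ X.se i) :: st))
  | getfieldNp {f : F} {k : S} {t : ℕ} {st} : P.code[i]? = some (.getfield f) →
      X.Guards i (.exc E.np) k → handlerOf E P.handlers i E.np = some t →
      JTrans E P X i (.exc E.np) (.base k :: st) [.base (k ⊔ X.se i)]
  | putfield {f : F} {k₁ : ExtLevel S} {k₂ : S} {st} : P.code[i]? = some (.putfield f) →
      (k₁.join (X.se i ⊔ k₂)).Le (X.ft f) → X.sgn.kh ≤ (X.ft f).head →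
      X.Guards i .norm k₂ →
      JTrans E P X i .norm (k₁ :: .base k₂ :: st) (StackType.lift k₂ st)
  | putfieldNp {f : F} {k₁ : ExtLevel S} {k₂ : S} {t : ℕ} {st} : P.code[i]? = some (.putfield f) →
      (k₁.join (X.se i ⊔ k₂)).Le (X.ft f) →
      X.Guards i (.exc E.np) k₂ → handlerOf E P.handlers i E.np = some t →
      JTrans E P X i (.exc E.np) (k₁ :: .base k₂ :: st) [.base (k₂ ⊔ X.se i)]
  | newarray {t : ElemType C} {k : S} {st} : P.code[i]? = some (.newarray t) →
      JTrans E P X i .norm (.base k :: st) (.arr k (X.at' i) :: st)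
  | arraylength {k : S} {kc : ExtLevel S} {st} : P.code[i]? = some .arraylength →
      X.Guards i .norm k →
      JTrans E P X i .norm (.arr k kc :: st) (StackType.lift k (.base k :: st))
  | arraylengthNp {k : S} {kc : ExtLevel S} {t : ℕ} {st} : P.code[i]? = some .arraylength →
      X.Guards i (.exc E.np) k → handlerOf E P.handlers i E.np = some t →
      JTrans E P X i (.exc E.np) (.arr k kc :: st) [.base (k ⊔ X.se i)]
  | arrayload {k₁ k₂ : S} {kc : ExtLevel S} {st} : P.code[i]? = some .arrayload →
      X.Guards i .norm k₂ →
      JTrans E P X i .norm (.base k₁ :: .arr k₂ kc :: st)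
        (StackType.lift k₂ (kc.join (k₁ ⊔ k₂) :: st))
  | arrayloadNp {k₁ k₂ : S} {kc : ExtLevel S} {t : ℕ} {st} : P.code[i]? = some .arrayload →
      X.Guards i (.exc E.np) k₂ → handlerOf E P.handlers i E.np = some t →
      JTrans E P X i (.exc E.np) (.base k₁ :: .arr k₂ kc :: st) [.base (k₂ ⊔ X.se i)]
  | arraystore {k₁ : ExtLevel S} {k₂ k₃ : S} {kc : ExtLevel S} {st} : P.code[i]? = some .arraystore →
      (k₁.join (k₂ ⊔ k₃)).Le kc →
      X.Guards i .norm k₃ →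
      JTrans E P X i .norm (k₁ :: .base k₂ :: .arr k₃ kc :: st) (StackType.lift k₃ st)
  | arraystoreNp {k₁ : ExtLevel S} {k₂ k₃ : S} {kc : ExtLevel S} {t : ℕ} {st} :
      P.code[i]? = some .arraystore →
      (k₁.join (k₂ ⊔ k₃)).Le kc →
      X.Guards i (.exc E.np) k₃ → handlerOf E P.handlers i E.np = some t →
      JTrans E P X i (.exc E.np) (k₁ :: .base k₂ :: .arr k₃ kc :: st) [.base (k₃ ⊔ X.se i)]
  | invoke {mid : M} {st₁ : StackType S} {k : S} {st₂} : P.code[i]? = some (.invoke mid) →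
      JCallOk E X i mid (X.Γ mid k) st₁ k →
      X.Guards i .norm (k ⊔ escapeLevel E mid (X.Γ mid k)) →
      JTrans E P X i .norm (st₁ ++ .base k :: st₂)
        (StackType.lift (k ⊔ escapeLevel E mid (X.Γ mid k))
          ((X.Γ mid k).krNorm.join (X.se i) :: st₂))
  | invokeExc {mid : M} {st₁ : StackType S} {k : S} {e : C} {t : ℕ} {st₂} :
      P.code[i]? = some (.invoke mid) →
      JCallOk E X i mid (X.Γ mid k) st₁ k →
      (e ∈ E.excAnalysis mid ∨ e = E.np) → handlerOf E P.handlers i e = some t →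
      X.Guards i (.exc e) (k ⊔ (X.Γ mid k).krExc e) →
      JTrans E P X i (.exc e) (st₁ ++ .base k :: st₂) [.base (k ⊔ (X.Γ mid k).krExc e)]
  | throw {k : ExtLevel S} {e : C} {t : ℕ} {st} : P.code[i]? = some .throw →
      (e ∈ P.classAnalysis i ∨ e = E.np) →
      X.Guards i (.exc e) k.head → handlerOf E P.handlers i e = some t →
      JTrans E P X i (.exc e) (k :: st) [k.join (X.se i)]

/-- The transfer rules `i ⊢^τ st ⇒` for the steps that end the method. -/
inductive JTransExit (E : Env C M) (P : JMethod C F M) (X : Ctx S C F M) (i : ℕ) :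
    Tag C → StackType S → Prop
  | ret {k : ExtLevel S} {st} : P.code[i]? = some .ret →
      (k.join (X.se i)).Le X.sgn.krNorm → JTransExit E P X i .norm (k :: st)
  | getfield {f : F} {k : S} {st} : P.code[i]? = some (.getfield f) →
      X.Guards i (.exc E.np) k → handlerOf E P.handlers i E.np = none →
      k ≤ X.sgn.krExc E.np →
      JTransExit E P X i (.exc E.np) (.base k :: st)
  | putfield {f : F} {k₁ : ExtLevel S} {k₂ : S} {st} : P.code[i]? = some (.putfield f) →
      (k₁.join (X.se i ⊔ k₂)).Le (X.ft f) →
      X.Guards i (.exc E.np) k₂ → handlerOf E P.handlers i E.np = none →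
      k₂ ≤ X.sgn.krExc E.np →
      JTransExit E P X i (.exc E.np) (k₁ :: .base k₂ :: st)
  | arraylength {k : S} {kc : ExtLevel S} {st} : P.code[i]? = some .arraylength →
      X.Guards i (.exc E.np) k → handlerOf E P.handlers i E.np = none →
      k ≤ X.sgn.krExc E.np →
      JTransExit E P X i (.exc E.np) (.arr k kc :: st)
  | arrayload {k₁ k₂ : S} {kc : ExtLevel S} {st} : P.code[i]? = some .arrayload →
      X.Guards i (.exc E.np) k₂ → handlerOf E P.handlers i E.np = none →
      k₂ ≤ X.sgn.krExc E.np →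
      JTransExit E P X i (.exc E.np) (.base k₁ :: .arr k₂ kc :: st)
  | arraystore {k₁ : ExtLevel S} {k₂ k₃ : S} {kc : ExtLevel S} {st} : P.code[i]? = some .arraystore →
      (k₁.join (k₂ ⊔ k₃)).Le kc →
      X.Guards i (.exc E.np) k₃ → handlerOf E P.handlers i E.np = none →
      k₃ ≤ X.sgn.krExc E.np →
      JTransExit E P X i (.exc E.np) (k₁ :: .base k₂ :: .arr k₃ kc :: st)
  | invoke {mid : M} {st₁ : StackType S} {k : S} {e : C} {st₂} :
      P.code[i]? = some (.invoke mid) →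
      JCallOk E X i mid (X.Γ mid k) st₁ k →
      k ⊔ X.se i ⊔ (X.Γ mid k).krExc e ≤ X.sgn.krExc e →
      (e ∈ E.excAnalysis mid ∨ e = E.np) → handlerOf E P.handlers i e = none →
      X.Guards i (.exc e) (k ⊔ (X.Γ mid k).krExc e) →
      JTransExit E P X i (.exc e) (st₁ ++ .base k :: st₂)
  | throw {k : ExtLevel S} {e : C} {st} : P.code[i]? = some .throw →
      (e ∈ P.classAnalysis i ∨ e = E.np) →
      k.head ≤ X.sgn.krExc e →
      X.Guards i (.exc e) k.head → handlerOf E P.handlers i e = none →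
      JTransExit E P X i (.exc e) (k :: st)

/-- The assignment `st` of stack types to program points is a typing of the method `P` (with
respect to the policies, regions and security environment in `X`). -/
structure JTyping (E : Env C M) (P : JMethod C F M) (X : Ctx S C F M) (st : ℕ → StackType S) :
    Prop where
  entry : st 0 = []
  step : ∀ i τ j, JSucc E P i τ j → ∃ st', JTrans E P X i τ (st i) st' ∧ st'.Le (st j)
  exit : ∀ i τ, JExit E P i τ → JTransExit E P X i τ (st i)

end JVMTyping

/-! ## DEX bytecode -/

/-- Registers: the numbered ones and the two pseudo-registers for the result of a call and for a
caught exception. -/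
inductive Reg where
  | r (n : ℕ)
  | ret
  | ex
deriving DecidableEq

/-- DEX instructions with jump targets in `T`; registers are given by their numbers. -/
inductive DInstr (C F M T : Type*) where
  | const (r : ℕ) (n : ℤ)
  | move (r rs : ℕ)
  | binop (op : BinOp) (r ra rb : ℕ)
  | goto (t : T)
  | ifeq (r : ℕ) (t : T)
  | ifneq (r : ℕ) (t : T)
  | ret (rs : ℕ)
  | new (r : ℕ) (c : C)
  | iget (r ro : ℕ) (f : F)
  | iput (rs ro : ℕ) (f : F)
  | newarray (r rl : ℕ) (t : ElemType C)
  | arraylength (r ra : ℕ)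
  | aget (r ra ri : ℕ)
  | aput (rs ra ri : ℕ)
  | invoke (n : ℕ) (m : M) (p : List ℕ)
  | moveresult (r : ℕ)
  | throw (r : ℕ)
  | moveexception (r : ℕ)

structure DMethod (C F M : Type*) where
  code : List (DInstr C F M ℕ)
  locN : ℕ
  handlers : List (HandlerEntry C)
  classAnalysis : ℕ → Finset C

def DInstr.excTags {C F M T : Type*} (E : Env C M) (D : DMethod C F M) (p : ℕ) :
    DInstr C F M T → Set C
  | .iget .. | .iput .. | .arraylength .. | .aget .. | .aput .. => {E.np}
  | .invoke _ m _ => {e | e ∈ E.excAnalysis m ∨ e = E.np}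
  | .throw _ => {e | e ∈ D.classAnalysis p ∨ e = E.np}
  | _ => ∅

def DInstr.FallsThrough {C F M T : Type*} : DInstr C F M T → Prop
  | .goto _ | .ret _ | .throw _ => False
  | _ => True

/-- The successor relation `p ↦^τ q`. -/
inductive DSucc {C F M : Type*} (E : Env C M) (D : DMethod C F M) : ℕ → Tag C → ℕ → Prop
  | next {p : ℕ} {ins : DInstr C F M ℕ} :
      D.code[p]? = some ins → ins.FallsThrough → DSucc E D p .norm (p + 1)
  | goto {p t : ℕ} : D.code[p]? = some (.goto t) → DSucc E D p .norm t
  | ifeq {p r t : ℕ} : D.code[p]? = some (.ifeq r t) → DSucc E D p .norm t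
  | ifneq {p r t : ℕ} : D.code[p]? = some (.ifneq r t) → DSucc E D p .norm t
  | exc {p t : ℕ} {ins : DInstr C F M ℕ} {e : C} :
      D.code[p]? = some ins → e ∈ ins.excTags E D p → handlerOf E D.handlers p e = some t →
      DSucc E D p (.exc e) t

/-- `p ↦^τ`: the method may end at `p` with tag `τ`. -/
inductive DExit {C F M : Type*} (E : Env C M) (D : DMethod C F M) : ℕ → Tag C → Prop
  | ret {p rs : ℕ} : D.code[p]? = some (.ret rs) → DExit E D p .norm
  | exc {p : ℕ} {ins : DInstr C F M ℕ} {e : C} :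
      D.code[p]? = some ins → e ∈ ins.excTags E D p → handlerOf E D.handlers p e = none →
      DExit E D p (.exc e)

/-! ## The DEX type system -/

/-- Register types. The value `none` is the top element: nothing is known about the register, and
it cannot be read. -/
abbrev RegType (S : Type*) := Reg → Option (ExtLevel S)

/-- Pointwise order on register types, `none` being the greatest element. -/
def RegType.Le {S : Type*} [LE S] (rt rt' : RegType S) : Prop :=
  ∀ r b, rt' r = some b → ∃ a, rt r = some a ∧ a.Le b

/-- `rt ⊕ {r ↦ k}`. -/
def RegType.set {S : Type*} (rt : RegType S) (r : Reg) (k : ExtLevel S) : RegType S :=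
  Function.update rt r (some k)

/-- The policy `kₐ` as a register type: the local variables are the registers below `locN`. -/
def Policy.regs {S C : Type*} (pol : Policy S C) (locN : ℕ) : RegType S
  | .r n => if n < locN then some (pol.ka n) else none
  | _ => none

section DEXTyping

variable {S C F M : Type*} [SemilatticeSup S] [OrderBot S]

/-- The conditions on the call of a method with policy `pol`, common to all rules for `invoke`:
`args` are the registers of the receiver (of level `k`) and of the `n - 1` arguments. -/
def DCallOk (X : Ctx S C F M) (p : ℕ) (pol : Policy S C) (rt : RegType S) (n : ℕ)
    (args : List ℕ) (k : S) : Prop :=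
  args.length = n ∧
  (∃ r₀, args[0]? = some r₀ ∧ rt (.r r₀) = some (.base k)) ∧
  k ⊔ X.sgn.kh ⊔ X.se p ≤ pol.kh ∧
  ∀ t r, args[t]? = some r → ∃ a, rt (.r r) = some a ∧ a.Le (pol.ka t)

/-- The transfer rules `p ⊢^τ rt ⇒ rt'`. -/
inductive DTrans (E : Env C M) (D : DMethod C F M) (X : Ctx S C F M) (p : ℕ) :
    Tag C → RegType S → RegType S → Prop
  | const {r n rt} : D.code[p]? = some (.const r n) →
      DTrans E D X p .norm rt (rt.set (.r r) (.base (X.se p)))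
  | move {r rs rt a} : D.code[p]? = some (.move r rs) → rt (.r rs) = some a →
      DTrans E D X p .norm rt (rt.set (.r r) (a.join (X.se p)))
  | binop {op r ra rb rt} {a b : S} : D.code[p]? = some (.binop op r ra rb) →
      rt (.r ra) = some (.base a) → rt (.r rb) = some (.base b) →
      DTrans E D X p .norm rt (rt.set (.r r) (.base (a ⊔ b ⊔ X.se p)))
  | goto {t rt} : D.code[p]? = some (.goto t) → DTrans E D X p .norm rt rt
  | ifeq {r t rt a} : D.code[p]? = some (.ifeq r t) → rt (.r r) = some a →
      X.Guards p .norm (X.se p ⊔ a.head) → DTrans E D X p .norm rt rt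
  | ifneq {r t rt a} : D.code[p]? = some (.ifneq r t) → rt (.r r) = some a →
      X.Guards p .norm (X.se p ⊔ a.head) → DTrans E D X p .norm rt rt
  | new {r c rt} : D.code[p]? = some (.new r c) →
      DTrans E D X p .norm rt (rt.set (.r r) (.base (X.se p)))
  | iget {r ro f rt} {k : S} : D.code[p]? = some (.iget r ro f) → rt (.r ro) = some (.base k) →
      X.Guards p .norm k →
      DTrans E D X p .norm rt (rt.set (.r r) ((X.ft f).join (k ⊔ X.se p)))
  | igetNp {r ro f rt t} {k : S} : D.code[p]? = some (.iget r ro f) →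
      rt (.r ro) = some (.base k) →
      X.Guards p (.exc E.np) k → handlerOf E D.handlers p E.np = some t →
      DTrans E D X p (.exc E.np) rt ((X.sgn.regs D.locN).set .ex (.base (k ⊔ X.se p)))
  | iput {rs ro f rt a} {k : S} : D.code[p]? = some (.iput rs ro f) →
      rt (.r rs) = some a → rt (.r ro) = some (.base k) →
      (a.join (k ⊔ X.se p)).Le (X.ft f) → X.sgn.kh ≤ (X.ft f).head →
      X.Guards p .norm k →
      DTrans E D X p .norm rt rt
  | iputNp {rs ro f rt t a} {k : S} : D.code[p]? = some (.iput rs ro f) →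
      rt (.r rs) = some a → rt (.r ro) = some (.base k) →
      (a.join (k ⊔ X.se p)).Le (X.ft f) →
      X.Guards p (.exc E.np) k → handlerOf E D.handlers p E.np = some t →
      DTrans E D X p (.exc E.np) rt ((X.sgn.regs D.locN).set .ex (.base (k ⊔ X.se p)))
  | newarray {r rl t rt} {k : S} : D.code[p]? = some (.newarray r rl t) →
      rt (.r rl) = some (.base k) →
      DTrans E D X p .norm rt (rt.set (.r r) (.arr k (X.at' p)))
  | arraylength {r ra rt} {k : S} {kc : ExtLevel S} : D.code[p]? = some (.arraylength r ra) →
      rt (.r ra) = some (.arr k kc) → X.Guards p .norm k →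
      DTrans E D X p .norm rt (rt.set (.r r) (.base k))
  | arraylengthNp {r ra rt t} {k : S} {kc : ExtLevel S} : D.code[p]? = some (.arraylength r ra) →
      rt (.r ra) = some (.arr k kc) →
      X.Guards p (.exc E.np) k → handlerOf E D.handlers p E.np = some t →
      DTrans E D X p (.exc E.np) rt ((X.sgn.regs D.locN).set .ex (.base (k ⊔ X.se p)))
  | aget {r ra ri rt} {k k' : S} {kc : ExtLevel S} : D.code[p]? = some (.aget r ra ri) →
      rt (.r ra) = some (.arr k kc) → rt (.r ri) = some (.base k') →
      X.Guards p .norm k →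
      DTrans E D X p .norm rt (rt.set (.r r) (kc.join (X.se p ⊔ k ⊔ k')))
  | agetNp {r ra ri rt t} {k k' : S} {kc : ExtLevel S} : D.code[p]? = some (.aget r ra ri) →
      rt (.r ra) = some (.arr k kc) → rt (.r ri) = some (.base k') →
      X.Guards p (.exc E.np) k → handlerOf E D.handlers p E.np = some t →
      DTrans E D X p (.exc E.np) rt ((X.sgn.regs D.locN).set .ex (.base (k ⊔ X.se p)))
  | aput {rs ra ri rt a} {k k' : S} {kc : ExtLevel S} : D.code[p]? = some (.aput rs ra ri) →
      rt (.r ra) = some (.arr k kc) → rt (.r ri) = some (.base k') → rt (.r rs) = some a →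
      (a.join (k ⊔ k')).Le kc → X.Guards p .norm k →
      DTrans E D X p .norm rt rt
  | aputNp {rs ra ri rt t a} {k k' : S} {kc : ExtLevel S} : D.code[p]? = some (.aput rs ra ri) →
      rt (.r ra) = some (.arr k kc) → rt (.r ri) = some (.base k') → rt (.r rs) = some a →
      (a.join (k ⊔ k')).Le kc →
      X.Guards p (.exc E.np) k → handlerOf E D.handlers p E.np = some t →
      DTrans E D X p (.exc E.np) rt ((X.sgn.regs D.locN).set .ex (.base (k ⊔ X.se p)))
  | invoke {n mid args rt} {k : S} : D.code[p]? = some (.invoke n mid args) →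
      DCallOk X p (X.Γ mid k) rt n args k →
      X.Guards p .norm (k ⊔ escapeLevel E mid (X.Γ mid k)) →
      DTrans E D X p .norm rt (rt.set .ret ((X.Γ mid k).krNorm.join (X.se p)))
  | invokeExc {n mid args rt e t} {k : S} : D.code[p]? = some (.invoke n mid args) →
      DCallOk X p (X.Γ mid k) rt n args k →
      (e ∈ E.excAnalysis mid ∨ e = E.np) → handlerOf E D.handlers p e = some t →
      X.Guards p (.exc e) (k ⊔ (X.Γ mid k).krExc e) →
      DTrans E D X p (.exc e) rt
        ((X.sgn.regs D.locN).set .ex (.base (k ⊔ (X.Γ mid k).krExc e)))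
  | moveresult {r rt a} : D.code[p]? = some (.moveresult r) → rt .ret = some a →
      DTrans E D X p .norm rt (rt.set (.r r) (a.join (X.se p)))
  | throw {r rt a e t} : D.code[p]? = some (.throw r) → rt (.r r) = some a →
      (e ∈ D.classAnalysis p ∨ e = E.np) →
      X.Guards p (.exc e) a.head → handlerOf E D.handlers p e = some t →
      DTrans E D X p (.exc e) rt (rt.set .ex (a.join (X.se p)))
  | moveexception {r rt a} : D.code[p]? = some (.moveexception r) → rt .ex = some a →
      DTrans E D X p .norm rt (rt.set (.r r) (a.join (X.se p)))

/-- The transfer rules `p ⊢^τ rt ⇒` for the steps that end the method. -/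
inductive DTransExit (E : Env C M) (D : DMethod C F M) (X : Ctx S C F M) (p : ℕ) :
    Tag C → RegType S → Prop
  | ret {rs rt a} : D.code[p]? = some (.ret rs) → rt (.r rs) = some a →
      (a.join (X.se p)).Le X.sgn.krNorm → DTransExit E D X p .norm rt
  | iget {r ro f rt} {k : S} : D.code[p]? = some (.iget r ro f) → rt (.r ro) = some (.base k) →
      X.Guards p (.exc E.np) k → handlerOf E D.handlers p E.np = none →
      X.se p ⊔ k ≤ X.sgn.krExc E.np →
      DTransExit E D X p (.exc E.np) rt
  | iput {rs ro f rt a} {k : S} : D.code[p]? = some (.iput rs ro f) →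
      rt (.r rs) = some a → rt (.r ro) = some (.base k) →
      (a.join (k ⊔ X.se p)).Le (X.ft f) →
      X.Guards p (.exc E.np) k → handlerOf E D.handlers p E.np = none →
      X.se p ⊔ k ≤ X.sgn.krExc E.np →
      DTransExit E D X p (.exc E.np) rt
  | arraylength {r ra rt} {k : S} {kc : ExtLevel S} : D.code[p]? = some (.arraylength r ra) →
      rt (.r ra) = some (.arr k kc) →
      X.Guards p (.exc E.np) k → handlerOf E D.handlers p E.np = none →
      X.se p ⊔ k ≤ X.sgn.krExc E.np →
      DTransExit E D X p (.exc E.np) rt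
  | aget {r ra ri rt} {k k' : S} {kc : ExtLevel S} : D.code[p]? = some (.aget r ra ri) →
      rt (.r ra) = some (.arr k kc) → rt (.r ri) = some (.base k') →
      X.Guards p (.exc E.np) k → handlerOf E D.handlers p E.np = none →
      X.se p ⊔ k ≤ X.sgn.krExc E.np →
      DTransExit E D X p (.exc E.np) rt
  | aput {rs ra ri rt a} {k k' : S} {kc : ExtLevel S} : D.code[p]? = some (.aput rs ra ri) →
      rt (.r ra) = some (.arr k kc) → rt (.r ri) = some (.base k') → rt (.r rs) = some a →
      (a.join (k ⊔ k')).Le kc →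
      X.Guards p (.exc E.np) k → handlerOf E D.handlers p E.np = none →
      X.se p ⊔ k ≤ X.sgn.krExc E.np →
      DTransExit E D X p (.exc E.np) rt
  | invoke {n mid args rt e} {k : S} : D.code[p]? = some (.invoke n mid args) →
      DCallOk X p (X.Γ mid k) rt n args k →
      k ⊔ X.se p ⊔ (X.Γ mid k).krExc e ≤ X.sgn.krExc e →
      (e ∈ E.excAnalysis mid ∨ e = E.np) → handlerOf E D.handlers p e = none →
      X.Guards p (.exc e) (k ⊔ (X.Γ mid k).krExc e) →
      DTransExit E D X p (.exc e) rt
  | throw {r rt a e} : D.code[p]? = some (.throw r) → rt (.r r) = some a →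
      (e ∈ D.classAnalysis p ∨ e = E.np) →
      X.Guards p (.exc e) a.head → handlerOf E D.handlers p e = none →
      X.se p ⊔ a.head ≤ X.sgn.krExc e →
      DTransExit E D X p (.exc e) rt

/-- The assignment `rt` of register types to program points is a typing of the method `D`. -/
structure DTyping (E : Env C M) (D : DMethod C F M) (X : Ctx S C F M) (rt : ℕ → RegType S) :
    Prop where
  entry : rt 0 = X.sgn.regs D.locN
  step : ∀ p τ q, DSucc E D p τ q → ∃ rt', DTrans E D X p τ (rt p) rt' ∧ rt'.Le (rt q)
  exit : ∀ p τ, DExit E D p τ → DTransExit E D X p τ (rt p)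

end DEXTyping

/-! ## The translation -/

/-- Labels of basic blocks: the block that starts at a JVM program point, the block with the
`moveresult` of the `invoke` at a point, the block with the `moveexception` in front of the handler
at a point, and the return block. -/
inductive Label where
  | insn (i : ℕ)
  | result (i : ℕ)
  | handler (h : ℕ)
  | ret
deriving DecidableEq

/-- Where an output instruction comes from. `insn i k` is the `k`-th instruction of the translation
of the JVM instruction at `i`; `jump i` is a `goto` appended to a block whose last JVM instruction is
at `i`; `result`, `handler` and `ret` are the instructions of the additional blocks (with the
appended `goto`s). -/
inductive Origin where
  | insn (i k : ℕ)
  | jump (i : ℕ)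
  | result (i : ℕ)
  | handler (h : ℕ)
  | ret
deriving DecidableEq

namespace JMethod

variable {C F M : Type*}

/-- The possibly throwing instructions. -/
def mayThrow (P : JMethod C F M) (i : ℕ) : Bool :=
  match P.code[i]? with
  | some (.getfield _) | some (.putfield _) | some .arraylength | some .arrayload
  | some .arraystore | some (.invoke _) | some .throw => true
  | _ => false

/-- The exception handlers associated with `i`. -/
def handlersAt (P : JMethod C F M) (i : ℕ) : List (HandlerEntry C) :=
  P.handlers.filter fun h => decide (h.startPC ≤ i) && decide (i < h.endPC)

/-! ### StartBlock -/

/-- The program points that the instruction at `j` makes the start of a block. -/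
def marks (P : JMethod C F M) (j : ℕ) : List ℕ :=
  match P.code[j]? with
  | some (.goto t) => [t]
  | some (.ifeq t) => [t, j + 1]
  | some .ret => [j + 1]
  | _ => if P.mayThrow j then
      (j + 1) :: (P.handlersAt j).flatMap fun h => [h.startPC, h.endPC, h.handlerPC]
    else []

def isStart (P : JMethod C F M) (i : ℕ) : Bool :=
  decide (i < P.code.length) &&
    (decide (i = 0) || (List.range P.code.length).any fun j => (P.marks j).contains i)

/-- The start of the block that contains `i`. -/
def pmap (P : JMethod C F M) : ℕ → ℕ
  | 0 => 0
  | i + 1 => if P.isStart (i + 1) then i + 1 else P.pmap i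

/-- The program points of the block that starts at `b`. -/
def blockPoints (P : JMethod C F M) (b : ℕ) : List ℕ :=
  (List.range P.code.length).filter fun i => P.pmap i == b

def lastPoint (P : JMethod C F M) (b : ℕ) : ℕ := (P.blockPoints b).getLast?.getD b

/-- The program points with a handler that is associated with some throwing instruction. -/
def usedHandlers (P : JMethod C F M) : List ℕ :=
  (List.range P.code.length).filter fun h => (List.range P.code.length).any fun i =>
    P.mayThrow i && (P.handlersAt i).any fun x => x.handlerPC == h

/-- All blocks. -/
def labels (P : JMethod C F M) : List Label :=
  ((List.range P.code.length).filter P.isStart).map .insn ++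
  ((List.range P.code.length).filter fun i =>
    match P.code[i]? with | some (.invoke _) => true | _ => false).map .result ++
  P.usedHandlers.map .handler ++
  (if (List.range P.code.length).any fun i =>
    match P.code[i]? with | some .ret => true | _ => false then [.ret] else [])

/-! ### TraceParentChild -/

/-- The primary successor of a block, if there is one. -/
def pSucc (P : JMethod C F M) : Label → Option Label
  | .insn b =>
    match P.code[P.lastPoint b]? with
    | some (.goto t) => some (.insn t)
    | some .ret => some .ret
    | some (.invoke _) => some (.result (P.lastPoint b))
    | some .throw => none
    | _ => some (.insn (P.lastPoint b + 1))
  | .result i => some (.insn (i + 1))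
  | .handler h => some (.insn h)
  | .ret => none

/-- The handlers of a block: those of its last instruction, if that may throw. -/
def blockHandlers (P : JMethod C F M) : Label → List (HandlerEntry C)
  | .insn b => if P.mayThrow (P.lastPoint b) then P.handlersAt (P.lastPoint b) else []
  | _ => []

/-- The successors of a block: the primary one, the target of a final `ifeq`, and the blocks in
front of its handlers. -/
def succs (P : JMethod C F M) (l : Label) : List Label :=
  (P.pSucc l).toList ++
  (match l with
    | .insn b => (match P.code[P.lastPoint b]? with
      | some (.ifeq t) => [.insn t]
      | _ => [])
    | _ => []) ++
  (P.blockHandlers l).map fun h => .handler h.handlerPC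

def parents (P : JMethod C F M) (l : Label) : List Label :=
  P.labels.filter fun p => (P.succs p).contains l

/-! ### Translate -/

/-- The effect of the normal execution of an instruction on the height of the stack. -/
def heightAfter (E : Env C M) (n : ℕ) : JInstr C F M → ℕ
  | .push _ | .load _ | .new _ => n + 1
  | .pop | .store _ | .binop _ | .ifeq _ | .arrayload => n - 1
  | .putfield _ => n - 2
  | .arraystore => n - 3
  | .invoke m => n - E.nbArguments m
  | _ => n

/-- `Height E P i n`: on some path the stack has height `n` before the instruction at `i`. -/
inductive Height (E : Env C M) (P : JMethod C F M) : ℕ → ℕ → Prop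
  | entry : Height E P 0 0
  | norm {i j n : ℕ} {ins : JInstr C F M} : Height E P i n → P.code[i]? = some ins →
      JSucc E P i .norm j → Height E P j (heightAfter E n ins)
  | exc {i j n : ℕ} {e : C} : Height E P i n → JSucc E P i (.exc e) j → Height E P j 1

/-- The height of the stack before the instruction at `i` (in verified code the same on all
paths). -/
noncomputable def topOfStack (E : Env C M) (P : JMethod C F M) (i : ℕ) : ℕ :=
  sInf {n | Height E P i n}

/-- The translation of the instruction at `i` with stack height `n`; the stack cell at height `k`
(counted from the bottom) is simulated by the register `locN + k`. -/
def transInstr (E : Env C M) (P : JMethod C F M) (n : ℕ) : JInstr C F M →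
    List (DInstr C F M Label) :=
  let s : ℕ → ℕ := fun k => P.locN + k
  fun
  | .push v => [.const (s n) v]
  | .pop => []
  | .load x => [.move (s n) x]
  | .store x => [.move x (s (n - 1))]
  | .binop op => [.binop op (s (n - 2)) (s (n - 2)) (s (n - 1))]
  | .swap => [.move (s n) (s (n - 2)), .move (s (n + 1)) (s (n - 1)),
      .move (s (n - 2)) (s (n + 1)), .move (s (n - 1)) (s n)]
  | .goto _ => []
  | .ifeq t => [.ifeq (s (n - 1)) (.insn t)]
  | .ret => [.move 0 (s (n - 1))]
  | .new c => [.new (s n) c]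
  | .getfield f => [.iget (s (n - 1)) (s (n - 1)) f]
  | .putfield f => [.iput (s (n - 1)) (s (n - 2)) f]
  | .newarray t => [.newarray (s (n - 1)) (s (n - 1)) t]
  | .arraylength => [.arraylength (s (n - 1)) (s (n - 1))]
  | .arrayload => [.aget (s (n - 2)) (s (n - 2)) (s (n - 1))]
  | .arraystore => [.aput (s (n - 1)) (s (n - 3)) (s (n - 2))]
  | .invoke m => [.invoke (E.nbArguments m + 1) m
      (s (n - (E.nbArguments m + 1)) ::
        (List.range (E.nbArguments m)).map fun t => s (n - 1 - t))]
  | .throw => [.throw (s (n - 1))]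

/-- The instructions of a block, with their origins. `ts i` is the stack height at `i`. -/
def blockInsns (E : Env C M) (P : JMethod C F M) (ts : ℕ → ℕ) :
    Label → List (Origin × DInstr C F M Label)
  | .insn b => (P.blockPoints b).flatMap fun i =>
      match P.code[i]? with
      | some ins => (P.transInstr E (ts i) ins).mapIdx fun k d => (.insn i k, d)
      | none => []
  | .result i =>
      match P.code[i]? with
      | some (.invoke m) =>
        [(.result i, .moveresult (P.locN + (ts i - (E.nbArguments m + 1))))]
      | _ => []
  | .handler h => [(.handler h, .moveexception P.locN)]
  | .ret => [(.ret, .ret 0)]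

/-! ### PickOrder -/

/-- The next block of a trace: the primary successor of `x` if it has no order yet, otherwise the
first successor without order. -/
def nextInTrace (P : JMethod C F M) (ordered : List Label) (x : Label) : Option Label :=
  (P.succs x).find? fun y => !ordered.contains y

/-- TraceSuccessors; the first argument bounds the length of the trace. -/
def traceSuccessors (P : JMethod C F M) : ℕ → List Label → Label → List Label
  | 0, ordered, _ => ordered
  | fuel + 1, ordered, x =>
    match P.nextInTrace (ordered ++ [x]) x with
    | none => ordered ++ [x]
    | some y => P.traceSuccessors fuel (ordered ++ [x]) y

/-- The first parent without order whose primary successor is `x`, unless a parent in `loop`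
comes before it. -/
def pickParent (P : JMethod C F M) (ordered loop : List Label) (x : Label) :
    List Label → Option Label
  | [] => none
  | p :: ps =>
    if loop.contains p then none
    else if P.pSucc p == some x && !ordered.contains p then some p
    else P.pickParent ordered loop x ps

/-- PickStartingPoint; the first argument bounds the length of the search. -/
def pickStartingPoint (P : JMethod C F M) (ordered : List Label) :
    ℕ → List Label → Label → Label
  | 0, _, x => x
  | fuel + 1, loop, x =>
    match P.pickParent ordered loop x (P.parents x) with
    | none => x
    | some p => P.pickStartingPoint ordered fuel (p :: loop) p

/-- As long as there is a block without order, trace from a starting point for it. -/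
def pickOrderLoop (P : JMethod C F M) : ℕ → List Label → List Label
  | 0, ordered => ordered
  | fuel + 1, ordered =>
    match P.labels.find? fun x => !ordered.contains x with
    | none => ordered
    | some x => P.pickOrderLoop fuel (P.traceSuccessors P.labels.length ordered
        (P.pickStartingPoint ordered P.labels.length [x] x))

/-- The order of the blocks: first a trace from the initial block, then the others. -/
def pickOrder (P : JMethod C F M) : List Label :=
  P.pickOrderLoop P.labels.length (P.traceSuccessors P.labels.length [] (.insn 0))

/-! ### Output -/

/-- The origin of a `goto` appended to a block. -/
def gotoOrigin (P : JMethod C F M) : Label → Origin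
  | .insn b => .jump (P.lastPoint b)
  | .result i => .result i
  | .handler h => .handler h
  | .ret => .ret

/-- The output for the block `x` when `next` is the next block in order. If the primary successor
is not next, a `goto` is appended, except that a final `ifeq` whose target is next is replaced by the
opposite test. -/
def emit (E : Env C M) (P : JMethod C F M) (ts : ℕ → ℕ) (x : Label) (next : Option Label) :
    List (Origin × DInstr C F M Label) :=
  let out := P.blockInsns E ts x
  match P.pSucc x with
  | none => out
  | some s =>
    if next = some s then out
    else match out.getLast? with
      | some (o, .ifeq r t) =>
        if next = some t then out.dropLast ++ [(o, .ifneq r s)]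
        else out ++ [(P.gotoOrigin x, .goto s)]
      | _ => out ++ [(P.gotoOrigin x, .goto s)]

def layout (E : Env C M) (P : JMethod C F M) (ts : ℕ → ℕ) :
    List Label → List (Label × List (Origin × DInstr C F M Label))
  | [] => []
  | x :: xs => (x, P.emit E ts x xs.head?) :: P.layout E ts xs

/-- The address of a block: the number of instructions before it. -/
def address (l : Label) : List (Label × List (Origin × DInstr C F M Label)) → ℕ
  | [] => 0
  | (x, out) :: xs => if x = l then 0 else out.length + address l xs

/-- The state of the sweep that collects the DEX exception table: current handlers, current range,
and the table so far. -/
structure Sweep (C : Type*) where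
  cH : List (HandlerEntry C)
  cS : ℕ
  cE : ℕ
  table : List (HandlerEntry C)

/-- makeHandlerEntry, followed by adding the entries to the table; handlers point to the block with
the `moveexception`. -/
def Sweep.flush (addr : Label → ℕ) (w : Sweep C) : List (HandlerEntry C) :=
  w.table ++ w.cH.map fun h => ⟨w.cS, w.cE, addr (.handler h.handlerPC), h.catchType⟩

def canThrow (P : JMethod C F M) : Label → Bool
  | .insn b => P.mayThrow (P.lastPoint b)
  | _ => false

/-- Blocks that cannot throw are skipped; consecutive ranges with the same handlers are merged. -/
def sweepStep [DecidableEq C] (P : JMethod C F M) (addr : Label → ℕ) (w : Sweep C)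
    (b : Label × List (Origin × DInstr C F M Label)) : Sweep C :=
  if P.canThrow b.1 then
    if w.cH = P.blockHandlers b.1 then { w with cE := addr b.1 + b.2.length }
    else ⟨P.blockHandlers b.1, addr b.1, addr b.1 + b.2.length, w.flush addr⟩
  else w

def translateExceptionHandlers [DecidableEq C] (P : JMethod C F M) (addr : Label → ℕ)
    (lay : List (Label × List (Origin × DInstr C F M Label))) : List (HandlerEntry C) :=
  (lay.foldl (P.sweepStep addr) ⟨[], 0, 0, []⟩).flush addr

end JMethod

/-- Replace labels by addresses. -/
def DInstr.resolve {C F M : Type*} (addr : Label → ℕ) : DInstr C F M Label → DInstr C F M ℕ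
  | .const r n => .const r n
  | .move r rs => .move r rs
  | .binop op r ra rb => .binop op r ra rb
  | .goto t => .goto (addr t)
  | .ifeq r t => .ifeq r (addr t)
  | .ifneq r t => .ifneq r (addr t)
  | .ret rs => .ret rs
  | .new r c => .new r c
  | .iget r ro f => .iget r ro f
  | .iput rs ro f => .iput rs ro f
  | .newarray r rl t => .newarray r rl t
  | .arraylength r ra => .arraylength r ra
  | .aget r ra ri => .aget r ra ri
  | .aput rs ra ri => .aput rs ra ri
  | .invoke n m p => .invoke n m p
  | .moveresult r => .moveresult r
  | .throw r => .throw r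
  | .moveexception r => .moveexception r

namespace JMethod

variable {C F M : Type*}

/-- The origins of the output instructions, for given stack heights. -/
def originsWith (E : Env C M) (P : JMethod C F M) (ts : ℕ → ℕ) : List Origin :=
  ((P.layout E ts P.pickOrder).flatMap Prod.snd).map Prod.fst

/-- The translation for given stack heights `ts`. -/
def translateWith [DecidableEq C] (E : Env C M) (P : JMethod C F M) (ts : ℕ → ℕ) :
    DMethod C F M :=
  let lay := P.layout E ts P.pickOrder
  let addr : Label → ℕ := fun l => address l lay
  { code := (lay.flatMap Prod.snd).map fun x => x.2.resolve addr
    locN := P.locN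
    handlers := P.translateExceptionHandlers addr lay
    classAnalysis := fun p =>
      match (P.originsWith E ts)[p]? with
      | some (.insn i _) => P.classAnalysis i
      | _ => ∅ }

/-- The translation of a JVM method to DEX. -/
noncomputable def translate [DecidableEq C] (E : Env C M) (P : JMethod C F M) : DMethod C F M :=
  P.translateWith E (P.topOfStack E)

/-- The origin of the output instruction at `p`. -/
noncomputable def origin? (E : Env C M) (P : JMethod C F M) (p : ℕ) : Option Origin :=
  (P.originsWith E (P.topOfStack E))[p]?

/-! ### Transport of the typing data -/

/-- Does a point with the given origin belong to the translation of `region(i, τ)`?  The translated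
instructions do so with their JVM instruction. An appended `goto` or a `moveresult` does so also when
it directly follows `i` itself (`τ` normal), a `moveexception` when it directly follows a throwing
step from `i` with tag `τ` or from a point of the region, and the return block when a `return` of
the region leads to it. -/
def InRegion (E : Env C M) (P : JMethod C F M) (region : ℕ → Tag C → Set ℕ) (i : ℕ) (τ : Tag C) :
    Origin → Prop
  | .insn j _ => j ∈ region i τ
  | .jump j | .result j => j ∈ region i τ ∨ (j = i ∧ τ = .norm)
  | .handler h => (∃ j ∈ region i τ, ∃ e, JSucc E P j (.exc e) h) ∨
      ∃ e, τ = .exc e ∧ JSucc E P i (.exc e) h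
  | .ret => ∃ j ∈ region i τ, P.code[j]? = some .ret

/-- The regions of the translated method. -/
def transRegion (E : Env C M) (P : JMethod C F M) (region : ℕ → Tag C → Set ℕ)
    (p : ℕ) (τ : Tag C) : Set ℕ :=
  {q | ∃ i k o, P.origin? E p = some (.insn i k) ∧ P.origin? E q = some o ∧
    P.InRegion E region i τ o}

/-- The content levels of the arrays created by the translated method. -/
noncomputable def transAt {S : Type*} [Bot S] (E : Env C M) (P : JMethod C F M) (at' : ℕ → ExtLevel S) (p : ℕ) :
    ExtLevel S :=
  match P.origin? E p with
  | some (.insn i _) => at' i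
  | _ => .base ⊥

end JMethod

/-- The flattening of a stack type to a register type: the local variables have the levels given by
the policy, the stack cells have the levels given by the stack type, and the other registers are
unconstrained. -/
def StackType.flatten {S C : Type*} (pol : Policy S C) (locN : ℕ) (st : StackType S) : RegType S
  | .r n => if n < locN then some (pol.ka n) else st.reverse[n - locN]?
  | _ => none

/-! ## Programs -/

/-- A JVM program: its methods (indexed by `N`), and the identifier of each method. -/
structure JProgram (C F M N : Type*) where
  body : N → JMethod C F M
  mid : N → M

structure DProgram (C F M N : Type*) where
  body : N → DMethod C F M
  mid : N → M

noncomputable def JProgram.translate {C F M N : Type*} [DecidableEq C] (E : Env C M)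
    (P : JProgram C F M N) : DProgram C F M N where
  body m := (P.body m).translate E
  mid := P.mid

/-- A JVM program is typable if every method is typable with respect to each of its policies:
for some security environment and some assignment of stack types. -/
def JProgram.Typable {S C F M N : Type*} [SemilatticeSup S] [OrderBot S] (E : Env C M)
    (Γ : M → S → Policy S C) (ft : F → ExtLevel S) (P : JProgram C F M N)
    (region : N → ℕ → Tag C → Set ℕ) (at' : N → ℕ → ExtLevel S) : Prop :=
  ∀ (m : N) (k : S), ∃ (se : ℕ → S) (st : ℕ → StackType S),
    JTyping E (P.body m) ⟨Γ, ft, Γ (P.mid m) k, region m, se, at' m⟩ st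

/-- A DEX program is typable if every method is typable with respect to each of its policies: for
some security environment and some assignment of register types. -/
def DProgram.Typable {S C F M N : Type*} [SemilatticeSup S] [OrderBot S] (E : Env C M)
    (Γ : M → S → Policy S C) (ft : F → ExtLevel S) (P : DProgram C F M N)
    (region : N → ℕ → Tag C → Set ℕ) (at' : N → ℕ → ExtLevel S) : Prop :=
  ∀ (m : N) (k : S), ∃ (se : ℕ → S) (rt : ℕ → RegType S),
    DTyping E (P.body m) ⟨Γ, ft, Γ (P.mid m) k, region m, se, at' m⟩ rt

/-!
Typability is not preserved for the given security environment `se` as it stands, and this is the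
heart of the matter: the DEX rules join `se` in places where the JVM rules do not. A `swap`
becomes four moves, each of which raises the level it copies by `se`; the result of reading an
array, the guard of a test and the level of an exception that leaves the method are raised
likewise. On the JVM side `se i` may well exceed the levels on the stack at `i`.

The remedy is to replace `se` by the least environment `leastEnv` that meets the guards
"`k ≤ se j` for all `j` in `region(i, τ)`" of all steps, for the given stack types. It lies below `se`
(`JTyping.leastEnv_le_se`), the stack types still form a typing for it (`JTyping.lower`), and it
lies below every level on the stack at every point (`JTyping.leastEnv_le_head`): a guarded step
from `i` raises the whole stack to its guard, every point of `region(i, τ)` is reached from `i` by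
such a step followed by steps inside the region, and the transfer rules never bring the stack
below a lower bound of the stack before and of the security environment. Hence the additional
joins of the DEX rules are absorbed, and every JVM rule is simulated by the DEX rules of its
translation (`JTrans.dtrans_norm`, `JTrans.dtrans_swap`, `JTrans.dtrans_invoke`,
`JTrans.dtrans_exc`, `JTransExit.dtransExit_exc`), where the register type of a translated point
is the flattening of its stack type.

It remains to see that the steps of the translation are those of the original. The relation
`Leads` says that an output starts by simulating the passage to a label, and `Shape` what follows
an output instruction. `JMethod.Verified.emit_shape` and `JMethod.Verified.leads_address`
establish them for the laid out blocks, `JMethod.Verified.pickOrder_spec` says that all blocks are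
laid out, with the entry in front, and `JMethod.Verified.handlerOf_translate` that the exception
tables agree. The additional instructions get the register types `entryType` and as security
environment (`originEnv`) the join of what the steps that lead to them demand: the guards of these
steps have to be respected at the additional instructions too, as they belong to the translated
regions. All this is assembled in `JTyping.dTyping`.
-/

set_option linter.unusedSectionVars false

/-! ### Levels, stack types and register types -/

namespace ExtLevel

variable {S : Type*} [SemilatticeSup S]

theorem Le.refl (a : ExtLevel S) : a.Le a := by
  cases a <;> simp [Le]

theorem Le.trans {a b c : ExtLevel S} (h : a.Le b) (h' : b.Le c) : a.Le c := by
  cases a <;> cases b <;> cases c <;> simp only [Le] at *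
  · exact le_trans h h'
  · exact ⟨h.1.trans h'.1, h.2.trans h'.2⟩

theorem Le.head {a b : ExtLevel S} (h : a.Le b) : a.head ≤ b.head := by
  cases a <;> cases b <;> simp_all [Le, ExtLevel.head]

@[simp] theorem head_base (k : S) : (base k).head = k := rfl

@[simp] theorem head_arr (k : S) (c : ExtLevel S) : (arr k c).head = k := rfl

@[simp] theorem head_join (k : S) (a : ExtLevel S) : (a.join k).head = k ⊔ a.head := by
  cases a <;> rfl

theorem join_eq_self {k : S} {a : ExtLevel S} (h : k ≤ a.head) : a.join k = a := by
  cases a <;> simpa [join, ExtLevel.head] using h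

theorem Le.join {k k' : S} {a b : ExtLevel S} (hk : k ≤ k') (h : a.Le b) :
    (a.join k).Le (b.join k') := by
  cases a <;> cases b <;> simp_all [Le, ExtLevel.join]
  · exact ⟨hk.trans le_sup_left, h.trans le_sup_right⟩
  · exact ⟨hk.trans le_sup_left, h.1.trans le_sup_right⟩

theorem le_join (k : S) (a : ExtLevel S) : a.Le (a.join k) := by
  cases a <;> simp [Le, join]

theorem base_le {k k' : S} (h : k ≤ k') : (base k).Le (base k') := h

end ExtLevel

namespace StackType

variable {S C : Type*} [SemilatticeSup S]

theorem Le.refl (st : StackType S) : StackType.Le st st :=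
  List.forall₂_same.2 fun a _ => ExtLevel.Le.refl a

theorem Le.trans {st st' st'' : StackType S} (h : StackType.Le st st')
    (h' : StackType.Le st' st'') : StackType.Le st st'' := by
  unfold StackType.Le at *
  induction h generalizing st'' with
  | nil => exact h'
  | cons hab _ ih =>
    cases h' with
    | cons hbc h' => exact .cons (hab.trans hbc) (ih h')

theorem le_lift (k : S) (st : StackType S) : StackType.Le st (StackType.lift k st) := by
  induction st with
  | nil => exact .nil
  | cons a st ih => exact .cons (ExtLevel.le_join k a) ih

theorem Le.lift (k : S) {st st' : StackType S} (h : StackType.Le st st') :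
    StackType.Le (StackType.lift k st) (StackType.lift k st') := by
  unfold StackType.Le at *
  induction h with
  | nil => exact .nil
  | cons hab _ ih => exact .cons (hab.join le_rfl) ih

theorem Le.forall_head {k : S} {st st' : StackType S} (h : StackType.Le st st')
    (hk : ∀ a ∈ st, k ≤ a.head) : ∀ a ∈ st', k ≤ a.head := by
  unfold StackType.Le at h
  induction h with
  | nil => simp
  | cons hab _ ih =>
    simp only [List.forall_mem_cons] at hk ⊢
    exact ⟨hk.1.trans hab.head, ih hk.2⟩

theorem le_head_of_mem_lift {k : S} {st : StackType S} {a : ExtLevel S}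
    (h : a ∈ StackType.lift k st) : k ≤ a.head := by
  obtain ⟨b, _, rfl⟩ := List.mem_map.1 h
  simp

end StackType

namespace RegType

variable {S : Type*} [SemilatticeSup S]

theorem Le.refl (rt : RegType S) : rt.Le rt := fun _ b h => ⟨b, h, ExtLevel.Le.refl b⟩

theorem Le.trans {rt rt' rt'' : RegType S} (h : rt.Le rt') (h' : rt'.Le rt'') : rt.Le rt'' := by
  intro r c hc
  obtain ⟨b, hb, hbc⟩ := h' r c hc
  obtain ⟨a, ha, hab⟩ := h r b hb
  exact ⟨a, ha, hab.trans hbc⟩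

theorem Le.set {rt rt' : RegType S} (h : rt.Le rt') (r : Reg) {a b : ExtLevel S} (hab : a.Le b) :
    (rt.set r a).Le (rt'.set r b) := by
  intro r' c hc
  by_cases hr : r' = r
  · subst hr
    simp only [RegType.set, Function.update_self, Option.some.injEq] at hc ⊢
    subst hc
    exact ⟨a, rfl, hab⟩
  · simp only [RegType.set, Function.update_of_ne hr] at hc ⊢
    exact h r' c hc

/-- A register on which the greater register type makes no claim may be overwritten. -/
theorem Le.set_left {rt rt' : RegType S} (h : rt.Le rt') {r : Reg} (hr : rt' r = none)
    (a : ExtLevel S) : (rt.set r a).Le rt' := by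
  intro r' c hc
  have : r' ≠ r := by rintro rfl; simp [hr] at hc
  simp only [RegType.set, Function.update_of_ne this]
  exact h r' c hc

@[simp] theorem set_self (rt : RegType S) (r : Reg) (a : ExtLevel S) : rt.set r a r = some a := by
  simp [RegType.set]

theorem set_of_ne (rt : RegType S) {r r' : Reg} (h : r' ≠ r) (a : ExtLevel S) :
    rt.set r a r' = rt r' := by
  simp [RegType.set, h]

end RegType

namespace StackType

variable {S C : Type*} [SemilatticeSup S] (pol : Policy S C) (locN : ℕ)

theorem flatten_local {x : ℕ} (st : StackType S) (h : x < locN) :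
    st.flatten pol locN (.r x) = some (pol.ka x) := by
  simp [flatten, h]

theorem flatten_nil : flatten pol locN ([] : StackType S) = pol.regs locN := by
  funext r
  cases r <;> simp [flatten, Policy.regs]

theorem flatten_append (st st' : StackType S) (a : ExtLevel S) :
    flatten pol locN (st ++ a :: st') (.r (locN + st'.length)) = some a := by
  simp [flatten]

theorem flatten_cons (st : StackType S) (a : ExtLevel S) :
    flatten pol locN (a :: st) = (flatten pol locN st).set (.r (locN + st.length)) a := by
  funext r
  cases r with
  | r n =>
    by_cases h : n = locN + st.length
    · subst h
      simp [flatten, RegType.set]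
    · rw [RegType.set_of_ne _ (by simpa using h)]
      by_cases hn : n < locN
      · simp [flatten, hn]
      · simp only [flatten, hn, if_false, List.reverse_cons]
        rcases lt_or_gt_of_ne (show n - locN ≠ st.length by omega) with h' | h'
        · rw [List.getElem?_append_left (by simpa using h')]
        · rw [List.getElem?_eq_none (by simp; omega), List.getElem?_eq_none (by simp; omega)]
  | ret => rw [RegType.set_of_ne _ (by simp)]; rfl
  | ex => rw [RegType.set_of_ne _ (by simp)]; rfl

theorem flatten_mono {st st' : StackType S} (h : StackType.Le st st') :
    (flatten pol locN st).Le (flatten pol locN st') := by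
  unfold StackType.Le at h
  induction h with
  | nil => exact RegType.Le.refl _
  | cons hab h ih =>
    rw [flatten_cons, flatten_cons, h.length_eq]
    exact ih.set _ hab

/-- Cells on top of the stack may be forgotten. -/
theorem flatten_append_le (st st' : StackType S) :
    (flatten pol locN (st ++ st')).Le (flatten pol locN st') := by
  induction st with
  | nil => exact RegType.Le.refl _
  | cons a st ih =>
    rw [List.cons_append, flatten_cons]
    refine ih.set_left ?_ a
    simp [flatten]

theorem flatten_le_regs (st : StackType S) : (flatten pol locN st).Le (pol.regs locN) := by
  have := flatten_append_le pol locN st []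
  rwa [List.append_nil, flatten_nil] at this

end StackType

/-! ### The security environment generated by the guards -/

section Guards

variable {S C F M : Type*} [SemilatticeSup S] [OrderBot S]

/-- The level of the cell at depth `n` of a stack type (`⊥` when there is no such cell). -/
def StackType.headAt (st : StackType S) (n : ℕ) : S := (st[n]?.map ExtLevel.head).getD ⊥

/-- The level `k` in the premise "`k ≤ se j` for all `j` in `region(i, τ)`" of the JVM rule that
applies to a step from `i` with tag `τ` and stack type `st`; it is `⊥` for the rules without such a
premise. -/
def guardLevel (E : Env C M) (P : JMethod C F M) (Γ : M → S → Policy S C) (st : StackType S)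
    (i : ℕ) (τ : Tag C) : S :=
  match P.code[i]? with
  | some (.ifeq _) | some (.getfield _) | some .arraylength | some .throw => st.headAt 0
  | some (.putfield _) | some .arrayload => st.headAt 1
  | some .arraystore => st.headAt 2
  | some (.invoke mid) =>
    let k := st.headAt (E.nbArguments mid)
    match τ with
    | .norm => k ⊔ escapeLevel E mid (Γ mid k)
    | .exc e => k ⊔ (Γ mid k).krExc e
  | _ => ⊥

@[simp] theorem StackType.headAt_cons_zero (a : ExtLevel S) (st : StackType S) :
    StackType.headAt (a :: st) 0 = a.head := rfl

@[simp] theorem StackType.headAt_cons_succ (a : ExtLevel S) (st : StackType S) (n : ℕ) :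
    StackType.headAt (a :: st) (n + 1) = StackType.headAt st n := rfl

theorem StackType.headAt_append {st₁ st₂ : StackType S} {a : ExtLevel S} {n : ℕ}
    (h : st₁.length = n) : StackType.headAt (st₁ ++ a :: st₂) n = a.head := by
  subst h
  simp [StackType.headAt]

/-- The premise on the region that `guardLevel` extracts from the rules. -/
theorem JTrans.guards {E : Env C M} {P : JMethod C F M} {X : Ctx S C F M} {i : ℕ} {τ : Tag C}
    {st st' : StackType S} (h : JTrans E P X i τ st st') :
    X.Guards i τ (guardLevel E P X.Γ st i τ) := by
  cases h
  case invoke hc hcall _ => simpa [guardLevel, hc, StackType.headAt_append hcall.1]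
  case invokeExc hc hcall _ _ _ => simpa [guardLevel, hc, StackType.headAt_append hcall.1]
  all_goals simp_all [guardLevel, Ctx.Guards]

/-- The steps that a rule guards at level `k` raise the stack at least to `k`. -/
theorem JTrans.guardLevel_le {E : Env C M} {P : JMethod C F M} {X : Ctx S C F M} {i : ℕ}
    {τ : Tag C} {st st' : StackType S} (h : JTrans E P X i τ st st') :
    ∀ a ∈ st', guardLevel E P X.Γ st i τ ≤ a.head := by
  have hlift : ∀ (k l : S) (s : StackType S), l = k →
      ∀ a ∈ StackType.lift k s, l ≤ a.head := by
    rintro k _ s rfl a ha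
    exact StackType.le_head_of_mem_lift ha
  cases h
  case invoke hc hcall _ =>
    exact hlift _ _ _ (by simp [guardLevel, hc, StackType.headAt_append hcall.1])
  case invokeExc hc hcall _ _ _ => simp [guardLevel, hc, StackType.headAt_append hcall.1]
  all_goals
    first
    | (apply hlift; simp_all [guardLevel])
    | simp_all [guardLevel]

/-- A lower bound of the security level of `i` and of the stack is kept by the rules. -/
theorem JTrans.le_head {E : Env C M} {P : JMethod C F M} {X : Ctx S C F M} {i : ℕ}
    {τ : Tag C} {st st' : StackType S} {k : S} (h : JTrans E P X i τ st st') (hi : k ≤ X.se i)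
    (hk : ∀ a ∈ st, k ≤ a.head) : ∀ a ∈ st', k ≤ a.head := by
  have hlift : ∀ (l : S) (s : StackType S), (∀ a ∈ s, k ≤ a.head) →
      ∀ a ∈ StackType.lift l s, k ≤ a.head := fun l s hs =>
    (StackType.le_lift l s).forall_head hs
  cases h
  case invoke =>
    apply hlift
    simp only [List.forall_mem_cons, List.forall_mem_append, ExtLevel.head_join] at hk ⊢
    exact ⟨hi.trans le_sup_left, hk.2.2⟩
  all_goals
    try simp only [List.forall_mem_cons, List.forall_mem_append, ExtLevel.head_base,
      ExtLevel.head_arr] at hk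
    try apply hlift
    simp_all [le_sup_of_le_left]

/-- A rule still applies after lowering the security environment to one that meets its guard, and
then yields a lower stack. -/
theorem JTrans.lower {E : Env C M} {P : JMethod C F M} {X : Ctx S C F M} {i : ℕ} {τ : Tag C}
    {st st' : StackType S} {se₁ : ℕ → S} (h : JTrans E P X i τ st st') (hi : se₁ i ≤ X.se i)
    (hg : ∀ j ∈ X.region i τ, guardLevel E P X.Γ st i τ ≤ se₁ j) :
    ∃ st'', JTrans E P { X with se := se₁ } i τ st st'' ∧ StackType.Le st'' st' := by
  have hcall : ∀ {mid pol st₁ k}, JCallOk E X i mid pol st₁ k →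
      JCallOk E { X with se := se₁ } i mid pol st₁ k := fun h =>
    ⟨h.1, h.2.1, h.2.2.1, (sup_le_sup_left hi _).trans h.2.2.2⟩
  cases h with
  | push h => exact ⟨_, .push h, .cons hi (StackType.Le.refl _)⟩
  | pop h => exact ⟨_, .pop h, StackType.Le.refl _⟩
  | load h => exact ⟨_, .load h, .cons ((ExtLevel.Le.refl _).join hi) (StackType.Le.refl _)⟩
  | store h h' => exact ⟨_, .store h (((ExtLevel.Le.refl _).join hi).trans h'), StackType.Le.refl _⟩
  | binop h => exact ⟨_, .binop h, .cons (sup_le_sup_left hi _) (StackType.Le.refl _)⟩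
  | swap h => exact ⟨_, .swap h, StackType.Le.refl _⟩
  | goto h => exact ⟨_, .goto h, StackType.Le.refl _⟩
  | ifeq h _ =>
    exact ⟨_, .ifeq h (by simpa [Ctx.Guards, guardLevel, h] using hg), StackType.Le.refl _⟩
  | new h => exact ⟨_, .new h, .cons hi (StackType.Le.refl _)⟩
  | getfield h _ =>
    exact ⟨_, .getfield h (by simpa [Ctx.Guards, guardLevel, h] using hg),
      StackType.Le.lift _
        (.cons ((ExtLevel.Le.refl _).join (sup_le_sup_left hi _)) (StackType.Le.refl _))⟩
  | getfieldNp h _ ht =>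
    exact ⟨_, .getfieldNp h (by simpa [Ctx.Guards, guardLevel, h] using hg) ht,
      .cons (sup_le_sup_left hi _) .nil⟩
  | putfield h h₁ h₂ _ =>
    exact ⟨_, .putfield h (((ExtLevel.Le.refl _).join (sup_le_sup_right hi _)).trans h₁) h₂
      (by simpa [Ctx.Guards, guardLevel, h] using hg), StackType.Le.refl _⟩
  | putfieldNp h h₁ _ ht =>
    exact ⟨_, .putfieldNp h (((ExtLevel.Le.refl _).join (sup_le_sup_right hi _)).trans h₁)
      (by simpa [Ctx.Guards, guardLevel, h] using hg) ht, .cons (sup_le_sup_left hi _) .nil⟩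
  | newarray h => exact ⟨_, .newarray h, StackType.Le.refl _⟩
  | arraylength h _ =>
    exact ⟨_, .arraylength h (by simpa [Ctx.Guards, guardLevel, h] using hg), StackType.Le.refl _⟩
  | arraylengthNp h _ ht =>
    exact ⟨_, .arraylengthNp h (by simpa [Ctx.Guards, guardLevel, h] using hg) ht,
      .cons (sup_le_sup_left hi _) .nil⟩
  | arrayload h _ =>
    exact ⟨_, .arrayload h (by simpa [Ctx.Guards, guardLevel, h] using hg), StackType.Le.refl _⟩
  | arrayloadNp h _ ht =>
    exact ⟨_, .arrayloadNp h (by simpa [Ctx.Guards, guardLevel, h] using hg) ht,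
      .cons (sup_le_sup_left hi _) .nil⟩
  | arraystore h h₁ _ =>
    exact ⟨_, .arraystore h h₁ (by simpa [Ctx.Guards, guardLevel, h] using hg), StackType.Le.refl _⟩
  | arraystoreNp h h₁ _ ht =>
    exact ⟨_, .arraystoreNp h h₁ (by simpa [Ctx.Guards, guardLevel, h] using hg) ht,
      .cons (sup_le_sup_left hi _) .nil⟩
  | invoke h h₁ _ =>
    exact ⟨_, .invoke h (hcall h₁)
      (by simpa [Ctx.Guards, guardLevel, h, StackType.headAt_append h₁.1] using hg),
      StackType.Le.lift _ (.cons ((ExtLevel.Le.refl _).join hi) (StackType.Le.refl _))⟩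
  | invokeExc h h₁ he ht _ =>
    exact ⟨_, .invokeExc h (hcall h₁) he ht
      (by simpa [Ctx.Guards, guardLevel, h, StackType.headAt_append h₁.1] using hg),
      StackType.Le.refl _⟩
  | throw h he _ ht =>
    exact ⟨_, .throw h he (by simpa [Ctx.Guards, guardLevel, h] using hg) ht,
      .cons ((ExtLevel.Le.refl _).join hi) .nil⟩

/-- The rules for exits survive lowering the security environment; the guards of exceptional exits
are void because their regions are empty. -/
theorem JTransExit.lower {E : Env C M} {P : JMethod C F M} {X : Ctx S C F M} {i : ℕ} {τ : Tag C}
    {st : StackType S} {se₁ : ℕ → S} (h : JTransExit E P X i τ st) (hi : se₁ i ≤ X.se i)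
    (hg : X.region i τ = ∅ ∨ τ = .norm) : JTransExit E P { X with se := se₁ } i τ st := by
  have hcall : ∀ {mid pol st₁ k}, JCallOk E X i mid pol st₁ k →
      JCallOk E { X with se := se₁ } i mid pol st₁ k := fun h =>
    ⟨h.1, h.2.1, h.2.2.1, (sup_le_sup_left hi _).trans h.2.2.2⟩
  cases h with
  | ret h h' => exact .ret h (((ExtLevel.Le.refl _).join hi).trans h')
  | getfield h _ h₁ h₂ => exact .getfield h (by simp_all [Ctx.Guards]) h₁ h₂
  | putfield h h₀ _ h₁ h₂ =>
    exact .putfield h (((ExtLevel.Le.refl _).join (sup_le_sup_right hi _)).trans h₀)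
      (by simp_all [Ctx.Guards]) h₁ h₂
  | arraylength h _ h₁ h₂ => exact .arraylength h (by simp_all [Ctx.Guards]) h₁ h₂
  | arrayload h _ h₁ h₂ => exact .arrayload h (by simp_all [Ctx.Guards]) h₁ h₂
  | arraystore h h₀ _ h₁ h₂ => exact .arraystore h h₀ (by simp_all [Ctx.Guards]) h₁ h₂
  | invoke h h₀ h₁ he ht _ =>
    exact .invoke h (hcall h₀) ((sup_le_sup_right (sup_le_sup_left hi _) _).trans h₁) he ht
      (by simp_all [Ctx.Guards])
  | throw h he h₁ _ ht => exact .throw h he h₁ (by simp_all [Ctx.Guards]) ht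

/-- The steps (source and tag) of a method inside its code. -/
def JMethod.steps (E : Env C M) (P : JMethod C F M) : Set (ℕ × Tag C) :=
  {x | ∃ j, JSucc E P x.1 x.2 j}

theorem JInstr.finite_excTags (E : Env C M) (P : JMethod C F M) (i : ℕ) (ins : JInstr C F M) :
    (ins.excTags E P i).Finite := by
  have h : ∀ s : Finset C, {e | e ∈ s ∨ e = E.np}.Finite := fun s =>
    s.finite_toSet.union (Set.finite_singleton E.np)
  cases ins <;> first
    | exact Set.finite_empty
    | exact Set.finite_singleton _
    | exact h _

theorem JMethod.finite_steps (E : Env C M) (P : JMethod C F M) : (P.steps E).Finite := by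
  have hf : (⋃ i ∈ Set.Iio P.code.length, ⋃ ins ∈ {ins | P.code[i]? = some ins},
      insert (i, Tag.norm) ((fun e => (i, Tag.exc e)) '' ins.excTags E P i)).Finite := by
    refine (Set.finite_Iio _).biUnion fun i _ => Set.Finite.biUnion ?_ fun ins _ =>
      ((ins.finite_excTags E P i).image _).insert _
    refine Set.Subsingleton.finite fun a ha b hb => ?_
    simp only [Set.mem_ofPred_eq] at ha hb
    simpa [ha] using hb
  refine hf.subset ?_
  rintro ⟨i, τ⟩ ⟨j, h⟩
  have key : ∀ ins, P.code[i]? = some ins →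
      (i, τ) ∈ insert (i, Tag.norm) ((fun e => (i, Tag.exc e)) '' ins.excTags E P i) →
      (i, τ) ∈ (⋃ i ∈ Set.Iio P.code.length, ⋃ ins ∈ {ins | P.code[i]? = some ins},
        insert (i, Tag.norm) ((fun e => (i, Tag.exc e)) '' ins.excTags E P i)) := by
    intro ins hins h
    simp only [Set.mem_iUnion]
    exact ⟨i, (List.getElem?_eq_some_iff.1 hins).1, ins, hins, h⟩
  cases h with
  | next h _ => exact key _ h (Or.inl rfl)
  | goto h => exact key _ h (Or.inl rfl)
  | ifeq h => exact key _ h (Or.inl rfl)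
  | exc h he _ => exact key _ h (Or.inr ⟨_, he, rfl⟩)

open Classical in
/-- The least security environment that satisfies the guards of all steps, for the stack types
`st`. -/
noncomputable def leastEnv (E : Env C M) (P : JMethod C F M) (Γ : M → S → Policy S C)
    (region : ℕ → Tag C → Set ℕ) (st : ℕ → StackType S) (j : ℕ) : S :=
  (P.finite_steps E).toFinset.sup fun x =>
    if j ∈ region x.1 x.2 then guardLevel E P Γ (st x.1) x.1 x.2 else ⊥

theorem le_leastEnv {E : Env C M} {P : JMethod C F M} {Γ : M → S → Policy S C}
    {region : ℕ → Tag C → Set ℕ} {st : ℕ → StackType S} {i j : ℕ} {τ : Tag C}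
    (h : (i, τ) ∈ P.steps E) (hj : j ∈ region i τ) :
    guardLevel E P Γ (st i) i τ ≤ leastEnv E P Γ region st j := by
  classical
  have := Finset.le_sup (f := fun x : ℕ × Tag C =>
    if j ∈ region x.1 x.2 then guardLevel E P Γ (st x.1) x.1 x.2 else ⊥)
    ((P.finite_steps E).mem_toFinset.2 h)
  simpa only [leastEnv, hj, if_true] using this

theorem leastEnv_le {E : Env C M} {P : JMethod C F M} {Γ : M → S → Policy S C}
    {region : ℕ → Tag C → Set ℕ} {st : ℕ → StackType S} {j : ℕ} {k : S}
    (h : ∀ i τ, (i, τ) ∈ P.steps E → j ∈ region i τ → guardLevel E P Γ (st i) i τ ≤ k) :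
    leastEnv E P Γ region st j ≤ k := by
  classical
  refine Finset.sup_le fun x hx => ?_
  split_ifs with hj
  · exact h x.1 x.2 ((P.finite_steps E).mem_toFinset.1 hx) hj
  · exact bot_le

theorem ReachedWithin.mem {E : Env C M} {P : JMethod C F M} {R : Set ℕ} {i : ℕ} {τ : Tag C} {j : ℕ}
    (h : ReachedWithin E P R i τ j) : j ∈ R := by
  cases h <;> assumption

theorem ReachedWithin.mem_steps {E : Env C M} {P : JMethod C F M} {R : Set ℕ} {i : ℕ} {τ : Tag C}
    {j : ℕ} (h : ReachedWithin E P R i τ j) : (i, τ) ∈ P.steps E := by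
  induction h with
  | first h _ => exact ⟨_, h⟩
  | step _ _ _ ih => exact ih

namespace JTyping

variable {E : Env C M} {P : JMethod C F M} {X : Ctx S C F M} {st : ℕ → StackType S}

/-- Inside `region(i, τ)` the whole stack is at least as high as the guard of the step: the step
itself raises it, and the steps inside the region only add levels above the security environment. -/
theorem guardLevel_le_head (h : JTyping E P X st) {i j : ℕ} {τ : Tag C}
    (hj : ReachedWithin E P (X.region i τ) i τ j) :
    ∀ a ∈ st j, guardLevel E P X.Γ (st i) i τ ≤ a.head := by
  have hstep := hj.mem_steps
  obtain ⟨j₀, hj₀⟩ := hstep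
  obtain ⟨_, hg, _⟩ := h.step _ _ _ hj₀
  have hguard := hg.guards
  induction hj with
  | first hs _ =>
    obtain ⟨st', ht, hle⟩ := h.step _ _ _ hs
    exact hle.forall_head ht.guardLevel_le
  | step hr hs _ ih =>
    obtain ⟨st', ht, hle⟩ := h.step _ _ _ hs
    exact hle.forall_head (ht.le_head (hguard _ hr.mem) ih)

theorem leastEnv_le_se (h : JTyping E P X st) (j : ℕ) :
    leastEnv E P X.Γ X.region st j ≤ X.se j := by
  refine leastEnv_le fun i τ ⟨_, hs⟩ hj => ?_
  obtain ⟨_, ht, _⟩ := h.step _ _ _ hs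
  exact ht.guards j hj

/-- Every point of a region is reached inside it, so that the levels on the stack dominate the least
security environment, though they need not dominate the given one. -/
theorem leastEnv_le_head (h : JTyping E P X st) (hreg : IsControlRegion E P X.region) (j : ℕ) :
    ∀ a ∈ st j, leastEnv E P X.Γ X.region st j ≤ a.head := fun a ha =>
  leastEnv_le fun i τ _ hj => h.guardLevel_le_head (hreg i τ j hj) a ha

/-- A tag with which the method is left has no successor, hence nothing is reached by it. -/
theorem region_eq_empty_of_exit (hreg : IsControlRegion E P X.region) {i : ℕ} {e : C}
    (h : JExit E P i (.exc e)) : X.region i (.exc e) = ∅ := by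
  refine Set.eq_empty_of_forall_notMem fun j hj => ?_
  obtain ⟨k, hk⟩ := (hreg _ _ _ hj).mem_steps
  cases h with
  | exc _ _ hn =>
    cases hk with
    | exc _ _ hs => simp [hn] at hs

/-- The same stack types form a typing for the least security environment. -/
theorem lower (h : JTyping E P X st) (hreg : IsControlRegion E P X.region) :
    JTyping E P { X with se := leastEnv E P X.Γ X.region st } st where
  entry := h.entry
  step i τ j hs := by
    obtain ⟨st', ht, hle⟩ := h.step i τ j hs
    obtain ⟨st'', ht', hle'⟩ := ht.lower (h.leastEnv_le_se i) fun j' hj' =>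
      le_leastEnv ⟨j, hs⟩ hj'
    exact ⟨st'', ht', hle'.trans hle⟩
  exit i τ hx := by
    refine (h.exit i τ hx).lower (h.leastEnv_le_se i) ?_
    cases τ with
    | norm => exact Or.inr rfl
    | exc e => exact Or.inl (region_eq_empty_of_exit hreg hx)

end JTyping

/-! ### Stack heights -/

theorem JTrans.length_eq {E : Env C M} {P : JMethod C F M} {X : Ctx S C F M} {i : ℕ}
    {ins : JInstr C F M} {st st' : StackType S} (h : JTrans E P X i .norm st st')
    (hi : P.code[i]? = some ins) :
    st'.length = JMethod.heightAfter E st.length ins := by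
  have hins : ∀ ins', P.code[i]? = some ins' → ins' = ins := fun ins' h' =>
    Option.some.inj (h'.symm.trans hi)
  cases h
  case invoke hc hcall _ =>
    obtain rfl := hins _ hc
    simp only [JMethod.heightAfter, StackType.lift, ← hcall.1, List.length_map, List.length_append,
      List.length_cons]
    omega
  all_goals
    obtain rfl := hins _ (by assumption)
    simp [JMethod.heightAfter, StackType.lift]

theorem JTrans.length_eq_one {E : Env C M} {P : JMethod C F M} {X : Ctx S C F M} {i : ℕ} {e : C}
    {st st' : StackType S} (h : JTrans E P X i (.exc e) st st') : st'.length = 1 := by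
  cases h <;> rfl

theorem JTyping.height_eq {E : Env C M} {P : JMethod C F M} {X : Ctx S C F M}
    {st : ℕ → StackType S} (h : JTyping E P X st) {i n : ℕ} (hn : JMethod.Height E P i n) :
    n = (st i).length := by
  induction hn with
  | entry => simp [h.entry]
  | norm _ hc hs ih =>
    obtain ⟨st', ht, hle⟩ := h.step _ _ _ hs
    rw [ih, ← ht.length_eq hc]
    exact List.Forall₂.length_eq hle
  | exc _ hs ih =>
    obtain ⟨st', ht, hle⟩ := h.step _ _ _ hs
    rw [← List.Forall₂.length_eq hle]
    exact ht.length_eq_one.symm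

theorem JReachable.exists_height {E : Env C M} {P : JMethod C F M} {i : ℕ}
    (h : JReachable E P i) : ∃ n, JMethod.Height E P i n := by
  induction h with
  | entry => exact ⟨0, .entry⟩
  | @step i j τ _ hs ih =>
    obtain ⟨n, hn⟩ := ih
    cases τ with
    | norm =>
      cases hs with
      | next hc hf => exact ⟨_, .norm hn hc (.next hc hf)⟩
      | goto hc => exact ⟨_, .norm hn hc (.goto hc)⟩
      | ifeq hc => exact ⟨_, .norm hn hc (.ifeq hc)⟩
    | exc e => exact ⟨1, .exc hn hs⟩

/-- The height by which the translation chooses registers is the length of the stack type. -/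
theorem JTyping.topOfStack_eq {E : Env C M} {P : JMethod C F M} {X : Ctx S C F M}
    {st : ℕ → StackType S} (h : JTyping E P X st) {i : ℕ} (hi : JReachable E P i) :
    P.topOfStack E i = (st i).length := by
  obtain ⟨n, hn⟩ := hi.exists_height
  exact (h.height_eq (Nat.sInf_mem (s := {n | JMethod.Height E P i n}) ⟨n, hn⟩))

end Guards

/-! ### Basic blocks -/

namespace JMethod

variable {C F M : Type*} {E : Env C M} {P : JMethod C F M}

theorem isStart_iff {i : ℕ} : P.isStart i = true ↔
    i < P.code.length ∧ (i = 0 ∨ ∃ j < P.code.length, i ∈ P.marks j) := by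
  simp [isStart]

theorem isStart_of_mem_marks {i j : ℕ} (hi : i < P.code.length) (h : i ∈ P.marks j) :
    P.isStart i = true := by
  refine isStart_iff.2 ⟨hi, Or.inr ⟨j, ?_, h⟩⟩
  by_contra hj
  simp [marks, mayThrow, List.getElem?_eq_none (not_lt.1 hj)] at h

theorem lt_of_isStart {i : ℕ} (h : P.isStart i = true) : i < P.code.length := (isStart_iff.1 h).1

theorem lt_of_mayThrow {i : ℕ} (h : P.mayThrow i = true) : i < P.code.length := by
  by_contra hi
  simp [mayThrow, List.getElem?_eq_none (not_lt.1 hi)] at h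

theorem marks_of_mayThrow {j : ℕ} (h : P.mayThrow j = true) :
    P.marks j = (j + 1) :: (P.handlersAt j).flatMap fun h => [h.startPC, h.endPC, h.handlerPC] := by
  have h' := h
  simp only [mayThrow] at h'
  unfold marks
  split <;> simp_all

theorem pmap_le (i : ℕ) : P.pmap i ≤ i := by
  induction i with
  | zero => simp [pmap]
  | succ i ih => rw [pmap]; split_ifs <;> omega

theorem pmap_of_isStart {b : ℕ} (h : P.isStart b = true) : P.pmap b = b := by
  cases b with
  | zero => rfl
  | succ b => simp [pmap, h]

/-- Points between a point and the start of its block belong to the same block. -/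
theorem pmap_eq_of_le {i j : ℕ} (hj : P.pmap i ≤ j) (hji : j ≤ i) : P.pmap j = P.pmap i := by
  induction i with
  | zero => rw [Nat.le_zero.1 hji]
  | succ i ih =>
    rcases hji.eq_or_lt with rfl | hlt
    · rfl
    rw [pmap] at hj ⊢
    split_ifs at hj ⊢
    · omega
    · exact ih hj (by omega)

theorem mem_blockPoints {b i : ℕ} : i ∈ P.blockPoints b ↔ i < P.code.length ∧ P.pmap i = b := by
  simp [blockPoints]

/-- The points of a block form an interval, and the point after it, if there is one, starts a
block. -/
theorem blockPoints_eq {b : ℕ} (h : P.isStart b = true) :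
    b ≤ P.lastPoint b ∧ P.lastPoint b < P.code.length ∧ P.pmap (P.lastPoint b) = b ∧
      P.blockPoints b = List.range' b (P.lastPoint b - b) ++ [P.lastPoint b] ∧
      (P.lastPoint b + 1 < P.code.length → P.isStart (P.lastPoint b + 1) = true) := by
  have hb : b ∈ P.blockPoints b := mem_blockPoints.2 ⟨lt_of_isStart h, pmap_of_isStart h⟩
  have hne : P.blockPoints b ≠ [] := List.ne_nil_of_mem hb
  have hsorted : (P.blockPoints b).Pairwise (· < ·) := List.pairwise_lt_range.filter _
  have hlast : P.lastPoint b = (P.blockPoints b).getLast hne := by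
    simp [lastPoint, List.getLast?_eq_some_getLast hne]
  have hmem : P.lastPoint b ∈ P.blockPoints b := hlast ▸ List.getLast_mem hne
  obtain ⟨hlt, hpm⟩ := mem_blockPoints.1 hmem
  have hble : b ≤ P.lastPoint b := by
    have := P.pmap_le (P.lastPoint b)
    omega
  have hle : ∀ i ∈ P.blockPoints b, i ≤ P.lastPoint b := by
    intro i hi
    rw [← List.dropLast_append_getLast hne, ← hlast] at hi hsorted
    rcases List.mem_append.1 hi with hi | hi
    · exact ((List.pairwise_append.1 hsorted).2.2 i hi _ (by simp)).le
    · simp at hi; omega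
  refine ⟨hble, hlt, hpm, ?_, ?_⟩
  · have hr : List.range' b (P.lastPoint b - b) ++ [P.lastPoint b] =
        List.range' b (P.lastPoint b - b + 1) := by
      rw [List.range'_concat]; simp; omega
    rw [hr]
    refine hsorted.eq_of_mem_iff List.pairwise_lt_range' fun i => ?_
    rw [List.mem_range'_1]
    constructor
    · intro hi
      have h1 := hle i hi
      have h2 := (mem_blockPoints.1 hi).2
      have h3 := P.pmap_le i
      omega
    · rintro ⟨h1, h2⟩
      exact mem_blockPoints.2
        ⟨by omega, by rw [pmap_eq_of_le (i := P.lastPoint b) (by omega) (by omega), hpm]⟩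
  · intro hlt'
    by_contra hns
    have := hle (P.lastPoint b + 1) (mem_blockPoints.2 ⟨hlt', by rw [pmap, if_neg hns, hpm]⟩)
    omega

/-- The label of the block at which normal execution continues after the point `i`, if `i` is the
last point of its block; for an `ifeq` this is the block after it. -/
def nextLabel (P : JMethod C F M) (i : ℕ) : Option Label :=
  match P.code[i]? with
  | some (.goto t) => some (.insn t)
  | some .ret => some .ret
  | some (.invoke _) => some (.result i)
  | some .throw => none
  | _ => some (.insn (i + 1))

theorem pSucc_insn (b : ℕ) : P.pSucc (.insn b) = P.nextLabel (P.lastPoint b) := rfl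

/-- Instructions that never end a basic block. -/
def _root_.JInstr.IsPlain : JInstr C F M → Prop
  | .push _ | .pop | .load _ | .store _ | .binop _ | .swap | .new _ | .newarray _ => True
  | _ => False

theorem nextLabel_of_isPlain {i : ℕ} {ins : JInstr C F M} (h : P.code[i]? = some ins)
    (hp : ins.IsPlain) : P.nextLabel i = some (.insn (i + 1)) := by
  cases ins <;> simp_all [nextLabel, JInstr.IsPlain]

theorem mayThrow_of_mem_excTags {i : ℕ} {ins : JInstr C F M} {e : C} (h : P.code[i]? = some ins)
    (he : e ∈ ins.excTags E P i) : P.mayThrow i = true := by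
  cases ins <;> simp_all [mayThrow, JInstr.excTags]

theorem mem_handlersAt_of_handlerOf {i h : ℕ} {e : C} (hh : handlerOf E P.handlers i e = some h) :
    ∃ x ∈ P.handlersAt i, x.handlerPC = h := by
  simp only [handlerOf, Option.map_eq_some_iff] at hh
  obtain ⟨x, hx, rfl⟩ := hh
  have := List.find?_some hx
  simp only [Bool.and_eq_true] at this
  exact ⟨x, List.mem_filter.2 ⟨List.mem_of_find?_eq_some hx, by simpa using this.1⟩, rfl⟩

/-- As all points are reachable, a point that does not start a block is only reached from the point
before it, and that one holds an instruction which does not end a block. -/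
theorem Verified.isPlain (hv : P.Verified E) {i : ℕ} (hi : i + 1 < P.code.length)
    (hs : P.isStart (i + 1) = false) : ∃ ins, P.code[i]? = some ins ∧ ins.IsPlain := by
  have hmark : ∀ j, i + 1 ∉ P.marks j := fun j hj => by
    simp [isStart_of_mem_marks hi hj] at hs
  have key : ∀ k, JReachable E P k → k = i + 1 →
      ∃ ins, P.code[i]? = some ins ∧ ins.FallsThrough := by
    intro k hk hki
    cases hk with
    | entry => omega
    | @step j _ τ _ hstep =>
      cases hstep with
      | next hc hf =>
        obtain rfl : j = i := by omega
        exact ⟨_, hc, hf⟩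
      | goto hc => exact absurd (by simp [marks, hc, hki]) (hmark j)
      | ifeq hc => exact absurd (by simp [marks, hc, hki]) (hmark j)
      | exc hc he hh =>
        refine absurd ?_ (hmark j)
        rw [marks_of_mayThrow (mayThrow_of_mem_excTags hc he)]
        obtain ⟨x, hx, hx'⟩ := mem_handlersAt_of_handlerOf hh
        refine List.mem_cons_of_mem _ (List.mem_flatMap.2 ⟨x, hx, ?_⟩)
        simp [hx', hki]
  obtain ⟨ins, hc, hf⟩ := key _ (hv.reachable _ hi) rfl
  refine ⟨ins, hc, ?_⟩
  have hm := hmark i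
  cases ins <;> first
    | trivial
    | exact hf.elim
    | (exfalso; apply hm; simp [marks, mayThrow, hc])

theorem isStart_entry (hv : P.Verified E) : P.isStart 0 = true :=
  isStart_iff.2 ⟨hv.nonempty, Or.inl rfl⟩

theorem Verified.isStart_of_nextLabel (hv : P.Verified E) {i b : ℕ} (hi : i < P.code.length)
    (hlast : i + 1 < P.code.length → P.isStart (i + 1) = true)
    (h : P.nextLabel i = some (.insn b)) : P.isStart b = true := by
  obtain ⟨ins, hc⟩ : ∃ ins, P.code[i]? = some ins := ⟨_, List.getElem?_eq_getElem hi⟩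
  have hnext : ins.FallsThrough → P.isStart (i + 1) = true := fun hf =>
    hlast (hv.succ_lt i .norm _ (.next hc hf))
  cases ins
  case goto t =>
    obtain rfl : t = b := by simpa [nextLabel, hc] using h
    exact isStart_of_mem_marks (j := i) (hv.succ_lt i .norm _ (.goto hc)) (by simp [marks, hc])
  all_goals
    simp only [nextLabel, hc, Option.some.injEq, reduceCtorEq, Label.insn.injEq] at h
    try (subst h; exact hnext trivial)

theorem Verified.isStart_ifeq (hv : P.Verified E) {i t : ℕ} (h : P.code[i]? = some (.ifeq t)) :
    P.isStart t = true :=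
  isStart_of_mem_marks (j := i) (hv.succ_lt i .norm _ (.ifeq h)) (by simp [marks, h])

theorem Verified.isStart_succ (hv : P.Verified E) {i m} (h : P.code[i]? = some (.invoke m)) :
    P.isStart (i + 1) = true :=
  isStart_of_mem_marks (j := i) (hv.succ_lt i .norm _ (.next h trivial))
    (by simp [marks, mayThrow, h])

/-! ### Labels and their order -/

theorem mem_usedHandlers {h : ℕ} : h ∈ P.usedHandlers ↔ h < P.code.length ∧
    ∃ i, P.mayThrow i = true ∧ ∃ x ∈ P.handlersAt i, x.handlerPC = h := by
  simp only [usedHandlers, List.mem_filter, List.mem_range, List.any_eq_true, Bool.and_eq_true,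
    beq_iff_eq]
  exact and_congr_right fun _ => exists_congr fun i =>
    ⟨fun h => h.2, fun h => ⟨lt_of_mayThrow h.1, h⟩⟩

theorem insn_mem_labels {b : ℕ} : .insn b ∈ P.labels ↔ P.isStart b = true := by
  have : (.insn b ∈ P.labels) ↔ b < P.code.length ∧ P.isStart b = true := by
    simp only [labels, List.mem_append, List.mem_map, List.mem_filter, List.mem_range,
      Label.insn.injEq, exists_eq_right, reduceCtorEq, and_false, exists_false, or_false]
    split_ifs <;> simp
  exact this.trans ⟨fun h => h.2, fun h => ⟨lt_of_isStart h, h⟩⟩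

theorem result_mem_labels {i : ℕ} : .result i ∈ P.labels ↔ ∃ m, P.code[i]? = some (.invoke m) := by
  have : (.result i ∈ P.labels) ↔ i < P.code.length ∧
      (match P.code[i]? with | some (.invoke _) => true | _ => false) = true := by
    simp only [labels, List.mem_append, List.mem_map, List.mem_filter, List.mem_range,
      Label.result.injEq, exists_eq_right, reduceCtorEq, and_false, exists_false, or_false,
      false_or]
    split_ifs <;> simp
  rw [this]
  constructor
  · rintro ⟨_, h⟩
    split at h
    · exact ⟨_, by assumption⟩
    · simp at h
  · rintro ⟨m, h⟩
    exact ⟨(List.getElem?_eq_some_iff.1 h).1, by simp [h]⟩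

theorem handler_mem_labels {h : ℕ} : .handler h ∈ P.labels ↔ h ∈ P.usedHandlers := by
  simp only [labels, List.mem_append, List.mem_map,
    Label.handler.injEq, exists_eq_right, reduceCtorEq, and_false, exists_false, false_or]
  split_ifs <;> simp

theorem ret_mem_labels : .ret ∈ P.labels ↔ ∃ i : ℕ, P.code[i]? = some JInstr.ret := by
  simp only [labels, List.mem_append, List.mem_map, reduceCtorEq, and_false, exists_false, false_or]
  split_ifs with h
  · simp only [List.mem_singleton, true_iff]
    obtain ⟨i, _, hi⟩ := List.any_eq_true.1 h
    refine ⟨i, ?_⟩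
    split at hi
    · assumption
    · simp at hi
  · simp only [List.not_mem_nil, false_iff]
    rintro ⟨i, hi⟩
    exact h (List.any_eq_true.2
      ⟨i, List.mem_range.2 (List.getElem?_eq_some_iff.1 hi).1, by simp [hi]⟩)

theorem isStart_of_mem_usedHandlers {h : ℕ} (hh : h ∈ P.usedHandlers) :
    P.isStart h = true := by
  obtain ⟨hlt, i, hi, x, hx, rfl⟩ := mem_usedHandlers.1 hh
  refine isStart_of_mem_marks hlt (j := i) ?_
  rw [marks_of_mayThrow hi]
  exact List.mem_cons_of_mem _ (List.mem_flatMap.2 ⟨x, hx, by simp⟩)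

theorem Verified.mem_usedHandlers_of_mem (hv : P.Verified E) {i : ℕ} (hi : P.mayThrow i = true)
    {x : HandlerEntry C} (hx : x ∈ P.handlersAt i) : x.handlerPC ∈ P.usedHandlers :=
  mem_usedHandlers.2 ⟨hv.handler_lt x (List.mem_filter.1 hx).1, i, hi, x, hx, rfl⟩

theorem Verified.pSucc_mem_labels (hv : P.Verified E) {l s : Label} (hl : l ∈ P.labels)
    (h : P.pSucc l = some s) : s ∈ P.labels := by
  cases l with
  | insn b =>
    obtain ⟨-, hlt, -, -, hstart⟩ := blockPoints_eq (insn_mem_labels.1 hl)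
    rw [pSucc_insn] at h
    cases s with
    | insn b' => exact insn_mem_labels.2 (hv.isStart_of_nextLabel hlt hstart h)
    | result i =>
      unfold nextLabel at h
      split at h <;> simp at h
      subst h
      exact result_mem_labels.2 ⟨_, by assumption⟩
    | handler i => unfold nextLabel at h; split at h <;> simp at h
    | ret =>
      unfold nextLabel at h
      split at h <;> simp at h
      exact ret_mem_labels.2 ⟨_, by assumption⟩
  | result i =>
    obtain ⟨m, hm⟩ := result_mem_labels.1 hl
    obtain rfl : Label.insn (i + 1) = s := by simpa [pSucc] using h
    exact insn_mem_labels.2 (hv.isStart_succ hm)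
  | handler i =>
    obtain rfl : Label.insn i = s := by simpa [pSucc] using h
    exact insn_mem_labels.2 (isStart_of_mem_usedHandlers (handler_mem_labels.1 hl))
  | ret => simp [pSucc] at h

theorem Verified.succs_subset (hv : P.Verified E) {l s : Label} (hl : l ∈ P.labels)
    (h : s ∈ P.succs l) : s ∈ P.labels := by
  simp only [succs, List.mem_append] at h
  rcases h with (h | h) | h
  · exact hv.pSucc_mem_labels hl (by simpa using h)
  · split at h
    · split at h
      · obtain rfl := List.mem_singleton.1 h
        exact insn_mem_labels.2 (hv.isStart_ifeq (by assumption))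
      · simp at h
    · simp at h
  · obtain ⟨x, hx, rfl⟩ := List.mem_map.1 h
    refine handler_mem_labels.2 ?_
    unfold blockHandlers at hx
    split at hx
    · split_ifs at hx with ht
      · exact hv.mem_usedHandlers_of_mem ht hx
      · simp at hx
    · simp at hx

/-- A duplicate-free list of labels of blocks. -/
def IsOrder (P : JMethod C F M) (ordered : List Label) : Prop :=
  ordered.Nodup ∧ ∀ l ∈ ordered, l ∈ P.labels

theorem IsOrder.concat {ordered : List Label} (h : P.IsOrder ordered) {x : Label}
    (hx : x ∈ P.labels) (hx' : x ∉ ordered) : P.IsOrder (ordered ++ [x]) := by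
  refine ⟨?_, ?_⟩
  · rw [List.nodup_append]
    refine ⟨h.1, by simp, fun a ha b hb => ?_⟩
    obtain rfl := List.mem_singleton.1 hb
    exact fun hab => hx' (hab ▸ ha)
  · intro l hl
    rcases List.mem_append.1 hl with hl | hl
    · exact h.2 l hl
    · exact (List.mem_singleton.1 hl) ▸ hx

theorem Verified.isOrder_traceSuccessors (hv : P.Verified E) (fuel : ℕ) {ordered : List Label}
    (h : P.IsOrder ordered) {x : Label} (hx : x ∈ P.labels) (hx' : x ∉ ordered) :
    P.IsOrder (P.traceSuccessors fuel ordered x) := by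
  induction fuel generalizing ordered x with
  | zero => exact h
  | succ fuel ih =>
    rw [traceSuccessors]
    split
    · exact h.concat hx hx'
    · rename_i y hy
      have := List.find?_some hy
      exact ih (h.concat hx hx') (hv.succs_subset hx (List.mem_of_find?_eq_some hy))
        (by simpa using this)

theorem prefix_traceSuccessors (fuel : ℕ) (ordered : List Label) (x : Label) :
    ordered <+: P.traceSuccessors fuel ordered x := by
  induction fuel generalizing ordered x with
  | zero => exact List.prefix_rfl
  | succ fuel ih =>
    rw [traceSuccessors]
    split
    · exact List.prefix_append _ _
    · exact (List.prefix_append _ _).trans (ih _ _)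

theorem prefix_traceSuccessors_succ (fuel : ℕ) (ordered : List Label) (x : Label) :
    ordered ++ [x] <+: P.traceSuccessors (fuel + 1) ordered x := by
  rw [traceSuccessors]
  split
  · exact List.prefix_rfl
  · exact prefix_traceSuccessors _ _ _

theorem pickParent_eq_some {ordered loop : List Label} {x p : Label} {ps : List Label}
    (h : P.pickParent ordered loop x ps = some p) : p ∈ ps ∧ p ∉ ordered := by
  induction ps with
  | nil => simp [pickParent] at h
  | cons q ps ih =>
    rw [pickParent] at h
    split_ifs at h with h1 h2
    · obtain rfl := Option.some.inj h
      simp only [Bool.and_eq_true, Bool.not_eq_true', List.contains_eq_mem,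
        decide_eq_false_iff_not] at h2
      exact ⟨by simp, h2.2⟩
    · exact ⟨List.mem_cons_of_mem _ (ih h).1, (ih h).2⟩

theorem pickStartingPoint_spec {ordered : List Label} (fuel : ℕ) (loop : List Label) {x : Label}
    (hx : x ∈ P.labels) (hx' : x ∉ ordered) :
    P.pickStartingPoint ordered fuel loop x ∈ P.labels ∧
      P.pickStartingPoint ordered fuel loop x ∉ ordered := by
  induction fuel generalizing loop x with
  | zero => exact ⟨hx, hx'⟩
  | succ fuel ih =>
    rw [pickStartingPoint]
    split
    · exact ⟨hx, hx'⟩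
    · rename_i p hp
      obtain ⟨h1, h2⟩ := pickParent_eq_some hp
      exact ih _ (List.mem_filter.1 h1).1 h2

theorem IsOrder.length_le {ordered : List Label} (h : P.IsOrder ordered) :
    ordered.length ≤ P.labels.length :=
  (List.subperm_of_subset h.1 h.2).length_le

theorem prefix_pickOrderLoop (fuel : ℕ) (ordered : List Label) :
    ordered <+: P.pickOrderLoop fuel ordered := by
  induction fuel generalizing ordered with
  | zero => exact List.prefix_rfl
  | succ fuel ih =>
    rw [pickOrderLoop]
    split
    · exact List.prefix_rfl
    · exact (prefix_traceSuccessors _ _ _).trans (ih _)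

/-- Each round orders at least one more block, so that the fuel suffices. -/
theorem Verified.pickOrderLoop_spec (hv : P.Verified E) (fuel : ℕ) {ordered : List Label}
    (h : P.IsOrder ordered) (hfuel : P.labels.length < fuel + ordered.length) :
    P.IsOrder (P.pickOrderLoop fuel ordered) ∧
      ∀ l ∈ P.labels, l ∈ P.pickOrderLoop fuel ordered := by
  induction fuel generalizing ordered with
  | zero => have := h.length_le; omega
  | succ fuel ih =>
    rw [pickOrderLoop]
    split
    · rename_i hn
      refine ⟨h, fun l hl => ?_⟩
      simpa using List.find?_eq_none.1 hn l hl
    · rename_i x hx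
      obtain ⟨h1, h2⟩ := pickStartingPoint_spec (ordered := ordered) P.labels.length [x]
        (List.mem_of_find?_eq_some hx) (by simpa using List.find?_some hx)
      obtain ⟨n, hn⟩ : ∃ n, P.labels.length = n + 1 :=
        Nat.exists_eq_succ_of_ne_zero (List.length_pos_of_mem h1).ne'
      refine ih (hv.isOrder_traceSuccessors _ h h1 h2) ?_
      have := (prefix_traceSuccessors_succ (P := P) n ordered
        (P.pickStartingPoint ordered P.labels.length [x] x)).length_le
      rw [← hn, List.length_append, List.length_singleton] at this
      omega

/-- The chosen order consists of all blocks, without repetition, and starts with the entry block. -/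
theorem Verified.pickOrder_spec (hv : P.Verified E) :
    P.IsOrder P.pickOrder ∧ (∀ l ∈ P.labels, l ∈ P.pickOrder) ∧
      ∃ ls, P.pickOrder = .insn 0 :: ls := by
  have h0 : .insn 0 ∈ P.labels := insn_mem_labels.2 (isStart_entry hv)
  obtain ⟨n, hn⟩ : ∃ n, P.labels.length = n + 1 :=
    Nat.exists_eq_succ_of_ne_zero (List.length_pos_of_mem h0).ne'
  have hpre := prefix_traceSuccessors_succ (P := P) n [] (.insn 0)
  rw [← hn, List.nil_append] at hpre
  have h := hv.pickOrderLoop_spec P.labels.length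
    (hv.isOrder_traceSuccessors P.labels.length (ordered := []) ⟨by simp, by simp⟩ h0 (by simp))
    (by have := hpre.length_le; simp at this; omega)
  obtain ⟨ls, hls⟩ := hpre.trans (prefix_pickOrderLoop P.labels.length _)
  exact ⟨h.1, h.2, ls, hls.symm⟩

end JMethod

/-! ### The shape of the output -/

namespace JMethod

variable {C F M : Type*} {E : Env C M} {P : JMethod C F M} {ts : ℕ → ℕ}

/-- Labelled output instructions: an instruction with symbolic targets, and its origin. -/
abbrev _root_.OutInsn (C F M : Type*) := Origin × DInstr C F M Label

/-- `Leads E P ts l c`: executing the output `c` from its first instruction simulates going to `l`.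
Either `c` starts with a `goto` to `l`, or with the first instruction that translates `l`, or `l` is
a point whose translation is empty and `c` leads to the point after it. A label `insn i` stands
here for any program point, whether or not it starts a block. -/
inductive Leads (E : Env C M) (P : JMethod C F M) (ts : ℕ → ℕ) : Label → List (OutInsn C F M) → Prop
  | goto {x l c} : Leads E P ts l ((P.gotoOrigin x, .goto l) :: c)
  | insn {i d c} : Leads E P ts (.insn i) ((.insn i 0, d) :: c)
  | empty {i : ℕ} {ins l c} : P.code[i]? = some ins → P.transInstr E (ts i) ins = [] →
      P.nextLabel i = some l → Leads E P ts l c → Leads E P ts (.insn i) c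
  | result {i r c} : Leads E P ts (.result i) ((.result i, .moveresult r) :: c)
  | handler {h r c} : Leads E P ts (.handler h) ((.handler h, .moveexception r) :: c)
  | ret {c} : Leads E P ts .ret ((.ret, .ret 0) :: c)

/-- What is known about an output instruction and the output `c` after it. -/
inductive Shape (E : Env C M) (P : JMethod C F M) (ts : ℕ → ℕ) :
    OutInsn C F M → List (OutInsn C F M) → Prop
  | goto {x s c} : s ∈ P.labels → Shape E P ts (P.gotoOrigin x, .goto s) c
  | insn {i k : ℕ} {ins d c} : P.code[i]? = some ins →
      (P.transInstr E (ts i) ins)[k]? = some d →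
      (∀ d', (P.transInstr E (ts i) ins)[k + 1]? = some d' → c.head? = some (.insn i (k + 1), d')) →
      ((P.transInstr E (ts i) ins)[k + 1]? = none →
        ∀ l, P.nextLabel i = some l → Leads E P ts l c) →
      Shape E P ts (.insn i k, d) c
  | ifneq {i t : ℕ} {c} : P.code[i]? = some (.ifeq t) → P.isStart (i + 1) = true →
      Leads E P ts (.insn t) c →
      Shape E P ts (.insn i 0, .ifneq (P.locN + (ts i - 1)) (.insn (i + 1))) c
  | result {i : ℕ} {m c} : P.code[i]? = some (.invoke m) → Leads E P ts (.insn (i + 1)) c →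
      Shape E P ts (.result i, .moveresult (P.locN + (ts i - (E.nbArguments m + 1)))) c
  | handler {h c} : h ∈ P.usedHandlers → Leads E P ts (.insn h) c →
      Shape E P ts (.handler h, .moveexception P.locN) c
  | ret {i : ℕ} {c} : P.code[i]? = some .ret → Shape E P ts (.ret, .ret 0) c

/-- All instructions of an output have the expected shape. -/
def AllShape (E : Env C M) (P : JMethod C F M) (ts : ℕ → ℕ) : List (OutInsn C F M) → Prop
  | [] => True
  | x :: c => Shape E P ts x c ∧ AllShape E P ts c

theorem AllShape.shape {out : List (OutInsn C F M)} {p : ℕ} {x : OutInsn C F M}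
    (h : AllShape E P ts out) (hp : out[p]? = some x) : Shape E P ts x (out.drop (p + 1)) := by
  induction out generalizing p with
  | nil => simp at hp
  | cons y c ih =>
    cases p with
    | zero =>
      obtain rfl : y = x := by simpa using hp
      exact h.1
    | succ p => exact ih h.2 (by simpa using hp)

/-- The output for one point of a block. -/
def pointInsns (E : Env C M) (P : JMethod C F M) (ts : ℕ → ℕ) (i : ℕ) : List (OutInsn C F M) :=
  match P.code[i]? with
  | some ins => (P.transInstr E (ts i) ins).mapIdx fun k d => (.insn i k, d)
  | none => []

theorem blockInsns_insn (b : ℕ) :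
    P.blockInsns E ts (.insn b) = (P.blockPoints b).flatMap (P.pointInsns E ts) := rfl

theorem pointInsns_shape {i : ℕ} {c : List (OutInsn C F M)} (hi : i < P.code.length)
    (hc : AllShape E P ts c) (hl : ∀ l, P.nextLabel i = some l → Leads E P ts l c) :
    AllShape E P ts (P.pointInsns E ts i ++ c) ∧
      Leads E P ts (.insn i) (P.pointInsns E ts i ++ c) := by
  obtain ⟨ins, hins⟩ : ∃ ins, P.code[i]? = some ins := ⟨_, List.getElem?_eq_getElem hi⟩
  have hone : ∀ d, P.transInstr E (ts i) ins = [d] →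
      AllShape E P ts (P.pointInsns E ts i ++ c) ∧
        Leads E P ts (.insn i) (P.pointInsns E ts i ++ c) := by
    intro d hd
    simp only [pointInsns, hins, hd, List.mapIdx_cons, List.mapIdx_nil, List.singleton_append]
    exact ⟨⟨.insn hins (by simp [hd]) (by simp [hd]) fun _ => hl, hc⟩, .insn⟩
  have hnil : ∀ l, P.transInstr E (ts i) ins = [] → P.nextLabel i = some l →
      AllShape E P ts (P.pointInsns E ts i ++ c) ∧
        Leads E P ts (.insn i) (P.pointInsns E ts i ++ c) := by
    intro l hd hn
    simp only [pointInsns, hins, hd, List.mapIdx_nil, List.nil_append]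
    exact ⟨hc, .empty hins hd hn (hl l hn)⟩
  cases ins
  case pop => exact hnil _ rfl (by simp [nextLabel, hins]; rfl)
  case goto t => exact hnil _ rfl (by simp [nextLabel, hins]; rfl)
  case swap =>
    simp only [pointInsns, hins, transInstr, List.mapIdx_cons, List.mapIdx_nil, List.cons_append,
      List.nil_append]
    refine ⟨⟨?_, ?_, ?_, ?_, hc⟩, .insn⟩
    · exact .insn hins rfl (by simp [transInstr]) (by simp [transInstr])
    · exact .insn hins rfl (by simp [transInstr]) (by simp [transInstr])
    · exact .insn hins rfl (by simp [transInstr]) (by simp [transInstr])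
    · exact .insn hins rfl (by simp [transInstr]) fun _ => hl
  all_goals exact hone _ rfl

/-- Consecutive points that do not end a block are laid out one after the other. -/
theorem range_shape {c : List (OutInsn C F M)} (hc : AllShape E P ts c) (n b : ℕ)
    (hplain : ∀ j, b ≤ j → j < b + n → ∃ ins, P.code[j]? = some ins ∧ ins.IsPlain)
    (hl : Leads E P ts (.insn (b + n)) c) :
    AllShape E P ts ((List.range' b n).flatMap (P.pointInsns E ts) ++ c) ∧
      Leads E P ts (.insn b) ((List.range' b n).flatMap (P.pointInsns E ts) ++ c) := by
  induction n generalizing b with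
  | zero => simpa using ⟨hc, hl⟩
  | succ n ih =>
    obtain ⟨h1, h2⟩ := ih (b + 1) (fun j hj hj' => hplain j (by omega) (by omega))
      (by rwa [show b + 1 + n = b + (n + 1) by omega])
    rw [List.range'_succ, List.flatMap_cons, List.append_assoc]
    obtain ⟨ins, hins, hp⟩ := hplain b le_rfl (by omega)
    refine pointInsns_shape (List.getElem?_eq_some_iff.1 hins).1 h1 fun l hb => ?_
    rw [nextLabel_of_isPlain hins hp] at hb
    exact Option.some.inj hb ▸ h2

theorem Verified.isPlain_of_block (hv : P.Verified E) {b j : ℕ} (hb : P.isStart b = true)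
    (h : b ≤ j) (h' : j < P.lastPoint b) : ∃ ins, P.code[j]? = some ins ∧ ins.IsPlain := by
  obtain ⟨-, hlt, hpm, -, -⟩ := blockPoints_eq hb
  refine hv.isPlain (by omega) ?_
  by_contra hs
  have h1 := pmap_of_isStart (P := P) (b := j + 1) (by simpa using hs)
  have h2 := pmap_eq_of_le (P := P) (i := P.lastPoint b) (j := j + 1) (by omega) (by omega)
  omega

theorem exists_of_mem_pointInsns {i : ℕ} {x : OutInsn C F M} (h : x ∈ P.pointInsns E ts i) :
    ∃ ins k, P.code[i]? = some ins ∧ (P.transInstr E (ts i) ins)[k]? = some x.2 ∧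
      x.1 = .insn i k := by
  unfold pointInsns at h
  split at h
  · rename_i ins hins
    obtain ⟨k, hk, rfl⟩ := List.mem_mapIdx.1 h
    exact ⟨ins, k, hins, by simp [hk], rfl⟩
  · simp at h

/-- The instructions of a block before those of its last point contain no test, so that the last
instruction of a block is a test only if its last point is. -/
theorem Verified.ifeq_of_mem (hv : P.Verified E) {b r : ℕ} {o : Origin} {t : Label}
    (hb : P.isStart b = true) (h : (o, .ifeq r t) ∈ P.blockInsns E ts (.insn b)) :
    ∃ t' : ℕ, P.code[P.lastPoint b]? = some (.ifeq t') := by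
  obtain ⟨hle, hlt, hpm, heq, -⟩ := blockPoints_eq hb
  rw [blockInsns_insn, heq] at h
  obtain ⟨i, hi, h⟩ := List.mem_flatMap.1 h
  obtain ⟨ins, k, hins, hk, -⟩ := exists_of_mem_pointInsns h
  have hins' : ∃ t', ins = .ifeq t' := by
    cases ins <;> simp only [transInstr] at hk <;>
      first
      | exact ⟨_, rfl⟩
      | (have := List.mem_of_getElem? hk; simp at this)
  obtain ⟨t', rfl⟩ := hins'
  rcases List.mem_append.1 hi with hi | hi
  · rw [List.mem_range'_1] at hi
    obtain ⟨ins, h1, h2⟩ := hv.isPlain_of_block hb hi.1 (by omega)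
    rw [hins] at h1
    obtain rfl := Option.some.inj h1
    exact h2.elim
  · exact ⟨t', by rwa [List.mem_singleton.1 hi] at hins⟩

/-- If a final test is not inverted, a block is completed by nothing or by a `goto`. -/
theorem emit_eq (x : Label) (next : Option Label)
    (h : ∀ o r t, (o, .ifeq r t) ∈ P.blockInsns E ts x → next = some t → P.pSucc x = some t) :
    P.emit E ts x next = P.blockInsns E ts x ++
      match P.pSucc x with
      | none => []
      | some s => if next = some s then [] else [(P.gotoOrigin x, .goto s)] := by
  unfold emit
  cases hs : P.pSucc x with
  | none => simp
  | some s =>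
    simp only
    split_ifs with h1
    · simp
    · split
      · rename_i o r t hlast
        rw [if_neg fun hn => h1 ?_]
        rw [hn, ← hs, h o r t (List.mem_of_getLast? hlast) hn]
      · rfl

/-- Emitting a block in front of an output that starts with the next block: what is appended to the
block, or the inversion of its final test, makes it lead to its successors. -/
theorem Verified.emit_shape (hv : P.Verified E) {x : Label} (hx : x ∈ P.labels)
    {next : Option Label} {c : List (OutInsn C F M)} (hc : AllShape E P ts c)
    (hnext : ∀ y, next = some y → Leads E P ts y c) :
    AllShape E P ts (P.emit E ts x next ++ c) ∧ Leads E P ts x (P.emit E ts x next ++ c) := by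
  -- the output after the instructions of the block
  have htail : ∀ l, P.pSucc x = some l →
      AllShape E P ts ((if next = some l then [] else [(P.gotoOrigin x, .goto l)]) ++ c) ∧
      Leads E P ts l ((if next = some l then [] else [(P.gotoOrigin x, .goto l)]) ++ c) := by
    intro l hl
    split_ifs with h
    · exact ⟨hc, hnext l h⟩
    · exact ⟨⟨.goto (hv.pSucc_mem_labels hx hl), hc⟩, .goto⟩
  cases x with
  | insn b =>
    have hb := insn_mem_labels.1 hx
    obtain ⟨hle, hlt, hpm, heq, hstart⟩ := blockPoints_eq hb
    have hrange : ∀ {c' : List (OutInsn C F M)}, AllShape E P ts c' →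
        Leads E P ts (.insn (P.lastPoint b)) c' →
        AllShape E P ts
          ((List.range' b (P.lastPoint b - b)).flatMap (P.pointInsns E ts) ++ c') ∧
        Leads E P ts (.insn b)
          ((List.range' b (P.lastPoint b - b)).flatMap (P.pointInsns E ts) ++ c') := by
      intro c' h1 h2
      refine range_shape h1 _ _ (fun j hj hj' => hv.isPlain_of_block hb hj (by omega)) ?_
      rwa [show b + (P.lastPoint b - b) = P.lastPoint b by omega]
    have hout : P.blockInsns E ts (.insn b) =
        (List.range' b (P.lastPoint b - b)).flatMap (P.pointInsns E ts) ++
          P.pointInsns E ts (P.lastPoint b) := by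
      rw [blockInsns_insn, heq, List.flatMap_append, List.flatMap_singleton]
    by_cases hinv : ∃ t : ℕ, P.code[P.lastPoint b]? = some (.ifeq t) ∧ next = some (.insn t) ∧
        next ≠ some (.insn (P.lastPoint b + 1))
    · obtain ⟨t, ht, hn, hn'⟩ := hinv
      have hpoint : P.pointInsns E ts (P.lastPoint b) =
          [(.insn (P.lastPoint b) 0, .ifeq (P.locN + (ts (P.lastPoint b) - 1)) (.insn t))] := by
        simp [pointInsns, ht, transInstr]
      have hemit : P.emit E ts (.insn b) next =
          (List.range' b (P.lastPoint b - b)).flatMap (P.pointInsns E ts) ++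
          [(.insn (P.lastPoint b) 0, .ifneq (P.locN + (ts (P.lastPoint b) - 1))
            (.insn (P.lastPoint b + 1)))] := by
        have hs : P.pSucc (.insn b) = some (.insn (P.lastPoint b + 1)) := by
          simp [pSucc_insn, nextLabel, ht]
        unfold emit
        simp only [hs, if_neg hn', hout, hpoint, List.getLast?_append, List.getLast?_singleton,
          Option.some_or, if_pos hn, List.dropLast_concat]
      rw [hemit, List.append_assoc]
      refine hrange ⟨.ifneq ht (hstart ?_) (hnext _ hn), hc⟩ .insn
      exact hv.succ_lt _ .norm _ (.next ht trivial)
    · rw [emit_eq]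
      · rw [hout, List.append_assoc, List.append_assoc]
        have hpt := pointInsns_shape (E := E) (P := P) (ts := ts) (i := P.lastPoint b)
          (c := (match P.pSucc (.insn b) with
            | none => []
            | some s => if next = some s then [] else [(P.gotoOrigin (.insn b), .goto s)]) ++ c) hlt
        have : AllShape E P ts ((match P.pSucc (.insn b) with
            | none => []
            | some s =>
              if next = some s then [] else [(P.gotoOrigin (.insn b), .goto s)]) ++ c) := by
          cases hs : P.pSucc (.insn b) with
          | none => exact hc
          | some s => exact (htail s hs).1
        obtain ⟨h1, h2⟩ := hpt this fun l hl => by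
          rw [← pSucc_insn] at hl
          rw [hl]
          exact (htail l hl).2
        exact hrange h1 h2
      · intro o r t hmem hn
        obtain ⟨t', ht'⟩ := hv.ifeq_of_mem hb hmem
        have : t = .insn t' := by
          rw [hout] at hmem
          rcases List.mem_append.1 hmem with hmem | hmem
          · obtain ⟨i, hi, hmem⟩ := List.mem_flatMap.1 hmem
            rw [List.mem_range'_1] at hi
            obtain ⟨ins, h1, h2⟩ := hv.isPlain_of_block hb hi.1 (by omega)
            obtain ⟨ins', k, h1', h3, -⟩ := exists_of_mem_pointInsns hmem
            rw [h1] at h1'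
            obtain rfl := Option.some.inj h1'
            cases ins <;> first
              | exact h2.elim
              | (have := List.mem_of_getElem? h3; simp [transInstr] at this)
          · simp [pointInsns, ht', transInstr] at hmem
            exact hmem.2.2
        subst this
        have : next = some (.insn (P.lastPoint b + 1)) := by
          by_contra hn'
          exact hinv ⟨t', ht', hn, hn'⟩
        rw [pSucc_insn, ← hn, this]
        simp [nextLabel, ht']
  | result i =>
    obtain ⟨m, hm⟩ := result_mem_labels.1 hx
    rw [emit_eq _ _ (by simp [blockInsns, hm])]
    obtain ⟨h1, h2⟩ := htail (.insn (i + 1)) rfl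
    simp only [blockInsns, hm, pSucc, List.append_assoc]
    exact ⟨⟨.result hm h2, h1⟩, .result⟩
  | handler h =>
    rw [emit_eq _ _ (by simp [blockInsns])]
    obtain ⟨h1, h2⟩ := htail (.insn h) rfl
    simp only [blockInsns, pSucc, List.append_assoc]
    exact ⟨⟨.handler (handler_mem_labels.1 hx) h2, h1⟩, .handler⟩
  | ret =>
    obtain ⟨i, hi⟩ := ret_mem_labels.1 hx
    rw [emit_eq _ _ (by simp [blockInsns])]
    simp only [blockInsns, pSucc, List.append_assoc]
    exact ⟨⟨.ret hi, hc⟩, .ret⟩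

end JMethod

/-! ### Addresses -/

namespace JMethod

variable {C F M : Type*} {E : Env C M} {P : JMethod C F M} {ts : ℕ → ℕ}

/-- A laid out program: blocks with their output. -/
abbrev _root_.Layout (C F M : Type*) := List (Label × List (OutInsn C F M))

theorem Verified.layout_shape (hv : P.Verified E) {xs : List Label} (h : ∀ x ∈ xs, x ∈ P.labels) :
    AllShape E P ts ((P.layout E ts xs).flatMap Prod.snd) ∧
      ∀ y, xs.head? = some y → Leads E P ts y ((P.layout E ts xs).flatMap Prod.snd) := by
  induction xs with
  | nil => simp [layout, AllShape]
  | cons x xs ih =>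
    obtain ⟨h1, h2⟩ := ih fun y hy => h y (List.mem_cons_of_mem _ hy)
    obtain ⟨h3, h4⟩ := hv.emit_shape (h x List.mem_cons_self) h1 h2
    rw [layout, List.flatMap_cons]
    refine ⟨h3, fun y hy => ?_⟩
    obtain rfl : x = y := by simpa using hy
    exact h4

/-- The address of a block in the output is where it starts. -/
theorem Verified.leads_address (hv : P.Verified E) {xs : List Label} (h : ∀ x ∈ xs, x ∈ P.labels)
    {l : Label} (hl : l ∈ xs) :
    Leads E P ts l (((P.layout E ts xs).flatMap Prod.snd).drop (address l (P.layout E ts xs))) := by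
  induction xs with
  | nil => simp at hl
  | cons x xs ih =>
    by_cases hx : x = l
    · subst hx
      simpa [layout, address] using (hv.layout_shape (ts := ts) h).2 x rfl
    · have := ih (fun y hy => h y (List.mem_cons_of_mem _ hy))
        ((List.mem_cons.1 hl).resolve_left (Ne.symm hx))
      simpa [layout, address, hx, List.drop_append, List.drop_eq_nil_of_le] using this

/-- `addr` gives the addresses of the blocks of a layout that starts at `a`. -/
def Offsets (addr : Label → ℕ) : ℕ → Layout C F M → Prop
  | _, [] => True
  | a, b :: lay => addr b.1 = a ∧ Offsets addr (a + b.2.length) lay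

theorem offsets_layout {xs : List Label} (hnd : xs.Nodup) {addr : Label → ℕ} {a : ℕ}
    (h : ∀ l ∈ xs, addr l = a + address l (P.layout E ts xs)) :
    Offsets addr a (P.layout E ts xs) := by
  induction xs generalizing a with
  | nil => trivial
  | cons x xs ih =>
    obtain ⟨hx, hnd⟩ := List.nodup_cons.1 hnd
    refine ⟨by simpa [layout, address] using h x List.mem_cons_self, ih hnd fun l hl => ?_⟩
    rw [h l (List.mem_cons_of_mem _ hl), layout, address, if_neg, add_assoc]
    rintro rfl
    exact hx hl

theorem Offsets.exists_block {addr : Label → ℕ} {a p : ℕ} {lay : Layout C F M} {x : OutInsn C F M}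
    (h : Offsets addr a lay) (hp : (lay.flatMap Prod.snd)[p]? = some x) :
    ∃ b ∈ lay, addr b.1 ≤ a + p ∧ a + p < addr b.1 + b.2.length ∧ x ∈ b.2 := by
  induction lay generalizing a p with
  | nil => simp at hp
  | cons b lay ih =>
    rw [List.flatMap_cons] at hp
    obtain ⟨h1, h2⟩ := h
    by_cases hlt : p < b.2.length
    · rw [List.getElem?_append_left hlt] at hp
      exact ⟨b, List.mem_cons_self, by omega, by omega, List.mem_of_getElem? hp⟩
    · rw [List.getElem?_append_right (by omega)] at hp
      obtain ⟨b', hb', h3, h4, h5⟩ := ih h2 hp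
      exact ⟨b', List.mem_cons_of_mem _ hb', by omega, by omega, h5⟩

theorem mem_layout {xs : List Label} {b : Label × List (OutInsn C F M)}
    (h : b ∈ P.layout E ts xs) : b.1 ∈ xs ∧ ∃ next, b.2 = P.emit E ts b.1 next := by
  induction xs with
  | nil => simp [layout] at h
  | cons x xs ih =>
    rw [layout] at h
    rcases List.mem_cons.1 h with rfl | h
    · exact ⟨List.mem_cons_self, _, rfl⟩
    · exact ⟨List.mem_cons_of_mem _ (ih h).1, (ih h).2⟩

theorem origin_mem_blockInsns {l : Label} {next : Option Label} {i k : ℕ} {d}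
    (h : (.insn i k, d) ∈ P.emit E ts l next) : ∃ d', (.insn i k, d') ∈ P.blockInsns E ts l := by
  have hgoto : Origin.insn i k ≠ P.gotoOrigin l := by cases l <;> simp [gotoOrigin]
  unfold emit at h
  simp only at h
  split at h
  · exact ⟨d, h⟩
  · split_ifs at h
    · exact ⟨d, h⟩
    · split at h
      · rename_i o r t hlast
        split_ifs at h
        · rcases List.mem_append.1 h with h | h
          · exact ⟨d, List.mem_of_mem_dropLast h⟩
          · simp only [List.mem_singleton, Prod.mk.injEq] at h
            exact ⟨_, h.1 ▸ List.mem_of_getLast? hlast⟩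
        · exact ⟨d, by simpa [hgoto] using h⟩
      · exact ⟨d, by simpa [hgoto] using h⟩

theorem label_of_mem_blockInsns {l : Label} {i k : ℕ} {d}
    (h : (.insn i k, d) ∈ P.blockInsns E ts l) : ∃ b, l = .insn b ∧ i ∈ P.blockPoints b := by
  cases l with
  | insn b =>
    rw [blockInsns_insn] at h
    obtain ⟨j, hj, h⟩ := List.mem_flatMap.1 h
    obtain ⟨_, k', -, -, h⟩ := exists_of_mem_pointInsns h
    simp only [Origin.insn.injEq] at h
    exact ⟨b, rfl, h.1 ▸ hj⟩
  | result j => simp only [blockInsns] at h; split at h <;> simp at h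
  | handler j => simp [blockInsns] at h
  | ret => simp [blockInsns] at h

/-- A throwing instruction ends its block, so that a block has the handlers of its last point. -/
theorem Verified.lastPoint_of_mayThrow (hv : P.Verified E) {b i : ℕ} (hb : P.isStart b = true)
    (hi : i ∈ P.blockPoints b) (ht : P.mayThrow i = true) : P.lastPoint b = i := by
  obtain ⟨-, -, -, heq, -⟩ := blockPoints_eq hb
  rw [heq] at hi
  rcases List.mem_append.1 hi with hi | hi
  · rw [List.mem_range'_1] at hi
    obtain ⟨ins, h1, h2⟩ := hv.isPlain_of_block hb hi.1 (by omega)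
    cases ins <;> first
      | exact h2.elim
      | simp [mayThrow, h1] at ht
  · exact (List.mem_singleton.1 hi).symm

/-! ### Exception tables -/

/-- The targets and classes of the entries of an exception table that are active at `q`. -/
def _root_.activeHandlers (table : List (HandlerEntry C)) (q : ℕ) : List (ℕ × C) :=
  (table.filter fun h => decide (h.startPC ≤ q) && decide (q < h.endPC)).map
    fun h => (h.handlerPC, h.catchType)

theorem _root_.handlerOf_eq_activeHandlers (table : List (HandlerEntry C)) (q : ℕ) (e : C) :
    handlerOf E table q e =
      ((activeHandlers table q).find? fun x => E.catches x.2 e).map Prod.fst := by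
  rw [activeHandlers, List.find?_map, List.find?_filter, Option.map_map, handlerOf]
  congr 2
  funext h
  simp

theorem _root_.activeHandlers_append (t t' : List (HandlerEntry C)) (q : ℕ) :
    activeHandlers (t ++ t') q = activeHandlers t q ++ activeHandlers t' q := by
  simp [activeHandlers]

theorem _root_.Sweep.activeHandlers_flush_of_lt {addr : Label → ℕ} {w : Sweep C} {q : ℕ}
    (hq : q < w.cS) : activeHandlers (w.flush addr) q = activeHandlers w.table q := by
  rw [Sweep.flush, activeHandlers_append]
  simp [activeHandlers, hq]

theorem _root_.Sweep.activeHandlers_flush {addr : Label → ℕ} {w : Sweep C} {q : ℕ}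
    (hq : w.cS ≤ q) (hq' : q < w.cE) (ht : ∀ h ∈ w.table, h.endPC ≤ w.cS) :
    activeHandlers (w.flush addr) q =
      w.cH.map fun h => (addr (.handler h.handlerPC), h.catchType) := by
  have : activeHandlers w.table q = [] := by
    simp only [activeHandlers, List.map_eq_nil_iff, List.filter_eq_nil_iff]
    intro h hh
    have := ht h hh
    simp
    omega
  rw [Sweep.flush, activeHandlers_append, this, List.nil_append, activeHandlers,
    List.filter_eq_self.2 (by simp [hq, hq']), List.map_map]
  rfl

/-- In the table that the sweep produces, the entries active inside a throwing block are those for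
the handlers of the block. The first two conjuncts say that what the sweep has already passed is
kept. -/
theorem activeHandlers_foldl_sweepStep [DecidableEq C] {addr : Label → ℕ} {lay : Layout C F M}
    {a : ℕ} (hoff : Offsets addr a lay) {w : Sweep C} (hS : w.cS ≤ w.cE) (hE : w.cE ≤ a)
    (ht : ∀ h ∈ w.table, h.endPC ≤ w.cS) :
    (∀ q < w.cS, activeHandlers ((lay.foldl (P.sweepStep addr) w).flush addr) q =
      activeHandlers w.table q) ∧
    (∀ q, w.cS ≤ q → q < w.cE → activeHandlers ((lay.foldl (P.sweepStep addr) w).flush addr) q =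
      w.cH.map fun h => (addr (.handler h.handlerPC), h.catchType)) ∧
    ∀ b ∈ lay, P.canThrow b.1 = true → ∀ q, addr b.1 ≤ q → q < addr b.1 + b.2.length →
      activeHandlers ((lay.foldl (P.sweepStep addr) w).flush addr) q =
        (P.blockHandlers b.1).map fun h => (addr (.handler h.handlerPC), h.catchType) := by
  induction lay generalizing a w with
  | nil =>
    exact ⟨fun q hq => Sweep.activeHandlers_flush_of_lt hq,
      fun q hq hq' => Sweep.activeHandlers_flush hq hq' ht, by simp⟩
  | cons b lay ih =>
    obtain ⟨h1, h2⟩ := hoff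
    rw [List.foldl_cons]
    simp only [List.forall_mem_cons]
    by_cases hc : P.canThrow b.1 = true
    · by_cases hH : w.cH = P.blockHandlers b.1
      · -- the current range is extended
        have hw : P.sweepStep addr w b = { w with cE := addr b.1 + b.2.length } := by
          simp [sweepStep, hc, hH]
        rw [hw]
        obtain ⟨i1, i2, i3⟩ := ih (w := { w with cE := addr b.1 + b.2.length }) h2
          (by simp only; omega) (by simp only; omega) ht
        exact ⟨i1, fun q hq hq' => i2 q hq (by simp only; omega),
          fun _ q hq hq' => hH ▸ i2 q (by simp only; omega) hq', i3⟩
      · -- a new range is opened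
        have hw : P.sweepStep addr w b =
            ⟨P.blockHandlers b.1, addr b.1, addr b.1 + b.2.length, w.flush addr⟩ := by
          simp [sweepStep, hc, hH]
        rw [hw]
        obtain ⟨i1, i2, i3⟩ := ih
          (w := ⟨P.blockHandlers b.1, addr b.1, addr b.1 + b.2.length, w.flush addr⟩) h2
          (by simp only; omega) (by simp only; omega) (by
            intro h hh
            simp only [Sweep.flush, List.mem_append, List.mem_map] at hh ⊢
            rcases hh with hh | ⟨h', -, rfl⟩
            · have := ht h hh
              omega
            · simp only; omega)
        refine ⟨fun q hq => ?_, fun q hq hq' => ?_, fun _ q hq hq' => i2 q hq hq', i3⟩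
        · rw [i1 q (by simp only; omega), Sweep.activeHandlers_flush_of_lt hq]
        · rw [i1 q (by simp only; omega), Sweep.activeHandlers_flush hq hq' ht]
    · have hw : P.sweepStep addr w b = w := by simp [sweepStep, hc]
      rw [hw]
      obtain ⟨i1, i2, i3⟩ := ih h2 hS (by omega) ht
      exact ⟨i1, i2, fun h => absurd h hc, i3⟩

/-- The exception tables of the method and of its translation agree, up to the `moveexception`
blocks in front of the handlers. -/
theorem Verified.handlerOf_translate [DecidableEq C] (hv : P.Verified E) {p i k : ℕ} {d}
    (hp : ((P.layout E ts P.pickOrder).flatMap Prod.snd)[p]? = some (.insn i k, d))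
    (ht : P.mayThrow i = true) (e : C) :
    handlerOf E (P.translateWith E ts).handlers p e =
      (handlerOf E P.handlers i e).map fun h =>
        address (.handler h) (P.layout E ts P.pickOrder) := by
  obtain ⟨hord, -, -⟩ := hv.pickOrder_spec
  have hoff : Offsets (fun l => address l (P.layout E ts P.pickOrder)) 0
      (P.layout E ts P.pickOrder) := offsets_layout hord.1 (by simp)
  obtain ⟨b, hb, h1, h2, hmem⟩ := hoff.exists_block hp
  obtain ⟨hbx, next, hemit⟩ := mem_layout hb
  rw [hemit] at hmem
  obtain ⟨d', hd'⟩ := origin_mem_blockInsns hmem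
  obtain ⟨b', hb', hi⟩ := label_of_mem_blockInsns hd'
  have hstart : P.isStart b' = true := insn_mem_labels.1 (hb' ▸ hord.2 _ hbx)
  have hlast := hv.lastPoint_of_mayThrow hstart hi ht
  have key := (activeHandlers_foldl_sweepStep (P := P) hoff (w := ⟨[], 0, 0, []⟩) le_rfl le_rfl
    (by simp)).2.2 b hb (by simp [hb', canThrow, hlast, ht]) p (by omega) (by omega)
  have hT : (P.translateWith E ts).handlers =
      ((P.layout E ts P.pickOrder).foldl
        (P.sweepStep fun l => address l (P.layout E ts P.pickOrder)) ⟨[], 0, 0, []⟩).flush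
          fun l => address l (P.layout E ts P.pickOrder) := rfl
  rw [handlerOf_eq_activeHandlers, handlerOf_eq_activeHandlers, hT, key, hb']
  simp only [blockHandlers, hlast, ht, if_true, activeHandlers, handlersAt, List.find?_map,
    Option.map_map]
  rfl

end JMethod

/-! ### Simulation of the transfer rules -/

section Simulation

variable {S C F M : Type*} [SemilatticeSup S] [OrderBot S]

namespace StackType

/-- A register type obtained by popping the cells `pre` and pushing a cell. -/
theorem set_flatten_le (pol : Policy S C) (locN : ℕ) (pre : StackType S) {st st' : StackType S}
    (h : StackType.Le st st') {a b : ExtLevel S} (hab : a.Le b) :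
    ((flatten pol locN (pre ++ st)).set (.r (locN + st.length)) a).Le
      (flatten pol locN (b :: st')) := by
  rw [flatten_cons, ← List.Forall₂.length_eq h]
  exact ((flatten_append_le pol locN pre st).trans (flatten_mono pol locN h)).set _ hab

theorem flatten_append_le_of_le (pol : Policy S C) (locN : ℕ) (pre : StackType S)
    {st st' : StackType S} (h : StackType.Le st st') :
    (flatten pol locN (pre ++ st)).Le (flatten pol locN st') :=
  (flatten_append_le pol locN pre st).trans (flatten_mono pol locN h)

/-- Assigning to a local variable a level below its policy. -/
theorem set_local_flatten_le (pol : Policy S C) (locN : ℕ) {rt : RegType S} {st : StackType S}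
    (h : rt.Le (flatten pol locN st)) {x : ℕ} (hx : x < locN) {a : ExtLevel S}
    (ha : a.Le (pol.ka x)) : (rt.set (.r x) a).Le (flatten pol locN st) := by
  have := h.set (.r x) ha
  rwa [show (flatten pol locN st).set (.r x) (pol.ka x) = flatten pol locN st from
    Function.update_eq_self_iff.2 (flatten_local pol locN st hx).symm] at this

end StackType

variable {E : Env C M} {P : JMethod C F M} {X : Ctx S C F M} {D : DMethod C F M}
  {addr : Label → ℕ} {R : ℕ → Tag C → Set ℕ} {se' : ℕ → S} {at'' : ℕ → ExtLevel S} {i p : ℕ}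

open StackType

/-- The arguments of a call are read off the registers in the order of the stack from the bottom:
the object first, then the cell of depth `t` as argument `t`. -/
theorem JCallOk.dCallOk {mid : M} {pol : Policy S C} {st₁ : StackType S} {k : S}
    (h : JCallOk E X i mid pol st₁ k) (hse : se' p = X.se i) (locN : ℕ) (st₂ : StackType S) :
    DCallOk { X with region := R, se := se', at' := at'' } p pol
      (flatten X.sgn locN (st₁ ++ .base k :: st₂)) (E.nbArguments mid + 1)
      ((locN + ((st₁ ++ ExtLevel.base k :: st₂).length - (E.nbArguments mid + 1))) ::
        (List.range (E.nbArguments mid)).map fun t =>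
          locN + ((st₁ ++ ExtLevel.base k :: st₂).length - 1 - t)) k := by
  obtain ⟨hlen, hargs, hrecv, hkh⟩ := h
  have h0 : (st₁ ++ ExtLevel.base k :: st₂).length - (E.nbArguments mid + 1) = st₂.length := by
    simp only [List.length_append, List.length_cons]; omega
  have hr : flatten X.sgn locN (st₁ ++ .base k :: st₂) (.r (locN + st₂.length)) =
      some (.base k) := flatten_append _ _ _ _ _
  refine ⟨by simp, ⟨_, rfl, by rw [h0, hr]⟩, by simpa only [hse] using hkh, fun t r ht => ?_⟩
  cases t with
  | zero =>
    obtain rfl := Option.some.inj ht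
    exact ⟨_, by rw [h0, hr], hrecv⟩
  | succ t =>
    simp only [List.getElem?_cons_succ, List.getElem?_map, Option.map_eq_some_iff] at ht
    obtain ⟨t', ht', rfl⟩ := ht
    obtain ⟨hlt, rfl⟩ := List.getElem?_eq_some_iff.1 ht'
    simp only [List.length_range] at hlt
    simp only [List.getElem_range]
    have hget : st₁[t]? = some st₁[t] := List.getElem?_eq_getElem (by omega)
    refine ⟨st₁[t], ?_, hargs t _ hget⟩
    have hsplit : st₁ ++ ExtLevel.base k :: st₂ =
        st₁.take t ++ st₁[t] :: (st₁.drop (t + 1) ++ ExtLevel.base k :: st₂) := by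
      have h1 : st₁ = st₁.take t ++ st₁[t] :: st₁.drop (t + 1) := by
        rw [← List.drop_eq_getElem_cons, List.take_append_drop]
      conv_lhs => rw [h1]
      rw [List.append_assoc, List.cons_append]
    have := flatten_append X.sgn locN (st₁.take t) (st₁.drop (t + 1) ++ ExtLevel.base k :: st₂)
      st₁[t]
    rw [← hsplit] at this
    rw [← this]
    congr 2
    simp only [List.length_append, List.length_cons, List.length_drop]
    omega

/-- The normal step of a JVM instruction that is translated to a single DEX instruction. -/
theorem JTrans.dtrans_norm (hv : P.Verified E) {st st' : StackType S} {ins : JInstr C F M}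
    {d : DInstr C F M Label} (h : JTrans E P X i .norm st st')
    (hst : ∀ a ∈ st, X.se i ≤ a.head) (hins : P.code[i]? = some ins)
    (hd : P.transInstr E st.length ins = [d]) (hp : D.code[p]? = some (d.resolve addr))
    (hse : se' p = X.se i) (hat : at'' p = X.at' i)
    (hg : ∀ q ∈ R p .norm, guardLevel E P X.Γ st i .norm ≤ se' q)
    (hinv : ∀ m, ins ≠ .invoke m) :
    ∃ rt', DTrans E D { X with region := R, se := se', at' := at'' } p .norm
        (st.flatten X.sgn P.locN) rt' ∧ rt'.Le (st'.flatten X.sgn P.locN) := by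
  have hins' : ∀ ins', P.code[i]? = some ins' → ins' = ins := fun ins' h' =>
    Option.some.inj (h'.symm.trans hins)
  simp only [guardLevel, hins] at hg
  cases h with
  | push h =>
    obtain rfl := hins' _ h
    obtain rfl := List.singleton_inj.1 hd
    exact ⟨_, .const hp, set_flatten_le _ _ [] (.refl _) (ExtLevel.base_le hse.le)⟩
  | pop h =>
    obtain rfl := hins' _ h
    simp [JMethod.transInstr] at hd
  | load h =>
    obtain rfl := hins' _ h
    obtain rfl := List.singleton_inj.1 hd
    exact ⟨_, .move hp (flatten_local _ _ _ (hv.load_lt _ _ h)),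
      set_flatten_le _ _ [] (.refl _) ((ExtLevel.Le.refl _).join hse.le)⟩
  | @store x k _ h h' =>
    obtain rfl := hins' _ h
    obtain rfl := List.singleton_inj.1 hd
    refine ⟨_, .move hp (flatten_append X.sgn P.locN [] st' k), ?_⟩
    exact set_local_flatten_le _ _ (flatten_append_le _ _ [k] st') (hv.store_lt _ _ h)
      (((ExtLevel.Le.refl _).join hse.le).trans h')
  | @binop op k₁ k₂ st h =>
    obtain rfl := hins' _ h
    obtain rfl := List.singleton_inj.1 hd
    refine ⟨_, .binop hp (flatten_append X.sgn P.locN [.base k₁] st (.base k₂))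
      (flatten_append X.sgn P.locN [] (.base k₂ :: st) (.base k₁)), ?_⟩
    exact set_flatten_le _ _ [.base k₁, .base k₂] (.refl st)
      (ExtLevel.base_le (by simp only [hse, sup_comm k₂ k₁, le_refl]))
  | swap h =>
    obtain rfl := hins' _ h
    simp [JMethod.transInstr] at hd
  | goto h =>
    obtain rfl := hins' _ h
    simp [JMethod.transInstr] at hd
  | @ifeq t k st h _ =>
    obtain rfl := hins' _ h
    obtain rfl := List.singleton_inj.1 hd
    refine ⟨_, .ifeq hp (flatten_append X.sgn P.locN [] st k) ?_,
      flatten_append_le_of_le _ _ [k] (le_lift _ st)⟩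
    intro q hq
    exact sup_le (hse.le.trans ((hst k (by simp)).trans (hg q hq))) (hg q hq)
  | new h =>
    obtain rfl := hins' _ h
    obtain rfl := List.singleton_inj.1 hd
    exact ⟨_, .new hp, set_flatten_le _ _ [] (.refl _) (ExtLevel.base_le hse.le)⟩
  | @getfield f k st h _ =>
    obtain rfl := hins' _ h
    obtain rfl := List.singleton_inj.1 hd
    refine ⟨_, .iget hp (flatten_append X.sgn P.locN [] st (.base k)) hg, ?_⟩
    refine set_flatten_le _ _ [.base k] (le_lift _ st) (ExtLevel.Le.trans ?_ (ExtLevel.le_join _ _))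
    exact (ExtLevel.Le.refl _).join (sup_le_sup_left hse.le _)
  | @putfield f k₁ k₂ st h h₁ h₂ _ =>
    obtain rfl := hins' _ h
    obtain rfl := List.singleton_inj.1 hd
    refine ⟨_, .iput hp (flatten_append X.sgn P.locN [] (.base k₂ :: st) k₁)
      (flatten_append X.sgn P.locN [k₁] st (.base k₂)) ?_ h₂ hg,
      flatten_append_le_of_le _ _ [k₁, .base k₂] (le_lift _ st)⟩
    simpa only [hse, sup_comm] using h₁
  | @newarray t k st h =>
    obtain rfl := hins' _ h
    obtain rfl := List.singleton_inj.1 hd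
    refine ⟨_, .newarray hp (flatten_append X.sgn P.locN [] st (.base k)), ?_⟩
    exact set_flatten_le _ _ [.base k] (.refl _) (hat ▸ .refl _)
  | @arraylength k kc st h _ =>
    obtain rfl := hins' _ h
    obtain rfl := List.singleton_inj.1 hd
    refine ⟨_, .arraylength hp (flatten_append X.sgn P.locN [] st (.arr k kc)) hg, ?_⟩
    exact set_flatten_le _ _ [.arr k kc] (le_lift _ st) (ExtLevel.le_join _ _)
  | @arrayload k₁ k₂ kc st h _ =>
    obtain rfl := hins' _ h
    obtain rfl := List.singleton_inj.1 hd
    refine ⟨_, .aget hp (flatten_append X.sgn P.locN [.base k₁] st (.arr k₂ kc))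
      (flatten_append X.sgn P.locN [] (.arr k₂ kc :: st) (.base k₁)) hg, ?_⟩
    refine set_flatten_le _ _ [.base k₁, .arr k₂ kc] (le_lift _ st)
      (ExtLevel.Le.trans ?_ (ExtLevel.le_join _ _))
    -- the security environment, absent from the JVM rule, is below the level of the index
    refine (ExtLevel.Le.refl _).join (sup_le (sup_le ?_ le_sup_right) le_sup_left)
    exact hse.le.trans ((hst (.base k₁) (by simp)).trans le_sup_left)
  | @arraystore k₁ k₂ k₃ kc st h h₁ _ =>
    obtain rfl := hins' _ h
    obtain rfl := List.singleton_inj.1 hd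
    refine ⟨_, .aput hp (flatten_append X.sgn P.locN [k₁, .base k₂] st (.arr k₃ kc))
      (flatten_append X.sgn P.locN [k₁] (.arr k₃ kc :: st) (.base k₂))
      (flatten_append X.sgn P.locN [] (.base k₂ :: .arr k₃ kc :: st) k₁) ?_ hg,
      flatten_append_le_of_le _ _ [k₁, .base k₂, .arr k₃ kc] (le_lift _ st)⟩
    simpa only [sup_comm] using h₁
  | invoke h _ _ => exact absurd (hins' _ h).symm (hinv _)

/-- The normal step of a call leaves the arguments in their registers and puts the result into the
pseudo-register, from which `moveresult` fetches it. -/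
theorem JTrans.dtrans_invoke {st st' : StackType S} {mid : M}
    {d : DInstr C F M Label} (h : JTrans E P X i .norm st st')
    (hins : P.code[i]? = some (.invoke mid))
    (hd : P.transInstr E st.length (.invoke mid) = [d]) (hp : D.code[p]? = some (d.resolve addr))
    (hse : se' p = X.se i) (hg : ∀ q ∈ R p .norm, guardLevel E P X.Γ st i .norm ≤ se' q) :
    ∃ rt' b st₂, st' = b :: st₂ ∧
      DTrans E D { X with region := R, se := se', at' := at'' } p .norm
        (st.flatten X.sgn P.locN) rt' ∧ rt'.Le ((flatten X.sgn P.locN st₂).set .ret b) := by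
  have hins' : ∀ ins', P.code[i]? = some ins' → ins' = .invoke mid := fun ins' h' =>
    Option.some.inj (h'.symm.trans hins)
  cases h
  case invoke mid' st₁ k st₂ h hcall _ =>
    obtain rfl := JInstr.invoke.inj (hins' _ h)
    obtain rfl := List.singleton_inj.1 hd
    simp only [guardLevel, hins, headAt_append hcall.1, ExtLevel.head_base] at hg
    refine ⟨_, _, _, rfl, .invoke hp (hcall.dCallOk hse _ _) hg, ?_⟩
    refine RegType.Le.set ?_ _
      (((ExtLevel.Le.refl _).join hse.le).trans (ExtLevel.le_join _ _))
    have := flatten_append_le_of_le X.sgn P.locN (st₁ ++ [.base k]) (le_lift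
      (k ⊔ escapeLevel E mid' (X.Γ mid' k)) st₂)
    rw [List.append_assoc] at this
    exact this
  all_goals exact absurd (hins' _ (by assumption)) (by simp)

/-- The exceptional steps: all the translations to one instruction agree in that the level of the
exception ends up in its pseudo-register. -/
theorem JTrans.dtrans_exc {st st' : StackType S} {ins : JInstr C F M} {e : C}
    {d : DInstr C F M Label} (h : JTrans E P X i (.exc e) st st')
    (hins : P.code[i]? = some ins)
    (hd : P.transInstr E st.length ins = [d]) (hp : D.code[p]? = some (d.resolve addr))
    (hse : se' p = X.se i) (hloc : D.locN = P.locN) (hca : D.classAnalysis p = P.classAnalysis i)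
    {t : ℕ} (ht : handlerOf E D.handlers p e = some t)
    (hg : ∀ q ∈ R p (.exc e), guardLevel E P X.Γ st i (.exc e) ≤ se' q) :
    ∃ (rt : RegType S) (a : ExtLevel S), st' = [a] ∧ rt.Le (X.sgn.regs P.locN) ∧
      DTrans E D { X with region := R, se := se', at' := at'' } p (.exc e)
        (st.flatten X.sgn P.locN) (rt.set .ex a) := by
  have hins' : ∀ ins', P.code[i]? = some ins' → ins' = ins := fun ins' h' =>
    Option.some.inj (h'.symm.trans hins)
  cases h with
  | @getfieldNp f k _ st h _ _ =>
    obtain rfl := hins' _ h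
    obtain rfl := List.singleton_inj.1 hd
    simp only [guardLevel, hins] at hg
    refine ⟨X.sgn.regs D.locN, _, rfl, hloc ▸ .refl _, ?_⟩
    rw [← hse]
    exact .igetNp hp (flatten_append X.sgn P.locN [] st (.base k)) hg ht
  | @putfieldNp f k₁ k₂ _ st h h₁ _ _ =>
    obtain rfl := hins' _ h
    obtain rfl := List.singleton_inj.1 hd
    simp only [guardLevel, hins] at hg
    refine ⟨X.sgn.regs D.locN, _, rfl, hloc ▸ .refl _, ?_⟩
    rw [← hse]
    exact .iputNp hp (flatten_append X.sgn P.locN [] (.base k₂ :: st) k₁)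
      (flatten_append X.sgn P.locN [k₁] st (.base k₂))
      (by simpa only [hse, sup_comm] using h₁) hg ht
  | @arraylengthNp k kc _ st h _ _ =>
    obtain rfl := hins' _ h
    obtain rfl := List.singleton_inj.1 hd
    simp only [guardLevel, hins] at hg
    refine ⟨X.sgn.regs D.locN, _, rfl, hloc ▸ .refl _, ?_⟩
    rw [← hse]
    exact .arraylengthNp hp (flatten_append X.sgn P.locN [] st (.arr k kc)) hg ht
  | @arrayloadNp k₁ k₂ kc _ st h _ _ =>
    obtain rfl := hins' _ h
    obtain rfl := List.singleton_inj.1 hd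
    simp only [guardLevel, hins] at hg
    refine ⟨X.sgn.regs D.locN, _, rfl, hloc ▸ .refl _, ?_⟩
    rw [← hse]
    exact .agetNp hp (flatten_append X.sgn P.locN [.base k₁] st (.arr k₂ kc))
      (flatten_append X.sgn P.locN [] (.arr k₂ kc :: st) (.base k₁)) hg ht
  | @arraystoreNp k₁ k₂ k₃ kc _ st h h₁ _ _ =>
    obtain rfl := hins' _ h
    obtain rfl := List.singleton_inj.1 hd
    simp only [guardLevel, hins] at hg
    refine ⟨X.sgn.regs D.locN, _, rfl, hloc ▸ .refl _, ?_⟩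
    rw [← hse]
    exact .aputNp hp (flatten_append X.sgn P.locN [k₁, .base k₂] st (.arr k₃ kc))
      (flatten_append X.sgn P.locN [k₁] (.arr k₃ kc :: st) (.base k₂))
      (flatten_append X.sgn P.locN [] (.base k₂ :: .arr k₃ kc :: st) k₁)
      (by simpa only [sup_comm] using h₁) hg ht
  | invokeExc h hcall he _ _ =>
    obtain rfl := hins' _ h
    obtain rfl := List.singleton_inj.1 hd
    simp only [guardLevel, hins, headAt_append hcall.1, ExtLevel.head_base] at hg
    refine ⟨X.sgn.regs D.locN, _, rfl, hloc ▸ .refl _, ?_⟩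
    exact .invokeExc hp (hcall.dCallOk hse _ _) he ht hg
  | @throw k _ _ st h he _ _ =>
    obtain rfl := hins' _ h
    obtain rfl := List.singleton_inj.1 hd
    simp only [guardLevel, hins] at hg
    refine ⟨_, _, rfl, flatten_le_regs _ _ (k :: st), ?_⟩
    rw [← hse]
    exact .throw hp (flatten_append X.sgn P.locN [] st k) (hca ▸ he) hg ht

/-- Exceptions that leave the method. Their regions are empty, so that no guard remains to check. -/
theorem JTransExit.dtransExit_exc {st : StackType S} {ins : JInstr C F M} {e : C}
    {d : DInstr C F M Label} (h : JTransExit E P X i (.exc e) st)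
    (hst : ∀ a ∈ st, X.se i ≤ a.head) (hins : P.code[i]? = some ins)
    (hd : P.transInstr E st.length ins = [d]) (hp : D.code[p]? = some (d.resolve addr))
    (hse : se' p = X.se i) (hca : D.classAnalysis p = P.classAnalysis i)
    (ht : handlerOf E D.handlers p e = none) (hg : R p (.exc e) = ∅) :
    DTransExit E D { X with region := R, se := se', at' := at'' } p (.exc e)
        (st.flatten X.sgn P.locN) := by
  have hins' : ∀ ins', P.code[i]? = some ins' → ins' = ins := fun ins' h' =>
    Option.some.inj (h'.symm.trans hins)
  have hg' : ∀ k, Ctx.Guards { X with region := R, se := se', at' := at'' } p (.exc e) k := by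
    simp [Ctx.Guards, hg]
  -- the security environment, absent from the JVM rules, is below the level of the exception
  have hk : ∀ {a : ExtLevel S} {k l : S}, a ∈ st → a.head = k → k ≤ l → se' p ⊔ k ≤ l := by
    rintro a _ l ha rfl hl
    exact sup_le ((hse.le.trans (hst a ha)).trans hl) hl
  cases h with
  | @getfield f k st h _ _ hkr =>
    obtain rfl := hins' _ h
    obtain rfl := List.singleton_inj.1 hd
    exact .iget hp (flatten_append X.sgn P.locN [] st (.base k)) (hg' _) ht
      (hk (a := .base k) (by simp) rfl hkr)
  | @putfield f k₁ k₂ st h h₁ _ _ hkr =>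
    obtain rfl := hins' _ h
    obtain rfl := List.singleton_inj.1 hd
    exact .iput hp (flatten_append X.sgn P.locN [] (.base k₂ :: st) k₁)
      (flatten_append X.sgn P.locN [k₁] st (.base k₂))
      (by simpa only [hse, sup_comm] using h₁) (hg' _) ht
      (hk (a := .base k₂) (by simp) rfl hkr)
  | @arraylength k kc st h _ _ hkr =>
    obtain rfl := hins' _ h
    obtain rfl := List.singleton_inj.1 hd
    exact .arraylength hp (flatten_append X.sgn P.locN [] st (.arr k kc)) (hg' _) ht
      (hk (a := .arr k kc) (by simp) rfl hkr)
  | @arrayload k₁ k₂ kc st h _ _ hkr =>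
    obtain rfl := hins' _ h
    obtain rfl := List.singleton_inj.1 hd
    exact .aget hp (flatten_append X.sgn P.locN [.base k₁] st (.arr k₂ kc))
      (flatten_append X.sgn P.locN [] (.arr k₂ kc :: st) (.base k₁)) (hg' _) ht
      (hk (a := .arr k₂ kc) (by simp) rfl hkr)
  | @arraystore k₁ k₂ k₃ kc st h h₁ _ _ hkr =>
    obtain rfl := hins' _ h
    obtain rfl := List.singleton_inj.1 hd
    exact .aput hp (flatten_append X.sgn P.locN [k₁, .base k₂] st (.arr k₃ kc))
      (flatten_append X.sgn P.locN [k₁] (.arr k₃ kc :: st) (.base k₂))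
      (flatten_append X.sgn P.locN [] (.base k₂ :: .arr k₃ kc :: st) k₁)
      (by simpa only [sup_comm] using h₁) (hg' _) ht
      (hk (a := .arr k₃ kc) (by simp) rfl hkr)
  | invoke h hcall hkr he _ _ =>
    obtain rfl := hins' _ h
    obtain rfl := List.singleton_inj.1 hd
    exact .invoke hp (hcall.dCallOk hse _ _) (by simpa only [hse] using hkr) he ht (hg' _)
  | @throw k _ st h he hkr _ _ =>
    obtain rfl := hins' _ h
    obtain rfl := List.singleton_inj.1 hd
    exact .throw hp (flatten_append X.sgn P.locN [] st k) (hca ▸ he) (hg' _) ht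
      (hk (a := k) (by simp) rfl hkr)

end Simulation

/-! ### The DEX typing -/

section Typing

variable {S C F M : Type*} [SemilatticeSup S] [OrderBot S]

open StackType JMethod

/-- Copy the type of the register `rs` to the register `r`. -/
def RegType.move (rt : RegType S) (r rs : ℕ) : RegType S :=
  Function.update rt (.r r) (rt (.r rs))

/-- The register types before the four moves that translate a `swap` at stack height `n`, starting
from `rt`. -/
def swapType (locN n : ℕ) (rt : RegType S) : ℕ → RegType S
  | 0 => rt
  | 1 => rt.move (locN + n) (locN + (n - 2))
  | 2 => (rt.move (locN + n) (locN + (n - 2))).move (locN + (n + 1)) (locN + (n - 1))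
  | _ => ((rt.move (locN + n) (locN + (n - 2))).move (locN + (n + 1)) (locN + (n - 1))).move
      (locN + (n - 2)) (locN + (n + 1))

/-- A move out of a register whose level is above the security environment copies the level. -/
theorem DTrans.of_move {E : Env C M} {D : DMethod C F M} {X : Ctx S C F M} {p r rs : ℕ}
    {rt : RegType S} {a : ExtLevel S} (hp : D.code[p]? = some (.move r rs))
    (ha : rt (.r rs) = some a) (hse : X.se p ≤ a.head) :
    DTrans E D X p .norm rt (rt.move r rs) := by
  have := DTrans.move (E := E) (X := X) hp ha
  rwa [ExtLevel.join_eq_self hse, show rt.set (.r r) a = rt.move r rs by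
    rw [RegType.move, ha]; rfl] at this

/-- Each of the four moves for a `swap` changes the register type as `swapType` says. The moves add
the security environment to the levels that they copy, which is harmless because the levels on the
stack are above it. -/
theorem JTrans.dtrans_swap {E : Env C M} {P : JMethod C F M} {X : Ctx S C F M} {D : DMethod C F M}
    {addr : Label → ℕ} {R : ℕ → Tag C → Set ℕ} {se' : ℕ → S} {at'' : ℕ → ExtLevel S} {i p k : ℕ}
    {st st' : StackType S} {d : DInstr C F M Label} (h : JTrans E P X i .norm st st')
    (hst : ∀ a ∈ st, X.se i ≤ a.head) (hins : P.code[i]? = some .swap)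
    (hd : (P.transInstr E st.length .swap)[k]? = some d) (hp : D.code[p]? = some (d.resolve addr))
    (hse : se' p = X.se i) :
    ∃ rt', DTrans E D { X with region := R, se := se', at' := at'' } p .norm
        (swapType P.locN st.length (st.flatten X.sgn P.locN) k) rt' ∧
      (k < 3 → rt' = swapType P.locN st.length (st.flatten X.sgn P.locN) (k + 1)) ∧
      (k = 3 → rt'.Le (st'.flatten X.sgn P.locN)) := by
  cases h
  case swap k₁ k₂ s _ =>
    have h₁ : flatten X.sgn P.locN (k₁ :: k₂ :: s) (.r (P.locN + (s.length + 1))) = some k₁ :=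
      flatten_append X.sgn P.locN [] (k₂ :: s) k₁
    have h₂ : flatten X.sgn P.locN (k₁ :: k₂ :: s) (.r (P.locN + s.length)) = some k₂ :=
      flatten_append X.sgn P.locN [k₁] s k₂
    have hne : s.length + 1 + 1 ≠ s.length := by omega
    have hs₁ : se' p ≤ k₁.head := hse ▸ hst k₁ (by simp)
    have hs₂ : se' p ≤ k₂.head := hse ▸ hst k₂ (by simp)
    match k with
    | 0 =>
      obtain rfl := Option.some.inj hd
      exact ⟨_, .of_move hp h₂ hs₂, fun _ => rfl, by simp⟩
    | 1 =>
      obtain rfl := Option.some.inj hd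
      refine ⟨_, .of_move (a := k₁) hp ?_ hs₁, fun _ => rfl, by simp⟩
      simpa [swapType, RegType.move, Function.update_apply] using h₁
    | 2 =>
      obtain rfl := Option.some.inj hd
      refine ⟨_, .of_move (a := k₁) hp ?_ hs₁, fun _ => rfl, by simp⟩
      simpa [swapType, RegType.move, Function.update_apply] using h₁
    | 3 =>
      obtain rfl := Option.some.inj hd
      refine ⟨_, .of_move (a := k₂) hp ?_ hs₂, by simp, fun _ => ?_⟩
      · simpa [swapType, RegType.move, Function.update_apply, hne] using h₂
      · have key : ((((flatten X.sgn P.locN (k₁ :: k₂ :: s)).set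
            (.r (P.locN + (s.length + 1 + 1))) k₂).set
            (.r (P.locN + (s.length + 1 + 1 + 1))) k₁).set (.r (P.locN + s.length)) k₁).set
            (.r (P.locN + (s.length + 1))) k₂ |>.Le (flatten X.sgn P.locN (k₂ :: k₁ :: s)) := by
          rw [flatten_cons _ _ (k₁ :: s), flatten_cons _ _ s k₁]
          refine ((RegType.Le.set_left (RegType.Le.set_left (flatten_append_le X.sgn P.locN
            [k₁, k₂] s) ?_ _) ?_ _).set _ (.refl _)).set _ (.refl _) <;>
          (simp [flatten]; omega)
        convert key using 1
        funext r
        simp [swapType, RegType.move, RegType.set, Function.update_apply, h₁, h₂, hne]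
    | k + 4 => simp [transInstr] at hd
  all_goals
    exfalso
    have := Option.some.inj (hins.symm.trans (by assumption))
    simp at this

/-- The instructions that a DEX instruction may jump to. -/
def DInstr.target {T : Type*} : DInstr C F M T → Option T
  | .goto t | .ifeq _ t | .ifneq _ t => some t
  | _ => none

theorem DSucc.exists_insn {E : Env C M} {D : DMethod C F M} {p q : ℕ} {τ : Tag C}
    (h : DSucc E D p τ q) : ∃ ins, D.code[p]? = some ins ∧
      (τ = .norm ∧ (ins.FallsThrough ∧ q = p + 1 ∨ ins.target = some q) ∨
        ∃ e, τ = .exc e ∧ e ∈ ins.excTags E D p ∧ handlerOf E D.handlers p e = some q) := by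
  cases h with
  | next h hf => exact ⟨_, h, Or.inl ⟨rfl, Or.inl ⟨hf, rfl⟩⟩⟩
  | goto h => exact ⟨_, h, Or.inl ⟨rfl, Or.inr rfl⟩⟩
  | ifeq h => exact ⟨_, h, Or.inl ⟨rfl, Or.inr rfl⟩⟩
  | ifneq h => exact ⟨_, h, Or.inl ⟨rfl, Or.inr rfl⟩⟩
  | exc h he ht => exact ⟨_, h, Or.inr ⟨_, rfl, he, ht⟩⟩

theorem DInstr.target_resolve {addr : Label → ℕ} (d : DInstr C F M Label) :
    (d.resolve addr).target = d.target.map addr := by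
  cases d <;> rfl

variable (E : Env C M) (P : JMethod C F M) (X : Ctx S C F M) (st : ℕ → StackType S)

/-- The register type at the start of a block. After a call the result is in its pseudo-register
only. A `moveexception` block that some exception reaches starts with the local variables and the
exception; if none does, the type is chosen such that the block is typable all the same. The return
block knows nothing but the register of the value returned. For `insn i` with `i` inside a block it
is the register type at that point. -/
noncomputable def entryType : Label → RegType S
  | .insn i => (st i).flatten X.sgn P.locN
  | .result i =>
    match st (i + 1) with
    | [] => X.sgn.regs P.locN
    | b :: s => (StackType.flatten X.sgn P.locN s).set .ret b
  | .handler h =>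
    open Classical in
    (if ∃ j e, JSucc E P j (.exc e) h then X.sgn.regs P.locN
      else (st h).flatten X.sgn P.locN).set .ex
        (((st h).flatten X.sgn P.locN (.r P.locN)).getD (.base ⊥))
  | .ret => RegType.set (fun _ => none) (.r 0) X.sgn.krNorm

/-- The register type at an output instruction. -/
noncomputable def outType : OutInsn C F M → RegType S
  | (.insn i k, _) => swapType P.locN (st i).length ((st i).flatten X.sgn P.locN) k
  | (_, .goto l) => entryType E P X st l
  | (.result i, _) => entryType E P X st (.result i)
  | (.handler h, _) => entryType E P X st (.handler h)
  | (.ret, _) => entryType E P X st .ret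
  | (.jump _, _) => X.sgn.regs P.locN

open Classical in
/-- The security environment of the translation: at the additional instructions it also has to meet
the guards of the steps that lead to them. -/
noncomputable def originEnv : Origin → S
  | .insn i _ => X.se i
  | .jump i | .result i => X.se i ⊔ guardLevel E P X.Γ (st i) i .norm
  | .handler h => (P.finite_steps E).toFinset.sup fun x =>
      if JSucc E P x.1 x.2 h ∧ x.2 ≠ .norm then
        X.se x.1 ⊔ guardLevel E P X.Γ (st x.1) x.1 x.2 else ⊥
  | .ret => (Finset.range P.code.length).sup fun i =>
      if P.code[i]? = some .ret then X.se i else ⊥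

/-- The output instructions of the translation with symbolic targets, and their origins. -/
noncomputable def JMethod.output : List (OutInsn C F M) :=
  (P.layout E (P.topOfStack E) P.pickOrder).flatMap Prod.snd

/-- The security environment of the translation; `⊥` outside the code. -/
noncomputable def transEnv (p : ℕ) : S :=
  match P.origin? E p with
  | some o => originEnv E P X st o
  | none => ⊥

/-- The register types of the translation. -/
noncomputable def transType (p : ℕ) : RegType S :=
  match (P.output E)[p]? with
  | some x => outType E P X st x
  | none => X.sgn.regs P.locN

variable {E P X st}

theorem origin?_eq (p : ℕ) : P.origin? E p = (P.output E)[p]?.map Prod.fst := by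
  simp [origin?, originsWith, JMethod.output]

theorem code_translate [DecidableEq C] (p : ℕ) : (P.translate E).code[p]? =
    (P.output E)[p]?.map fun x => x.2.resolve fun l =>
      address l (P.layout E (P.topOfStack E) P.pickOrder) := by
  simp [JMethod.translate, translateWith, JMethod.output]

theorem classAnalysis_translate [DecidableEq C] {p i k : ℕ}
    (h : P.origin? E p = some (.insn i k)) :
    (P.translate E).classAnalysis p = P.classAnalysis i := by
  simp only [origin?] at h
  simp [JMethod.translate, translateWith, h]

theorem le_originEnv_handler {j h : ℕ} {e : C} (hs : JSucc E P j (.exc e) h) :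
    X.se j ⊔ guardLevel E P X.Γ (st j) j (.exc e) ≤ originEnv E P X st (.handler h) := by
  classical
  have := Finset.le_sup (f := fun x : ℕ × Tag C => if JSucc E P x.1 x.2 h ∧ x.2 ≠ .norm then
    X.se x.1 ⊔ guardLevel E P X.Γ (st x.1) x.1 x.2 else ⊥)
    ((P.finite_steps E).mem_toFinset.2 (⟨h, hs⟩ : (j, Tag.exc e) ∈ P.steps E))
  simpa only [originEnv, ne_eq, hs, reduceCtorEq, not_false_eq_true, and_self, if_true] using this

theorem originEnv_handler_le {h : ℕ} {k : S} (hk : ∀ j e, JSucc E P j (.exc e) h →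
    X.se j ⊔ guardLevel E P X.Γ (st j) j (.exc e) ≤ k) : originEnv E P X st (.handler h) ≤ k := by
  classical
  refine Finset.sup_le fun x _ => ?_
  obtain ⟨j, τ⟩ := x
  split_ifs with hx
  · cases τ with
    | norm => exact absurd rfl hx.2
    | exc e => exact hk j e hx.1
  · exact bot_le

theorem le_originEnv_ret {i : ℕ} (hi : P.code[i]? = some .ret) :
    X.se i ≤ originEnv E P X st .ret := by
  classical
  have := Finset.le_sup (f := fun i => if P.code[i]? = some .ret then X.se i else ⊥)
    (Finset.mem_range.2 (List.getElem?_eq_some_iff.1 hi).1)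
  simpa only [originEnv, hi, if_true] using this

theorem originEnv_ret_le {k : S} (hk : ∀ i : ℕ, P.code[i]? = some .ret → X.se i ≤ k) :
    originEnv E P X st .ret ≤ k := by
  classical
  refine Finset.sup_le fun i _ => ?_
  split_ifs with hi
  · exact hk i hi
  · exact bot_le

namespace JTyping

theorem guards (h : JTyping E P X st) {i : ℕ} {τ : Tag C} (hs : (i, τ) ∈ P.steps E) :
    X.Guards i τ (guardLevel E P X.Γ (st i) i τ) := by
  obtain ⟨j, hj⟩ := hs
  obtain ⟨_, ht, _⟩ := h.step i τ j hj
  exact ht.guards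

/-- The translated regions respect the guards of the steps. -/
theorem guardLevel_le_transEnv (h : JTyping E P X st) {i k p : ℕ} {τ : Tag C}
    (hs : (i, τ) ∈ P.steps E) (hp : P.origin? E p = some (.insn i k)) :
    ∀ q ∈ P.transRegion E X.region p τ, guardLevel E P X.Γ (st i) i τ ≤ transEnv E P X st q := by
  rintro q ⟨i', k', o, hp', hq, ho⟩
  obtain ⟨rfl, rfl⟩ : i = i' ∧ k = k' := by simpa [hp] using hp'
  have hg := h.guards hs
  rw [transEnv, hq]
  have hnorm : ∀ j, (j ∈ X.region i τ ∨ j = i ∧ τ = .norm) → guardLevel E P X.Γ (st i) i τ ≤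
      X.se j ⊔ guardLevel E P X.Γ (st j) j .norm := by
    rintro j (hj | ⟨rfl, rfl⟩)
    · exact (hg j hj).trans le_sup_left
    · exact le_sup_right
  cases o with
  | insn j _ => exact hg j ho
  | jump j => exact hnorm j ho
  | result j => exact hnorm j ho
  | handler t =>
    rcases ho with ⟨j, hj, e, he⟩ | ⟨e, rfl, he⟩
    · exact ((hg j hj).trans le_sup_left).trans (le_originEnv_handler he)
    · exact le_sup_right.trans (le_originEnv_handler he)
  | ret =>
    obtain ⟨j, hj, hr⟩ := ho
    exact (hg j hj).trans (le_originEnv_ret hr)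

theorem transRegion_eq_empty (hreg : IsControlRegion E P X.region) {i k p : ℕ}
    {e : C} (hx : JExit E P i (.exc e)) (hp : P.origin? E p = some (.insn i k)) :
    P.transRegion E X.region p (.exc e) = ∅ := by
  refine Set.eq_empty_of_forall_notMem ?_
  rintro q ⟨i', k', o, hp', hq, ho⟩
  obtain ⟨rfl, rfl⟩ : i = i' ∧ k = k' := by simpa [hp] using hp'
  have hr := region_eq_empty_of_exit hreg hx
  cases o with
  | handler t =>
    rcases ho with ⟨j, hj, -⟩ | ⟨e', he, hs⟩
    · simp [hr] at hj
    · obtain rfl := Tag.exc.inj he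
      cases hx with
      | exc _ _ hn =>
        cases hs with
        | exc _ _ hs => simp [hn] at hs
  | _ => simp [InRegion, hr] at ho

/-- Going to a label reaches an instruction whose register type is at least the type on entry; the
points without translation in between only forget the top of the stack. -/
theorem entryType_le_of_leads (h : JTyping E P X st) {ts : ℕ → ℕ} {l : Label}
    {c : List (OutInsn C F M)} (hl : Leads E P ts l c) :
    ∃ x c', c = x :: c' ∧ (entryType E P X st l).Le (outType E P X st x) := by
  induction hl with
  | @goto x l c => exact ⟨_, _, rfl, by cases x <;> exact .refl _⟩
  | insn => exact ⟨_, _, rfl, .refl _⟩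
  | @empty i ins l c hi hd hn _ ih =>
    obtain ⟨x, c', hc, hle⟩ := ih
    refine ⟨x, c', hc, RegType.Le.trans ?_ hle⟩
    have key : ∀ j, JSucc E P i .norm j → (∀ st', JTrans E P X i .norm (st i) st' →
        ∃ pre, st i = pre ++ st') →
        (entryType E P X st (.insn i)).Le (entryType E P X st (.insn j)) := by
      intro j hs hpre
      obtain ⟨st', ht, hle⟩ := h.step _ _ _ hs
      obtain ⟨pre, hpre⟩ := hpre st' ht
      simp only [entryType, hpre]
      exact flatten_append_le_of_le _ _ _ hle
    cases ins <;> try (simp [transInstr] at hd; done)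
    case pop =>
      obtain rfl : Label.insn (i + 1) = l := by simpa [nextLabel, hi] using hn
      refine key _ (.next hi trivial) fun st' ht => ?_
      generalize st i = s at ht
      cases ht
      case pop k _ => exact ⟨[k], rfl⟩
      all_goals simp_all
    case goto t =>
      obtain rfl : Label.insn t = l := by simpa [nextLabel, hi] using hn
      refine key _ (.goto hi) fun st' ht => ?_
      generalize st i = s at ht
      cases ht
      case goto => exact ⟨[], rfl⟩
      all_goals simp_all
  | result => exact ⟨_, _, rfl, .refl _⟩
  | handler => exact ⟨_, _, rfl, .refl _⟩
  | ret => exact ⟨_, _, rfl, .refl _⟩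

/-- Where the stack is empty, nothing but a chain of jumps can precede the first instruction. -/
theorem outType_eq_of_leads (h : JTyping E P X st) {ts : ℕ → ℕ} {l : Label}
    {c : List (OutInsn C F M)} (hl : Leads E P ts l c) {i : ℕ} (hli : l = .insn i)
    (hi : st i = []) : ∃ x c', c = x :: c' ∧ outType E P X st x = X.sgn.regs P.locN := by
  induction hl generalizing i with
  | @goto x l c =>
    refine ⟨_, _, rfl, ?_⟩
    subst hli
    have : entryType E P X st (.insn i) = X.sgn.regs P.locN := by
      simp [entryType, hi, flatten_nil]
    cases x <;> exact this
  | insn =>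
    obtain rfl := Label.insn.inj hli
    exact ⟨_, _, rfl, by simp [outType, swapType, hi, flatten_nil]⟩
  | @empty j ins l c hj hd hn _ ih =>
    obtain rfl := Label.insn.inj hli
    cases ins <;> try (simp [transInstr] at hd; done)
    case pop =>
      obtain ⟨st', ht, hle⟩ := h.step _ _ _ (.next hj trivial)
      generalize st j = s at ht hi
      cases ht <;> simp_all
    case goto t =>
      obtain rfl : Label.insn t = l := by simpa [nextLabel, hj] using hn
      refine ih rfl ?_
      obtain ⟨st', ht, hle⟩ := h.step _ _ _ (.goto hj)
      have := ht.length_eq hj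
      have h2 := List.Forall₂.length_eq hle
      simp only [hi, heightAfter, List.length_nil] at this
      exact List.length_eq_zero_iff.1 (h2.symm.trans this)
  | _ => cases hli

theorem entryType_le_transType (h : JTyping E P X st) {l : Label} {p : ℕ}
    (hl : Leads E P (P.topOfStack E) l ((P.output E).drop p)) :
    (entryType E P X st l).Le (transType E P X st p) := by
  obtain ⟨x, c', hc, hle⟩ := h.entryType_le_of_leads hl
  have : (P.output E)[p]? = some x := by
    rw [← List.head?_drop, hc]; rfl
  rwa [transType, this]

theorem entryType_le_transType_address (h : JTyping E P X st) (hv : P.Verified E) {l : Label}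
    (hl : l ∈ P.labels) : (entryType E P X st l).Le (transType E P X st
      (address l (P.layout E (P.topOfStack E) P.pickOrder))) := by
  obtain ⟨hord, hmem, -⟩ := hv.pickOrder_spec
  exact h.entryType_le_transType (hv.leads_address hord.2 (hmem l hl))

/-- An exceptional step into a `moveexception` block. -/
theorem _root_.set_ex_le_entryType {i t : ℕ} {e : C}
    (hs : JSucc E P i (.exc e) t) {rt : RegType S} (hrt : rt.Le (X.sgn.regs P.locN))
    {a : ExtLevel S} (ha : StackType.Le [a] (st t)) :
    (rt.set .ex a).Le (entryType E P X st (.handler t)) := by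
  classical
  have hex : ∃ j e, JSucc E P j (.exc e) t := ⟨i, e, hs⟩
  cases hst : st t with
  | nil => rw [hst] at ha; cases ha
  | cons b s =>
    rw [hst] at ha
    cases ha with
    | cons hab hs' =>
      cases hs'
      have : flatten X.sgn P.locN [b] (.r P.locN) = some b := flatten_append _ _ [] [] b
      simp only [entryType, hex, if_true, hst, this, Option.getD_some]
      exact hrt.set _ hab

/-- The `moveexception` in front of the handler `t` leads to the register type at `t`. If some
exception reaches `t`, the stack there holds just the exception. -/
theorem moveexception_le (h : JTyping E P X st) (hle : ∀ j, ∀ a ∈ st j, X.se j ≤ a.head) (t : ℕ) :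
    ∃ a, entryType E P X st (.handler t) .ex = some a ∧
      ((entryType E P X st (.handler t)).set (.r P.locN)
        (a.join (originEnv E P X st (.handler t)))).Le (entryType E P X st (.insn t)) := by
  classical
  refine ⟨_, RegType.set_self _ _ _, ?_⟩
  by_cases hex : ∃ j e, JSucc E P j (.exc e) t
  · have hlen : (st t).length = 1 := by
      obtain ⟨j, e, hj⟩ := hex
      obtain ⟨st', ht, hle'⟩ := h.step _ _ _ hj
      rw [← List.Forall₂.length_eq hle', ht.length_eq_one]
    obtain ⟨b, hb⟩ := List.length_eq_one_iff.1 hlen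
    have hr : flatten X.sgn P.locN [b] (.r P.locN) = some b := flatten_append _ _ [] [] b
    have hbound : originEnv E P X st (.handler t) ≤ b.head := by
      refine originEnv_handler_le fun j e hj => ?_
      obtain ⟨st', ht, hle'⟩ := h.step _ _ _ hj
      rw [hb] at hle'
      exact sup_le (hle'.forall_head (ht.le_head le_rfl (hle j)) b (by simp))
        (hle'.forall_head ht.guardLevel_le b (by simp))
    simp only [entryType, hex, if_true, hb, hr, Option.getD_some, ExtLevel.join_eq_self hbound]
    rw [flatten_cons, flatten_nil]
    exact (RegType.Le.set_left (.refl _) rfl _).set _ (.refl _)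
  · have hbot : originEnv E P X st (.handler t) = ⊥ := by
      refine le_bot_iff.1 (originEnv_handler_le fun j e hj => absurd ⟨j, e, hj⟩ hex)
    simp only [entryType, hex, if_false, hbot, ExtLevel.join_eq_self bot_le]
    have hex' : ∀ a, (((st t).flatten X.sgn P.locN).set .ex a).Le ((st t).flatten X.sgn P.locN) :=
      fun a => RegType.Le.set_left (.refl _) rfl a
    cases hr : (st t).flatten X.sgn P.locN (.r P.locN) with
    | none => exact (hex' _).set_left hr _
    | some b =>
      have := (hex' b).set (.r P.locN) (ExtLevel.Le.refl b)
      rwa [show ((st t).flatten X.sgn P.locN).set (.r P.locN) b = (st t).flatten X.sgn P.locN from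
        Function.update_eq_self_iff.2 hr.symm] at this

/-- After a call the stack holds the result on top, and its level absorbs the security environment
of the `moveresult`. -/
theorem exists_result (h : JTyping E P X st) (hle : ∀ j, ∀ a ∈ st j, X.se j ≤ a.head)
    {i : ℕ} {m : M} (hi : P.code[i]? = some (.invoke m)) :
    ∃ b s, st (i + 1) = b :: s ∧ s.length = (st i).length - (E.nbArguments m + 1) ∧
      originEnv E P X st (.result i) ≤ b.head := by
  obtain ⟨st', ht, hle'⟩ := h.step i .norm (i + 1) (.next hi trivial)
  have h1 := hle'.forall_head (ht.le_head le_rfl (hle i))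
  have h2 := hle'.forall_head ht.guardLevel_le
  have h3 := ht.length_eq hi
  have h4 := List.Forall₂.length_eq hle'
  have h5 : 0 < st'.length := by
    generalize st i = s at ht
    cases ht
    case invoke => exact Nat.succ_pos _
    all_goals simp_all
  cases hst : st (i + 1) with
  | nil => simp [hst] at h4; simp [h4] at h5
  | cons b s =>
    rw [hst] at h1 h2 h4
    refine ⟨b, s, rfl, ?_, sup_le (h1 b (by simp)) (h2 b (by simp))⟩
    simp only [heightAfter, List.length_cons] at h3 h4
    omega

/-- The value returned and the security environment at a return are bounded by the policy. -/
theorem ret_le (h : JTyping E P X st) {i : ℕ} (hi : P.code[i]? = some .ret) :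
    ∃ k s, st i = k :: s ∧ (k.join (X.se i)).Le X.sgn.krNorm := by
  have := h.exit i .norm (.ret hi)
  generalize st i = s at this
  cases this with
  | ret _ hle => exact ⟨_, _, rfl, hle⟩

end JTyping

end Typing

/-! ### Typability of the translation -/

section Assembly

variable {S C F M : Type*} [SemilatticeSup S] [OrderBot S]
variable {E : Env C M} {P : JMethod C F M} {X : Ctx S C F M} {st : ℕ → StackType S}

open StackType JMethod

/-- Only instructions with a single translation throw, and they throw what the original throws. -/
theorem JMethod.transInstr_eq_singleton_of_mem_excTags {n k : ℕ} {ins : JInstr C F M}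
    {d : DInstr C F M Label}
    {D : DMethod C F M} {p i : ℕ} {addr : Label → ℕ} {e : C}
    (hd : (P.transInstr E n ins)[k]? = some d) (hca : D.classAnalysis p = P.classAnalysis i)
    (he : e ∈ (d.resolve addr).excTags E D p) :
    P.transInstr E n ins = [d] ∧ k = 0 ∧ e ∈ ins.excTags E P i := by
  have hone : ∀ {d'}, P.transInstr E n ins = [d'] → d = d' ∧ k = 0 := by
    intro d' h
    rw [h] at hd
    cases k with
    | zero => exact ⟨(Option.some.inj hd).symm, rfl⟩
    | succ k => simp at hd
  cases ins
  case pop => simp [transInstr] at hd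
  case goto => simp [transInstr] at hd
  case swap =>
    have := List.mem_of_getElem? hd
    simp only [transInstr, List.mem_cons, List.not_mem_nil, or_false] at this
    rcases this with rfl | rfl | rfl | rfl <;> exact absurd he (Set.notMem_empty e)
  all_goals
    obtain ⟨rfl, rfl⟩ := hone rfl
    first
    | exact absurd he (Set.notMem_empty e)
    | exact ⟨rfl, rfl, he⟩
    | (refine ⟨rfl, rfl, ?_⟩
       change e ∈ D.classAnalysis p ∨ e = E.np at he
       rw [hca] at he
       exact he)

theorem DInstr.fallsThrough_resolve {addr : Label → ℕ} (d : DInstr C F M Label) :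
    (d.resolve addr).FallsThrough ↔ d.FallsThrough := by
  cases d <;> rfl

variable (E P X st) in
/-- The context in which the translation of a typing is typed. -/
noncomputable def transCtx : Ctx S C F M :=
  { X with
    region := P.transRegion E X.region
    se := transEnv E P X st
    at' := P.transAt E X.at' }

theorem getElem?_output {p : ℕ} {x : OutInsn C F M} (hp : (P.output E)[p]? = some x) :
    transType E P X st p = outType E P X st x ∧ (transCtx E P X st).se p = originEnv E P X st x.1 ∧
      P.origin? E p = some x.1 := by
  have ho : P.origin? E p = some x.1 := by rw [origin?_eq, hp]; rfl
  have hse : transEnv E P X st p = originEnv E P X st x.1 := by rw [transEnv, ho]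
  exact ⟨by rw [transType, hp], hse, ho⟩

theorem exists_output [DecidableEq C] {p : ℕ} {ins : DInstr C F M ℕ}
    (hp : (P.translate E).code[p]? = some ins) :
    ∃ x : OutInsn C F M, (P.output E)[p]? = some x ∧ ins = x.2.resolve fun l =>
      address l (P.layout E (P.topOfStack E) P.pickOrder) := by
  rw [code_translate, Option.map_eq_some_iff] at hp
  obtain ⟨x, hx, rfl⟩ := hp
  exact ⟨x, hx, rfl⟩

theorem transAt_eq {p i k : ℕ} (hp : P.origin? E p = some (.insn i k)) :
    P.transAt E X.at' p = X.at' i := by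
  rw [transAt, hp]

theorem JMethod.Verified.shape_output (hv : P.Verified E) {p : ℕ} {x : OutInsn C F M}
    (hp : (P.output E)[p]? = some x) :
    Shape E P (P.topOfStack E) x ((P.output E).drop (p + 1)) :=
  (hv.layout_shape hv.pickOrder_spec.1.2).1.shape hp

namespace JTyping

variable [DecidableEq C]

theorem topOfStack_eq_of_getElem? (h : JTyping E P X st) (hv : P.Verified E) {i : ℕ}
    {ins : JInstr C F M} (hi : P.code[i]? = some ins) : P.topOfStack E i = (st i).length :=
  h.topOfStack_eq (hv.reachable _ (List.getElem?_eq_some_iff.1 hi).1)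

/-- An inverted test falls through to the target of the original one and jumps to the point after
it; both are successors of the original. -/
theorem dtrans_ifneq (h : JTyping E P X st) (hv : P.Verified E)
    (hle : ∀ j, ∀ a ∈ st j, X.se j ≤ a.head) {p q i t : ℕ}
    (hi : P.code[i]? = some (.ifeq t)) (hst : P.isStart (i + 1) = true)
    (hl : Leads E P (P.topOfStack E) (.insn t) ((P.output E).drop (p + 1)))
    (hx : (P.output E)[p]? = some (.insn i 0, .ifneq (P.locN + (P.topOfStack E i - 1))
      (.insn (i + 1))))
    (hq : q = p + 1 ∨ q = address (.insn (i + 1)) (P.layout E (P.topOfStack E) P.pickOrder)) :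
    ∃ rt', DTrans E (P.translate E) (transCtx E P X st) p .norm (flatten X.sgn P.locN (st i)) rt' ∧
      rt'.Le (transType E P X st q) := by
  have hins' : (P.translate E).code[p]? = some (.ifneq (P.locN + (P.topOfStack E i - 1))
      (address (.insn (i + 1)) (P.layout E (P.topOfStack E) P.pickOrder))) := by
    rw [code_translate, hx]; rfl
  obtain ⟨-, hse, ho⟩ := getElem?_output (X := X) (st := st) hx
  have hq' : ∃ j, JSucc E P i .norm j ∧
      (entryType E P X st (.insn j)).Le (transType E P X st q) := by
    rcases hq with rfl | rfl
    · exact ⟨t, .ifeq hi, h.entryType_le_transType hl⟩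
    · exact ⟨i + 1, .next hi trivial,
        h.entryType_le_transType_address hv (insn_mem_labels.2 hst)⟩
  obtain ⟨j, hj, hle'⟩ := hq'
  obtain ⟨st', ht, hst'⟩ := h.step i .norm j hj
  have hg := h.guardLevel_le_transEnv ⟨j, hj⟩ ho
  have hlev := hle i
  simp only [guardLevel, hi] at hg
  rw [h.topOfStack_eq_of_getElem? hv hi] at hins'
  have hent : (flatten X.sgn P.locN st').Le (entryType E P X st (.insn j)) :=
    flatten_mono _ _ hst'
  change _ = X.se i at hse
  generalize st i = s at ht hg hlev hins'
  cases ht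
  case ifeq k s _ _ =>
    refine ⟨_, .ifneq hins' (flatten_append X.sgn P.locN [] s k) ?_,
      ((flatten_append_le_of_le X.sgn P.locN [k] (le_lift _ s)).trans hent).trans hle'⟩
    intro q hq
    exact sup_le (hse.le.trans ((hlev k (by simp)).trans (hg q hq))) (hg q hq)
  all_goals simp_all

theorem dtrans_swap (h : JTyping E P X st)
    (hle : ∀ j, ∀ a ∈ st j, X.se j ≤ a.head) {p i k : ℕ}
    {d : DInstr C F M Label} (hx : (P.output E)[p]? = some (.insn i k, d))
    (hi : P.code[i]? = some .swap)
    (hd : (P.transInstr E (st i).length .swap)[k]? = some d)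
    (hin : ∀ d', (P.transInstr E (st i).length .swap)[k + 1]? = some d' →
      ((P.output E).drop (p + 1)).head? = some (.insn i (k + 1), d'))
    (hout : (P.transInstr E (st i).length .swap)[k + 1]? = none → ∀ l, P.nextLabel i = some l →
      Leads E P (P.topOfStack E) l ((P.output E).drop (p + 1))) :
    ∃ rt', DTrans E (P.translate E) (transCtx E P X st) p .norm (outType E P X st (.insn i k, d))
      rt' ∧ rt'.Le (transType E P X st (p + 1)) := by
  have hins' : (P.translate E).code[p]? = some (d.resolve fun l =>
      address l (P.layout E (P.topOfStack E) P.pickOrder)) := by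
    rw [code_translate, hx]; rfl
  obtain ⟨-, hse, ho⟩ := getElem?_output (X := X) (st := st) hx
  change _ = X.se i at hse
  obtain ⟨st', ht, hst'⟩ := h.step i .norm (i + 1) (.next hi trivial)
  obtain ⟨rt', h1, h2, h3⟩ := ht.dtrans_swap (R := P.transRegion E X.region)
    (at'' := P.transAt E X.at') (hle i) hi hd hins' hse
  refine ⟨rt', h1, ?_⟩
  have hk4 : k < 4 := by
    obtain ⟨h, -⟩ := List.getElem?_eq_some_iff.1 hd
    simpa [transInstr] using h
  rcases Nat.lt_or_ge k 3 with hk3 | hk3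
  · obtain ⟨d', hd'⟩ : ∃ d', (P.transInstr E (st i).length .swap)[k + 1]? = some d' :=
      ⟨_, List.getElem?_eq_getElem (by simp [transInstr]; omega)⟩
    have hnext := hin d' hd'
    rw [List.head?_drop] at hnext
    rw [h2 hk3, (getElem?_output hnext).1]
    exact .refl _
  · obtain rfl : k = 3 := by omega
    refine ((h3 rfl).trans (flatten_mono _ _ hst')).trans ?_
    exact h.entryType_le_transType (hout rfl (.insn (i + 1)) (by simp [nextLabel, hi]))

theorem dtrans_invoke (h : JTyping E P X st) {p i : ℕ} {m : M}
    {d : DInstr C F M Label} (hx : (P.output E)[p]? = some (.insn i 0, d))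
    (hi : P.code[i]? = some (.invoke m))
    (hd : P.transInstr E (st i).length (.invoke m) = [d])
    (hout : Leads E P (P.topOfStack E) (.result i) ((P.output E).drop (p + 1))) :
    ∃ rt', DTrans E (P.translate E) (transCtx E P X st) p .norm (outType E P X st (.insn i 0, d))
      rt' ∧ rt'.Le (transType E P X st (p + 1)) := by
  have hins' : (P.translate E).code[p]? = some (d.resolve fun l =>
      address l (P.layout E (P.topOfStack E) P.pickOrder)) := by
    rw [code_translate, hx]; rfl
  obtain rfl := (List.cons.inj hd).1
  obtain ⟨-, hse, ho⟩ := getElem?_output (X := X) (st := st) hx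
  change _ = X.se i at hse
  have hs : JSucc E P i .norm (i + 1) := .next hi trivial
  obtain ⟨st', ht, hst'⟩ := h.step i .norm (i + 1) hs
  obtain ⟨rt', b, s, rfl, h1, h2⟩ := ht.dtrans_invoke (at'' := P.transAt E X.at') hi rfl
    hins' hse (h.guardLevel_le_transEnv ⟨_, hs⟩ ho)
  refine ⟨rt', h1, (h2.trans ?_).trans
    (h.entryType_le_transType hout)⟩
  cases hb : st (i + 1) with
  | nil => rw [hb] at hst'; cases hst'
  | cons b' s' =>
    rw [hb] at hst'
    cases hst' with
    | cons hbb hss =>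
      simp only [entryType, hb]
      exact (flatten_mono _ _ hss).set _ hbb

/-- The normal steps of the instructions that translate a point. -/
theorem dtrans_insn_norm (h : JTyping E P X st) (hv : P.Verified E)
    (hle : ∀ j, ∀ a ∈ st j, X.se j ≤ a.head) {p q i k : ℕ} {ins : JInstr C F M}
    {d : DInstr C F M Label} (hx : (P.output E)[p]? = some (.insn i k, d))
    (hi : P.code[i]? = some ins) (hd : (P.transInstr E (st i).length ins)[k]? = some d)
    (hin : ∀ d', (P.transInstr E (st i).length ins)[k + 1]? = some d' →
      ((P.output E).drop (p + 1)).head? = some (.insn i (k + 1), d'))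
    (hout : (P.transInstr E (st i).length ins)[k + 1]? = none → ∀ l, P.nextLabel i = some l →
      Leads E P (P.topOfStack E) l ((P.output E).drop (p + 1)))
    (hq : d.FallsThrough ∧ q = p + 1 ∨
      d.target.map (fun l => address l (P.layout E (P.topOfStack E) P.pickOrder)) = some q) :
    ∃ rt', DTrans E (P.translate E) (transCtx E P X st) p .norm (outType E P X st (.insn i k, d))
      rt' ∧ rt'.Le (transType E P X st q) := by
  have hins' : (P.translate E).code[p]? = some (d.resolve fun l =>
      address l (P.layout E (P.topOfStack E) P.pickOrder)) := by
    rw [code_translate, hx]; rfl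
  obtain ⟨-, hse, ho⟩ := getElem?_output (X := X) (st := st) hx
  change _ = X.se i at hse
  -- the instructions with a single translation that continue at a program point
  have hsingle : P.transInstr E (st i).length ins = [d] → k = 0 → (∀ m, ins ≠ .invoke m) →
      ∀ j, JSucc E P i .norm j →
        (entryType E P X st (.insn j)).Le (transType E P X st q) →
      ∃ rt', DTrans E (P.translate E) (transCtx E P X st) p .norm
          (outType E P X st (.insn i k, d)) rt' ∧
        rt'.Le (transType E P X st q) := by
    rintro hd' rfl hinv j hj hjq
    obtain ⟨st', ht, hst'⟩ := h.step i .norm j hj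
    obtain ⟨rt', h1, h2⟩ := ht.dtrans_norm hv (hle i) hi hd' hins' hse (transAt_eq ho)
      (h.guardLevel_le_transEnv ⟨j, hj⟩ ho) hinv
    exact ⟨rt', h1, (h2.trans (flatten_mono _ _ hst')).trans hjq⟩
  have hk : ∀ {d'}, P.transInstr E (st i).length ins = [d'] → d = d' ∧ k = 0 := by
    intro d' hd'
    rw [hd'] at hd
    cases k with
    | zero => exact ⟨(Option.some.inj hd).symm, rfl⟩
    | succ k => simp at hd
  have hlast : ∀ {l}, P.transInstr E (st i).length ins = [d] → k = 0 →
      P.nextLabel i = some l →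
      (entryType E P X st l).Le (transType E P X st (p + 1)) := by
    rintro l hd' rfl hl
    exact h.entryType_le_transType (hout (by rw [hd']; rfl) l hl)
  cases ins
  case pop => simp [transInstr] at hd
  case goto => simp [transInstr] at hd
  case throw =>
    obtain ⟨rfl, -⟩ := hk rfl
    rcases hq with ⟨hf, -⟩ | hq
    · exact hf.elim
    · simp [DInstr.target] at hq
  case ret =>
    obtain ⟨rfl, rfl⟩ := hk rfl
    rcases hq with ⟨-, rfl⟩ | hq
    · obtain ⟨a, s, hs, ha⟩ := h.ret_le hi
      have hr : flatten X.sgn P.locN (st i) (.r (P.locN + ((st i).length - 1))) = some a := by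
        rw [hs]
        exact flatten_append X.sgn P.locN [] s a
      refine ⟨_, .move hins' hr, RegType.Le.trans ?_ (hlast rfl rfl (by simp [nextLabel, hi]; rfl))⟩
      refine RegType.Le.set (fun _ _ h => by cases h) _ ?_
      rw [hse]
      exact ha
    · simp [DInstr.target] at hq
  case swap =>
    have hq' : q = p + 1 := by
      rcases hq with ⟨-, rfl⟩ | hq
      · rfl
      · have := List.mem_of_getElem? hd
        simp only [transInstr, List.mem_cons, List.not_mem_nil, or_false] at this
        rcases this with rfl | rfl | rfl | rfl <;> simp [DInstr.target] at hq
    subst hq'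
    exact h.dtrans_swap hle hx hi hd hin hout
  case invoke m =>
    obtain ⟨rfl, rfl⟩ := hk rfl
    rcases hq with ⟨-, rfl⟩ | hq
    · exact h.dtrans_invoke hx hi rfl (hout rfl (.result i) (by simp [nextLabel, hi]))
    · simp [DInstr.target] at hq
  case ifeq t =>
    obtain ⟨rfl, rfl⟩ := hk rfl
    rcases hq with ⟨-, rfl⟩ | hq
    · exact hsingle rfl rfl (by simp) (i + 1) (.next hi trivial)
        (hlast rfl rfl (by simp [nextLabel, hi]))
    · obtain rfl := Option.some.inj hq
      exact hsingle rfl rfl (by simp) t (.ifeq hi)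
        (h.entryType_le_transType_address hv (insn_mem_labels.2 (hv.isStart_ifeq hi)))
  all_goals
    obtain ⟨rfl, rfl⟩ := hk rfl
    rcases hq with ⟨-, rfl⟩ | hq
    · exact hsingle rfl rfl (by simp) (i + 1) (.next hi trivial)
        (hlast rfl rfl (by simp [nextLabel, hi]))
    · simp [DInstr.target] at hq

/-- The exceptional steps lead to the `moveexception` block of the handler. -/
theorem dtrans_insn_exc (h : JTyping E P X st) (hv : P.Verified E) {p q i k : ℕ}
    {ins : JInstr C F M} {d : DInstr C F M Label} {e : C}
    (hx : (P.output E)[p]? = some (.insn i k, d)) (hi : P.code[i]? = some ins)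
    (hd : (P.transInstr E (st i).length ins)[k]? = some d)
    (he : e ∈ (d.resolve fun l => address l (P.layout E (P.topOfStack E) P.pickOrder)).excTags E
      (P.translate E) p)
    (ht : handlerOf E (P.translate E).handlers p e = some q) :
    ∃ rt', DTrans E (P.translate E) (transCtx E P X st) p (.exc e)
      (outType E P X st (.insn i k, d)) rt' ∧ rt'.Le (transType E P X st q) := by
  have hins' : (P.translate E).code[p]? = some (d.resolve fun l =>
      address l (P.layout E (P.topOfStack E) P.pickOrder)) := by
    rw [code_translate, hx]; rfl
  obtain ⟨-, hse, ho⟩ := getElem?_output (X := X) (st := st) hx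
  have hca := classAnalysis_translate (E := E) (P := P) ho
  obtain ⟨hd', rfl, he'⟩ := transInstr_eq_singleton_of_mem_excTags hd hca he
  have hthrow := mayThrow_of_mem_excTags hi he'
  have ht' := ht
  rw [JMethod.translate, hv.handlerOf_translate hx hthrow, Option.map_eq_some_iff] at ht'
  obtain ⟨t, ht', rfl⟩ := ht'
  have hs : JSucc E P i (.exc e) t := .exc hi he' ht'
  obtain ⟨st', hst, hst'⟩ := h.step _ _ _ hs
  obtain ⟨rt, a, rfl, h1, h2⟩ := hst.dtrans_exc hi hd' hins' hse rfl hca ht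
    (h.guardLevel_le_transEnv ⟨_, hs⟩ ho) (at'' := P.transAt E X.at')
  obtain ⟨x, hx1, hx2⟩ := mem_handlersAt_of_handlerOf ht'
  refine ⟨_, h2, (set_ex_le_entryType hs h1 hst').trans
    (h.entryType_le_transType_address hv (handler_mem_labels.2 ?_))⟩
  exact hx2 ▸ hv.mem_usedHandlers_of_mem hthrow hx1

theorem dtrans_of_dSucc (h : JTyping E P X st) (hv : P.Verified E)
    (hle : ∀ j, ∀ a ∈ st j, X.se j ≤ a.head) {p q : ℕ} {τ : Tag C}
    (hs : DSucc E (P.translate E) p τ q) :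
    ∃ rt', DTrans E (P.translate E) (transCtx E P X st) p τ (transType E P X st p) rt' ∧
      rt'.Le (transType E P X st q) := by
  obtain ⟨ins', hins', hs⟩ := hs.exists_insn
  obtain ⟨⟨o, d⟩, hx, rfl⟩ := exists_output hins'
  obtain ⟨hrt, hse, -⟩ := getElem?_output (X := X) (st := st) hx
  rw [DInstr.target_resolve] at hs
  have hsh := hv.shape_output hx
  rw [hrt]
  generalize hrest : (P.output E).drop (p + 1) = c at hsh
  cases hsh with
  | @goto x s _ hmem =>
    rcases hs with ⟨rfl, ⟨hf, -⟩ | hq⟩ | ⟨e, -, he, -⟩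
    · exact hf.elim
    · obtain rfl := Option.some.inj hq
      refine ⟨_, .goto hins', ?_⟩
      rw [show outType E P X st (P.gotoOrigin x, .goto s) = entryType E P X st s by
        cases x <;> rfl]
      exact h.entryType_le_transType_address hv hmem
    · exact he.elim
  | @ifneq i t _ hi hst hl =>
    rcases hs with ⟨rfl, hq⟩ | ⟨e, -, he, -⟩
    · exact h.dtrans_ifneq hv hle hi hst (hrest ▸ hl) hx
        (hq.imp And.right fun hq => (Option.some.inj hq).symm)
    · exact he.elim
  | @result i m _ hi hl =>
    rcases hs with ⟨rfl, ⟨-, rfl⟩ | hq⟩ | ⟨e, -, he, -⟩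
    · obtain ⟨b, s, hb, hlen, hbound⟩ := h.exists_result hle hi
      have hrt' : outType E P X st (.result i, .moveresult (P.locN +
          (P.topOfStack E i - (E.nbArguments m + 1)))) = (flatten X.sgn P.locN s).set .ret b := by
        simp only [outType, entryType, hb]
      rw [hrt']
      refine ⟨_, .moveresult hins' (RegType.set_self _ _ b),
        RegType.Le.trans ?_ (h.entryType_le_transType (hrest ▸ hl))⟩
      simp only [entryType, hb]
      rw [flatten_cons, h.topOfStack_eq_of_getElem? hv hi, ← hlen, hse,
        ExtLevel.join_eq_self hbound]
      exact (RegType.Le.set_left (.refl _) rfl _).set _ (.refl _)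
    · simp [DInstr.target] at hq
    · exact he.elim
  | @handler t _ hu hl =>
    rcases hs with ⟨rfl, ⟨-, rfl⟩ | hq⟩ | ⟨e, -, he, -⟩
    · obtain ⟨a, ha, hle'⟩ := h.moveexception_le hle t
      refine ⟨_, .moveexception hins' ha,
        RegType.Le.trans ?_ (h.entryType_le_transType (hrest ▸ hl))⟩
      rw [hse]
      exact hle'
    · simp [DInstr.target] at hq
    · exact he.elim
  | ret =>
    rcases hs with ⟨rfl, ⟨hf, -⟩ | hq⟩ | ⟨e, -, he, -⟩
    · exact hf.elim
    · simp [DInstr.target] at hq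
    · exact he.elim
  | @insn i k ins _ _ hi hd hin hout =>
    rw [h.topOfStack_eq_of_getElem? hv hi] at hd hin hout
    rcases hs with ⟨rfl, hq⟩ | ⟨e, rfl, he, ht⟩
    · subst hrest
      exact h.dtrans_insn_norm hv hle hx hi hd hin hout (hq.imp_left <|
        And.imp_left (DInstr.fallsThrough_resolve d).1)
    · exact h.dtrans_insn_exc hv hx hi hd he ht

theorem dtransExit_of_dExit (h : JTyping E P X st) (hv : P.Verified E)
    (hreg : IsControlRegion E P X.region) (hle : ∀ j, ∀ a ∈ st j, X.se j ≤ a.head) {p : ℕ}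
    {τ : Tag C} (hxit : DExit E (P.translate E) p τ) :
    DTransExit E (P.translate E) (transCtx E P X st) p τ (transType E P X st p) := by
  cases hxit with
  | @ret rs hp =>
    obtain ⟨⟨o, d⟩, hx, hd⟩ := exists_output hp
    obtain ⟨hrt, hse, ho⟩ := getElem?_output (X := X) (st := st) hx
    have hsh := hv.shape_output hx
    rw [hrt]
    have hnot : ∀ {k n : ℕ} {ins : JInstr C F M},
        (P.transInstr E n ins)[k]? ≠ some d := by
      intro k n ins hk
      have := List.mem_of_getElem? hk
      cases ins <;> simp only [transInstr, List.mem_cons, List.not_mem_nil, or_false] at this <;>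
        first
        | (subst this; simp [DInstr.resolve] at hd)
        | (rcases this with rfl | rfl | rfl | rfl <;> simp [DInstr.resolve] at hd)
    generalize (P.output E).drop (p + 1) = c at hsh
    cases hsh with
    | @ret i _ hi =>
      obtain rfl := DInstr.ret.inj hd
      have hr : outType E P X st (.ret, .ret 0) (.r 0) = some X.sgn.krNorm :=
        RegType.set_self (fun _ => none) (.r 0) X.sgn.krNorm
      refine .ret hp hr ?_
      have hbound : originEnv E P X st .ret ≤ X.sgn.krNorm.head := originEnv_ret_le fun j hj => by
        obtain ⟨k, s, -, hk⟩ := h.ret_le hj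
        exact le_sup_left.trans ((ExtLevel.head_join _ _).symm.le.trans hk.head)
      simp only [hse, ExtLevel.join_eq_self hbound]
      exact .refl _
    | insn hi hd' => exact (hnot hd').elim
    | _ => simp [DInstr.resolve] at hd
  | @exc ins' e hp he ht =>
    obtain ⟨⟨o, d⟩, hx, rfl⟩ := exists_output hp
    obtain ⟨hrt, hse, ho⟩ := getElem?_output (X := X) (st := st) hx
    have hsh := hv.shape_output hx
    rw [hrt]
    generalize (P.output E).drop (p + 1) = c at hsh
    cases hsh with
    | @insn i k ins _ _ hi hd hin hout =>
      have hca := classAnalysis_translate (E := E) (P := P) ho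
      rw [h.topOfStack_eq_of_getElem? hv hi] at hd
      obtain ⟨hd', rfl, he'⟩ := transInstr_eq_singleton_of_mem_excTags hd hca he
      have hthrow := mayThrow_of_mem_excTags hi he'
      have ht' := ht
      rw [JMethod.translate, hv.handlerOf_translate hx hthrow, Option.map_eq_none_iff] at ht'
      have hxit : JExit E P i (.exc e) := .exc hi he' ht'
      exact (h.exit _ _ hxit).dtransExit_exc (hle i) hi hd' hp hse hca ht
        (transRegion_eq_empty hreg hxit ho)
    | _ => exact he.elim

/-- The translation of a typing whose security environment is below all levels on the stacks. -/
theorem dTyping (h : JTyping E P X st) (hv : P.Verified E)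
    (hreg : IsControlRegion E P X.region) (hle : ∀ j, ∀ a ∈ st j, X.se j ≤ a.head) :
    DTyping E (P.translate E) (transCtx E P X st) (transType E P X st) := by
  refine ⟨?_, fun _ _ _ => h.dtrans_of_dSucc hv hle,
    fun _ _ => h.dtransExit_of_dExit hv hreg hle⟩
  -- the first block is that of the entry point, where the stack is empty
  obtain ⟨hord, -, ls, hls⟩ := hv.pickOrder_spec
  have hlead := hv.leads_address (ts := P.topOfStack E) hord.2 (l := .insn 0) (by simp [hls])
  have haddr : address (.insn 0) (P.layout E (P.topOfStack E) P.pickOrder) = 0 := by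
    simp [hls, layout, address]
  rw [haddr, List.drop_zero] at hlead
  obtain ⟨x, c, hc, hx⟩ := h.outType_eq_of_leads hlead rfl h.entry
  have : (P.output E)[0]? = some x := by rw [JMethod.output, hc]; rfl
  rw [transType, this]
  exact hx

end JTyping

end Assembly

theorem mainTheorem2 {S C F M N : Type*} [SemilatticeSup S] [OrderBot S] [DecidableEq C]
    (E : Env C M) (Γ : M → S → Policy S C) (ft : F → ExtLevel S) (P : JProgram C F M N)
    (region : N → ℕ → Tag C → Set ℕ) (at' : N → ℕ → ExtLevel S)
    (hverified : ∀ m, (P.body m).Verified E)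
    (hregion : ∀ m, IsControlRegion E (P.body m) (region m)) :
    (P.Typable E Γ ft region at' →
      (P.translate E).Typable E Γ ft
        (fun m => (P.body m).transRegion E (region m))
        (fun m => (P.body m).transAt E (at' m))) ∧
    ∀ (m : N) (k : S) (se : ℕ → S) (st : ℕ → StackType S),
      JTyping E (P.body m) ⟨Γ, ft, Γ (P.mid m) k, region m, se, at' m⟩ st →
      ∃ (se₁ : ℕ → S) (se' : ℕ → S) (rt : ℕ → RegType S),
        (∀ i, se₁ i ≤ se i) ∧
        JTyping E (P.body m) ⟨Γ, ft, Γ (P.mid m) k, region m, se₁, at' m⟩ st ∧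
        DTyping E ((P.body m).translate E)
          ⟨Γ, ft, Γ (P.mid m) k, (P.body m).transRegion E (region m), se',
            (P.body m).transAt E (at' m)⟩ rt ∧
        (∀ p i n, (P.body m).origin? E p = some (.insn i n) → se' p = se₁ i) ∧
        (∀ p i, (P.body m).origin? E p = some (.insn i 0) →
          rt p = (st i).flatten (Γ (P.mid m) k) (P.body m).locN) := by
  have key : ∀ (m : N) (k : S) (se : ℕ → S) (st : ℕ → StackType S),
      JTyping E (P.body m) ⟨Γ, ft, Γ (P.mid m) k, region m, se, at' m⟩ st →
      ∃ (se₁ : ℕ → S) (se' : ℕ → S) (rt : ℕ → RegType S),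
        (∀ i, se₁ i ≤ se i) ∧
        JTyping E (P.body m) ⟨Γ, ft, Γ (P.mid m) k, region m, se₁, at' m⟩ st ∧
        DTyping E ((P.body m).translate E)
          ⟨Γ, ft, Γ (P.mid m) k, (P.body m).transRegion E (region m), se',
            (P.body m).transAt E (at' m)⟩ rt ∧
        (∀ p i n, (P.body m).origin? E p = some (.insn i n) → se' p = se₁ i) ∧
        (∀ p i, (P.body m).origin? E p = some (.insn i 0) →
          rt p = (st i).flatten (Γ (P.mid m) k) (P.body m).locN) := by
    intro m k se st h
    have h' := h.lower (hregion m)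
    refine ⟨_, _, _, h.leastEnv_le_se, h',
      h'.dTyping (hverified m) (hregion m) (h.leastEnv_le_head (hregion m)), ?_, ?_⟩
    · intro p i n hp
      rw [transEnv, hp]
      rfl
    · intro p i hp
      rw [origin?_eq, Option.map_eq_some_iff] at hp
      obtain ⟨⟨o, d⟩, hx, rfl⟩ := hp
      rw [transType, hx]
      rfl
  refine ⟨fun h m k => ?_, key⟩
  obtain ⟨se, st, hst⟩ := h m k
  obtain ⟨_, se', rt, -, -, hd, -⟩ := key m k se st hst
  exact ⟨se', rt, hd⟩
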